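/- Let $\Omega\subset\mathbb R^2$ be a polygon, that is, a bounded domain whose Lipschitz boundary is a finite union of line segments. Let $\alpha,\sigma\in\mathbb R$, $\gamma\ge 1$, $\mu,c>0$, $M\in\mathbb R$, $\kappa\in\mathbb N$ and $h_0<1$. Then there is a constant $C>0$, depending only on these data, such that the following holds. Let $\mathcal T_h$ be a conforming triangulation of $\Omega$ with mesh size $h=\max_{\tau\in\mathcal T_h}\operatorname{diam}\tau\le h_0$ which is shape regular (each $\tau\in\mathcal T_h$ contains a disk of radius $\operatorname{diam}\tau/\mu$) and satisfies $$\min_{\tau\in\mathcal T_h}\operatorname{diam}\tau\ \ge\ c\,h^{\gamma}$$ and the $(\alpha,\sigma)$-condition with constants $M,\kappa$, i.e.: 1. The set of interior edges is a disjoint union $\mathcal E_1\uplus\mathcal E_2$ such that, for each $e\in\mathcal E_1$, the two triangles $\tau,\tau'$ sharing $e$ form an approximate parallelogram: the lengths of any two opposite edges of $\tau\cup\tau'$ differ by at most $Mh^{1+\alpha}$; and $\sum_{e\in\mathcal E_2}(|\tau|+|\tau'|)\le Mh^{\sigma}$. 2. The set of vertices of $\mathcal T_h$ on $\partial\Omega$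 is a disjoint union $\mathcal P_1\uplus\mathcal P_2$ with $|\mathcal P_2|\le\kappa$ such that the following holds for each $x\in\mathcal P_1$. Let $e,e'$ be the two boundary edges with endpoint $x$, let $\tau,\tau'$ be the triangles having $e,e'$ as edges, and let $\boldsymbol t,\boldsymbol t'$ be the unit tangents to $e,e'$, oriented counterclockwise along $\partial\tau,\partial\tau'$. Pair the edges of $\tau$ and $\tau'$ by going counterclockwise along $\partial\tau$ from $e$ and along $\partial\tau'$ from $e'$. Then the lengths of paired edges differ by at most $Mh^{1+\alpha}$, and $|\boldsymbol t-\boldsymbol t'|\le Mh^{\alpha}$. Let $\boldsymbol p\in W^{2,\infty}(\Omega)^2$. Let $\Pi_h\boldsymbol p$ be its lowest order Raviart--Thomas interpolant: on each $\tau\in\mathcal T_h$ it is the field of the form $\boldsymbol a+b\boldsymbol x$, with $\boldsymbol a\in\mathbb R^2$ and $b\in\mathbb R$, such that $\int_{e_k}\Pi_h\boldsymbol p\cdot\boldsymbol n_k=\int_{e_k}\boldsymbol p\cdot\boldsymbol n_k$ for the three edges $e_k$ of $\tau$ with outward unit normals $\boldsymbol n_k$. Let $\boldsymbol q_h=\left(\partial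 w_h/\partial x_2,\,-\partial w_h/\partial x_1\right)$ for a continuous function $w_h$ on $\overline\Omega$ that is affine on each $\tau\in\mathcal T_h$. Then $$\left|\int_\Omega(\boldsymbol p-\Pi_h\boldsymbol p)\cdot\boldsymbol q_h\right|\ \le\ C\,h^{1+\rho}\,|\log h|^{1/2}\,\|\nabla\boldsymbol p\|_{1,\infty,\Omega}\,\|\boldsymbol q_h\|_{0,\Omega},\qquad \rho=\min\left(1,\;1+\alpha-\gamma,\;\frac{\sigma}{2}\right).$$ Here $\|\nabla\boldsymbol p\|_{1,\infty,\Omega}$ is the largest $L^\infty(\Omega)$ norm of a first or second order weak partial derivative of a component of $\boldsymbol p$, and $\|\cdot\|_{0,\Omega}$ is the norm of $L^2(\Omega)^2$. -/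

import Mathlib

open MeasureTheory Set

noncomputable section

namespace RTMixed

/-- The Euclidean plane. -/
abbrev Plane : Type := EuclideanSpace ℝ (Fin 2)

/-- `Ω` is a polygon: a bounded domain (nonempty, open, connected) whose boundary is a finite union
of line segments and is Lipschitz, i.e. near each boundary point, in suitable Cartesian coordinates,
`Ω` is the region strictly above the graph of a Lipschitz function. -/
structure IsLipschitzPolygon (Ω : Set Plane) : Prop where
  isOpen : IsOpen Ω
  isConnected : IsConnected Ω
  isBounded : Bornology.IsBounded Ω
  polygonal : ∃ S : Finset (Plane × Plane), frontier Ω = ⋃ s ∈ S, segment ℝ s.1 s.2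
  lipschitz : ∀ x ∈ frontier Ω, ∃ (R : Plane ≃ₗᵢ[ℝ] Plane) (φ : ℝ → ℝ) (L : NNReal) (r : ℝ),
    0 < r ∧ LipschitzWith L φ ∧ ∀ y ∈ Metric.ball x r, (y ∈ Ω ↔ φ (R y 0) < R y 1)

/-! ### Sobolev spaces with exponent infinity -/

/-- The classical partial derivative `∂ᵢ u` at `x`. -/
def partialDeriv (i : Fin 2) (u : Plane → ℝ) (x : Plane) : ℝ :=
  fderiv ℝ u x (EuclideanSpace.single i 1)

/-- `v` is the weak partial derivative `∂ⱼ u` on `Ω`. -/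
def HasWeakDeriv (Ω : Set Plane) (j : Fin 2) (u v : Plane → ℝ) : Prop :=
  LocallyIntegrableOn u Ω ∧ LocallyIntegrableOn v Ω ∧
    ∀ φ : Plane → ℝ, ContDiff ℝ (⊤ : ℕ∞) φ → HasCompactSupport φ → tsupport φ ⊆ Ω →
      ∫ x in Ω, u x * partialDeriv j φ x = - ∫ x in Ω, v x * φ x

open Classical in
/-- The weak partial derivative `∂ⱼ u` on `Ω` (unique up to null sets; `0` if there is none). -/
def weakDeriv (Ω : Set Plane) (j : Fin 2) (u : Plane → ℝ) : Plane → ℝ :=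
  if h : ∃ v, HasWeakDeriv Ω j u v then h.choose else 0

/-- `u ∈ W^{k,∞}(Ω)`. -/
def MemSobolevInf (Ω : Set Plane) : ℕ → (Plane → ℝ) → Prop
  | 0, u => MemLp u ⊤ (volume.restrict Ω)
  | k + 1, u => MemLp u ⊤ (volume.restrict Ω) ∧
      ∀ j, ∃ v, HasWeakDeriv Ω j u v ∧ MemSobolevInf Ω k v

/-- `‖u‖_{k,∞,Ω}`: the largest `L^∞` norm of a weak derivative of order at most `k`. -/
def sobolevInfNorm (Ω : Set Plane) : ℕ → (Plane → ℝ) → ENNReal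
  | 0, u => eLpNorm u ⊤ (volume.restrict Ω)
  | k + 1, u => eLpNorm u ⊤ (volume.restrict Ω) ⊔ ⨆ j, sobolevInfNorm Ω k (weakDeriv Ω j u)

/-- `p ∈ W^{2,∞}(Ω)²`, given by its continuous representative on the closure of `Ω` (so that
integrals of `p` over edges make sense). -/
def MemW2InfVec (Ω : Set Plane) (p : Plane → Plane) : Prop :=
  ContinuousOn p (closure Ω) ∧ ∀ i, MemSobolevInf Ω 2 (fun x => p x i)

/-- `‖∇p‖_{1,∞,Ω}`. -/
def gradNorm1Inf (Ω : Set Plane) (p : Plane → Plane) : ℝ :=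
  (⨆ (i : Fin 2) (j : Fin 2), sobolevInfNorm Ω 1 (weakDeriv Ω j (fun x => p x i))).toReal

/-- `‖q‖_{0,Ω}`, the norm of `L²(Ω)²`. -/
def l2Norm (Ω : Set Plane) (q : Plane → Plane) : ℝ :=
  (eLpNorm q 2 (volume.restrict Ω)).toReal

/-! ### Triangles -/

/-- A nondegenerate triangle with vertices `a 0, a 1, a 2` in counterclockwise order. Indices are
added modulo `3`. -/
structure Triangle where
  a : Fin 3 → Plane
  ccw : 0 < (a 1 0 - a 0 0) * (a 2 1 - a 0 1) - (a 1 1 - a 0 1) * (a 2 0 - a 0 0)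

namespace Triangle

variable (τ : Triangle)

/-- The closed triangle as a point set. -/
def carrier : Set Plane := convexHull ℝ (range τ.a)

/-- The edge `e_k` opposite to `a k`, as the unordered pair of its endpoints. -/
def edge (k : Fin 3) : Sym2 Plane := s(τ.a (k + 1), τ.a (k + 2))

/-- The edge `e_k` as a point set. -/
def edgeSet (k : Fin 3) : Set Plane := segment ℝ (τ.a (k + 1)) (τ.a (k + 2))

/-- The length `ℓ_k` of `e_k`. -/
def len (k : Fin 3) : ℝ := dist (τ.a (k + 1)) (τ.a (k + 2))

/-- The unit tangent `t_k` to `e_k`, oriented counterclockwise. -/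
def tangent (k : Fin 3) : Plane := (τ.len k)⁻¹ • (τ.a (k + 2) - τ.a (k + 1))

/-- The outward unit normal `n_k` to `e_k`: the tangent rotated clockwise by a right angle. -/
def normal (k : Fin 3) : Plane := !₂[τ.tangent k 1, -τ.tangent k 0]

/-- The degree of freedom `N_k(q) = ∫_{e_k} q · n_k` (integral with respect to arc length). -/
def flux (q : Plane → Plane) (k : Fin 3) : ℝ :=
  τ.len k * ∫ s in (0 : ℝ)..1,
    inner ℝ (q (AffineMap.lineMap (τ.a (k + 1)) (τ.a (k + 2)) s)) (τ.normal k)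

/-- Going along `∂τ` and `∂τ'` counterclockwise, starting with `e_k` and `e'_{k'}`, the lengths of
corresponding edges differ by at most `δ`. If `e_k = e'_{k'}` is a common edge of two triangles on
its two sides, corresponding edges are the opposite edges of the quadrilateral `τ ∪ τ'`. -/
def EdgesClose (k : Fin 3) (τ' : Triangle) (k' : Fin 3) (δ : ℝ) : Prop :=
  ∀ j : Fin 3, |τ.len (k + j) - τ'.len (k' + j)| ≤ δ

end Triangle

/-- `RT₀`: the vector fields `x ↦ a + b x`, with a constant vector `a` and a constant number `b`. -/
def RT0 : Set (Plane → Plane) := {f | ∃ (a : Plane) (b : ℝ), f = fun x => a + b • x}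

/-! ### Triangulations -/

/-- A (conforming, finite) triangulation of `Ω`: two different triangles are disjoint or share
exactly one vertex or exactly one edge. -/
structure Triangulation (Ω : Set Plane) where
  elems : Finset Triangle
  cover : closure Ω = ⋃ τ ∈ elems, τ.carrier
  conforming : ∀ τ ∈ elems, ∀ τ' ∈ elems, τ ≠ τ' →
    range τ.a ≠ range τ'.a ∧
      τ.carrier ∩ τ'.carrier = convexHull ℝ (range τ.a ∩ range τ'.a)

namespace Triangulation

variable {Ω : Set Plane} (T : Triangulation Ω)

/-- The mesh size `h`, the largest diameter of a triangle. -/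
def meshSize : ℝ := ⨆ τ : T.elems, Metric.diam τ.1.carrier

/-- Shape regularity: each triangle contains a disk of radius `diam τ / μ`. -/
def ShapeRegular (μ : ℝ) : Prop :=
  ∀ τ ∈ T.elems, ∃ x, Metric.closedBall x (Metric.diam τ.carrier / μ) ⊆ τ.carrier

/-- The interior edges: those shared by two different triangles. -/
def interiorEdges : Set (Sym2 Plane) :=
  {e | ∃ τ ∈ T.elems, ∃ τ' ∈ T.elems, τ ≠ τ' ∧ (∃ k, τ.edge k = e) ∧ ∃ k', τ'.edge k' = e}

/-- The boundary vertices: vertices of the triangulation lying on `∂Ω`. -/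
def boundaryVertices : Set Plane :=
  {x | x ∈ frontier Ω ∧ ∃ τ ∈ T.elems, ∃ k, τ.a k = x}

open Classical in
/-- The `(α,σ)`-condition, with `M` for all the constants hidden in the `O`-symbols and at most `κ`
exceptional boundary vertices. -/
def AlphaSigmaCondition (α σ M : ℝ) (κ : ℕ) : Prop :=
  (∃ E₁ E₂ : Finset (Sym2 Plane), Disjoint E₁ E₂ ∧ ((E₁ ∪ E₂ : Finset _) : Set _) = T.interiorEdges ∧
    (∀ e ∈ E₁, ∀ τ ∈ T.elems, ∀ τ' ∈ T.elems, ∀ k k', τ ≠ τ' → τ.edge k = e → τ'.edge k' = e →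
      τ.EdgesClose k τ' k' (M * T.meshSize ^ (1 + α))) ∧
    ∑ e ∈ E₂, ∑ τ ∈ T.elems with ∃ k, τ.edge k = e, volume.real τ.carrier
      ≤ M * T.meshSize ^ σ) ∧
  (∃ P₁ P₂ : Finset Plane, Disjoint P₁ P₂ ∧ ((P₁ ∪ P₂ : Finset _) : Set _) = T.boundaryVertices ∧
    (∀ x ∈ P₁, ∀ τ ∈ T.elems, ∀ τ' ∈ T.elems, ∀ k k',
      τ.edgeSet k ⊆ frontier Ω → τ'.edgeSet k' ⊆ frontier Ω → x ∈ τ.edge k → x ∈ τ'.edge k' →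
      τ.edge k ≠ τ'.edge k' →
        τ.EdgesClose k τ' k' (M * T.meshSize ^ (1 + α)) ∧
        ‖τ.tangent k - τ'.tangent k'‖ ≤ M * T.meshSize ^ α) ∧
    P₂.card ≤ κ)

/-- `r` is the lowest order Raviart--Thomas interpolant `Π_h p`: on (the interior of) each triangle
it is the element of `RT₀` with the same fluxes as `p` through the three edges. Values on the edges,
a null set, are irrelevant. -/
def IsRTInterpolant (p r : Plane → Plane) : Prop :=
  ∀ τ ∈ T.elems, ∃ f ∈ RT0, EqOn r f (interior τ.carrier) ∧ ∀ k, τ.flux f k = τ.flux p k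

/-- `S_h`: the continuous functions on the closure of `Ω` that are affine on each triangle. -/
def continuousPiecewiseLinear : Set (Plane → ℝ) :=
  {w | ContinuousOn w (closure Ω) ∧
    ∀ τ ∈ T.elems, ∃ (g : Plane) (b : ℝ), ∀ x ∈ τ.carrier, w x = inner ℝ g x + b}

end Triangulation

/-- The vector curl `(∂w/∂x₂, -∂w/∂x₁)`. -/
def curl (w : Plane → ℝ) (x : Plane) : Plane := !₂[partialDeriv 1 w x, -partialDeriv 0 w x]

end RTMixed

end

noncomputable section

namespace RTMixed

open Filter Metric
open scoped Topology ENNReal Convolution Pointwise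

/-! ### Weak derivatives and mollification -/

/-! The error integral is, up to a harmless remainder, a sum over oriented edges of a coefficient
times the increment of `w` along the edge. Superconvergence is cancellation in this sum.

On one triangle `p` is replaced by its first order Taylor polynomial at the centroid; the remainder,
summed by Cauchy–Schwarz, costs a multiple of `h ^ 2 * l2Norm Ω (curl w)`. For an affine field an
algebraic identity (`centroid_expansion`) writes the error against a constant vector `q` as the sum
over the three edges of `coef k` times `inner q (rot (vec k))`, and for `q = curl w` the second
factor is the increment of `w` along the edge. The coefficient has size `diam ^ 2`, is linear in the
gradient of `p` and invariant under a half-turn of the triangle (`edgeCoef_neg`). The law of cosines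
and Heron's formula make it Lipschitz in the three edge lengths and the edge direction
(`abs_edgeCoef_sub_le`).

An interior edge is traversed in opposite directions by its two triangles, so only the difference of
the two coefficients survives. For approximate parallelograms this difference is small and the edges
contribute `h ^ (1 + α)` and `h ^ 2`. The exceptional edges are estimated without cancellation;
Cauchy–Schwarz over a set of area `h ^ σ` gives `h ^ (1 + σ / 2)`.

Boundary edges have no partner, but they form a cycle. Summation by parts turns their contribution
into a sum over boundary vertices of `w x - w x₀` times a combination of coefficients of the edges
meeting at `x` whose weights add up to zero. At a good vertex these coefficients are close, and
since there are at most about `h ^ (-γ)` boundary edges the total is `h ^ (2 + α - γ)` plus `h ^ 2`.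
The at most `κ` remaining vertices cost `h ^ 2` each. The oscillation of `w` is controlled by the
discrete Sobolev inequality `exists_abs_sub_le_l2Norm_curl`, the only source of the factor `|log h|
^ (1 / 2)`.

Two facts about the domain are needed. A field in `W^{2,∞}` has a gradient that is Lipschitz for the
Euclidean distance (`exists_gradient_field`, by mollification), although the polygon need not be
convex. Near each point of its closure the polygon is star shaped with respect to a fixed ball
(`exists_star_ball`); this serves both the Lipschitz bound and the Sobolev inequality. -/

lemma HasWeakDeriv.ae_eq {Ω : Set Plane} (hΩ : IsOpen Ω) {j : Fin 2} {u v v' : Plane → ℝ}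
    (h : HasWeakDeriv Ω j u v) (h' : HasWeakDeriv Ω j u v') :
    v =ᵐ[volume.restrict Ω] v' := by
  have h0 : ∀ᵐ x ∂(volume : Measure Plane), x ∈ Ω → (v - v') x = 0 := by
    refine hΩ.ae_eq_zero_of_integral_contDiff_smul_eq_zero (h.2.1.sub h'.2.1) ?_
    intro g hg hgc hgs
    have e1 := h.2.2 g hg hgc hgs
    have e2 := h'.2.2 g hg hgc hgs
    have key : ∀ f : Plane → ℝ, LocallyIntegrableOn f Ω → Integrable (fun x => f x * g x) := by
      intro f hf
      have hint : IntegrableOn f (tsupport g) :=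
        (hf.mono_set hgs).integrableOn_isCompact hgc
      have := hint.mul_continuousOn (hg.continuous.continuousOn) hgc
      refine (integrableOn_iff_integrable_of_support_subset ?_).1 this
      intro x hx
      exact subset_tsupport g (right_ne_zero_of_mul hx)
    have full : ∀ f : Plane → ℝ, ∫ x in Ω, f x * g x = ∫ x, f x * g x := by
      intro f
      refine setIntegral_eq_integral_of_forall_compl_eq_zero ?_
      intro x hx
      have : g x = 0 := by
        by_contra hne
        exact hx (hgs (subset_tsupport g hne))
      simp [this]
    rw [full] at e1 e2
    have : ∫ x, g x • (v - v') x = ∫ x, (v x * g x - v' x * g x) := by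
      congr 1; ext x; simp [smul_eq_mul]; ring
    rw [this, integral_sub (key v h.2.1) (key v' h'.2.1)]
    linarith
  rw [Filter.EventuallyEq, ae_restrict_iff' hΩ.measurableSet]
  filter_upwards [h0] with x hx hxΩ
  have := hx hxΩ
  simpa [sub_eq_zero] using this

lemma hasWeakDeriv_weakDeriv {Ω : Set Plane} {j : Fin 2} {u : Plane → ℝ}
    (h : ∃ v, HasWeakDeriv Ω j u v) : HasWeakDeriv Ω j u (weakDeriv Ω j u) := by
  unfold weakDeriv
  rw [dif_pos h]
  exact h.choose_spec

lemma HasWeakDeriv.congr_left {Ω : Set Plane} {j : Fin 2} {u u' v : Plane → ℝ}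
    (h : HasWeakDeriv Ω j u v) (e : u =ᵐ[volume.restrict Ω] u') (hu' : LocallyIntegrableOn u' Ω) :
    HasWeakDeriv Ω j u' v := by
  refine ⟨hu', h.2.1, fun φ h1 h2 h3 => ?_⟩
  rw [← h.2.2 φ h1 h2 h3]
  refine integral_congr_ae ?_
  filter_upwards [e] with x hx
  rw [hx]

lemma MemSobolevInf.memLp {Ω : Set Plane} {k : ℕ} {u : Plane → ℝ} (h : MemSobolevInf Ω k u) :
    MemLp u ⊤ (volume.restrict Ω) := by
  cases k with
  | zero => exact h
  | succ k => exact h.1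

lemma MemSobolevInf.congr {Ω : Set Plane} {k : ℕ} {u u' : Plane → ℝ} (h : MemSobolevInf Ω k u)
    (e : u =ᵐ[volume.restrict Ω] u') (hu' : LocallyIntegrableOn u' Ω) : MemSobolevInf Ω k u' := by
  cases k with
  | zero => exact (memLp_congr_ae e).1 h
  | succ k =>
    refine ⟨(memLp_congr_ae e).1 h.1, fun j => ?_⟩
    obtain ⟨v, hv, hv'⟩ := h.2 j
    exact ⟨v, hv.congr_left e hu', hv'⟩

/-- `weakDeriv` is an arbitrary choice, while membership supplies some possibly different
derivative. Uniqueness almost everywhere transfers the regularity from one to the other. -/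
lemma MemSobolevInf.weakDeriv {Ω : Set Plane} (hΩ : IsOpen Ω) {k : ℕ} {u : Plane → ℝ}
    (h : MemSobolevInf Ω (k + 1) u) (j : Fin 2) :
    HasWeakDeriv Ω j u (weakDeriv Ω j u) ∧ MemSobolevInf Ω k (RTMixed.weakDeriv Ω j u) := by
  obtain ⟨v, hv, hv'⟩ := h.2 j
  have hw := hasWeakDeriv_weakDeriv ⟨v, hv⟩
  exact ⟨hw, hv'.congr (hv.ae_eq hΩ hw) hw.2.1⟩

lemma sobolevInfNorm_lt_top {Ω : Set Plane} (hΩ : IsOpen Ω) {k : ℕ} {u : Plane → ℝ}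
    (h : MemSobolevInf Ω k u) : sobolevInfNorm Ω k u < ⊤ := by
  induction k generalizing u with
  | zero => exact h.eLpNorm_lt_top
  | succ k ih =>
    simp only [sobolevInfNorm]
    refine max_lt h.1.eLpNorm_lt_top ?_
    rw [iSup_lt_iff]
    refine ⟨sobolevInfNorm Ω k (weakDeriv Ω 0 u) ⊔ sobolevInfNorm Ω k (weakDeriv Ω 1 u),
      max_lt (ih (h.weakDeriv hΩ 0).2) (ih (h.weakDeriv hΩ 1).2), ?_⟩
    intro j
    fin_cases j
    · exact le_sup_left
    · exact le_sup_right

/-- Convolution of the extension of `u` by zero with a normalized bump function. -/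
def mollify (Ω : Set Plane) (φ : ContDiffBump (0 : Plane)) (u : Plane → ℝ) : Plane → ℝ :=
  φ.normed volume ⋆[ContinuousLinearMap.lsmul ℝ ℝ, volume] Ω.indicator u

lemma mollify_apply (Ω : Set Plane) (hΩ : MeasurableSet Ω) (φ : ContDiffBump (0 : Plane))
    (u : Plane → ℝ) (z : Plane) :
    mollify Ω φ u z = ∫ t in Ω, u t * φ.normed volume (z - t) := by
  rw [mollify, convolution_lsmul_swap, ← integral_indicator hΩ]
  congr 1; ext t
  by_cases ht : t ∈ Ω <;> simp [ht, mul_comm]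

lemma integrableOn_of_memLp_top {Ω : Set Plane} (hb : Bornology.IsBounded Ω) {u : Plane → ℝ}
    (h : MemLp u ⊤ (volume.restrict Ω)) : IntegrableOn u Ω := by
  have : IsFiniteMeasure (volume.restrict Ω) := ⟨by simpa using hb.measure_lt_top⟩
  exact (h.mono_exponent (p := 1) le_top).integrable le_rfl

/-- The kernel is nonnegative with integral one, and extension by zero does not increase the
supremum; hence no restriction on `z`. -/
lemma abs_mollify_le {Ω : Set Plane} (hΩ : MeasurableSet Ω) {φ : ContDiffBump (0 : Plane)}
    {u : Plane → ℝ} {K : ℝ} (hK0 : 0 ≤ K)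
    (hK : eLpNorm u ⊤ (volume.restrict Ω) ≤ ENNReal.ofReal K) (z : Plane) :
    |mollify Ω φ u z| ≤ K := by
  have hae : ∀ᵐ t ∂(volume.restrict Ω), |u t| ≤ K := by
    have h1 : ∀ᵐ t ∂(volume.restrict Ω), ‖u t‖ₑ ≤ eLpNorm u ⊤ (volume.restrict Ω) := by
      rw [eLpNorm_exponent_top]; exact enorm_ae_le_eLpNormEssSup u _
    filter_upwards [h1] with t ht
    have := ht.trans hK
    rw [Real.enorm_eq_ofReal_abs] at this
    exact (ENNReal.ofReal_le_ofReal_iff hK0).1 this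
  have hint : Integrable (fun t => φ.normed volume (z - t)) (volume : Measure Plane) :=
    (φ.integrable_normed (μ := volume)).comp_sub_left z
  rw [mollify_apply Ω hΩ, ← Real.norm_eq_abs]
  calc ‖∫ t in Ω, u t * φ.normed volume (z - t)‖
      ≤ ∫ t in Ω, K * φ.normed volume (z - t) := by
        refine norm_integral_le_of_norm_le (hint.const_mul K).integrableOn ?_
        filter_upwards [hae] with t ht
        rw [Real.norm_eq_abs, abs_mul, abs_of_nonneg (φ.nonneg_normed (z - t))]
        exact mul_le_mul_of_nonneg_right ht (φ.nonneg_normed _)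
    _ ≤ ∫ t, K * φ.normed volume (z - t) := by
        refine setIntegral_le_integral (hint.const_mul K) ?_
        exact Eventually.of_forall fun t => mul_nonneg hK0 (φ.nonneg_normed _)
    _ = K := by
        rw [integral_const_mul, integral_sub_left_eq_self (fun t => φ.normed volume t),
          φ.integral_normed, mul_one]

lemma plane_eq_smul_single (v : Plane) :
    v = v 0 • EuclideanSpace.single 0 1 + v 1 • EuclideanSpace.single 1 1 := by
  ext i; fin_cases i <;> simp

lemma inner_plane (x y : Plane) : inner ℝ x y = x 0 * y 0 + x 1 * y 1 := by
  simp [PiLp.inner_apply, Fin.sum_univ_two]; ring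

/-- Differentiation falls on the kernel. When the ball around `z` lies in `Ω`, the reflected kernel
`φ (z - ·)` is an admissible test function, so the definition of the weak derivative moves it onto
`v`. The jump created by the extension by zero is never seen. -/
lemma hasFDerivAt_mollify {Ω : Set Plane} (hΩ : IsOpen Ω) (hb : Bornology.IsBounded Ω)
    {φ : ContDiffBump (0 : Plane)} {u : Plane → ℝ} {v : Fin 2 → Plane → ℝ}
    (hu : MemLp u ⊤ (volume.restrict Ω)) (hv : ∀ j, HasWeakDeriv Ω j u (v j))
    {z : Plane} (hz : closedBall z φ.rOut ⊆ Ω) :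
    HasFDerivAt (mollify Ω φ u)
      (innerSL ℝ (!₂[mollify Ω φ (v 0) z, mollify Ω φ (v 1) z] : Plane)) z := by
  have hui : Integrable (Ω.indicator u) :=
    (integrableOn_of_memLp_top hb hu).integrable_indicator hΩ.measurableSet
  have hc : HasCompactSupport (φ.normed (volume : Measure Plane)) := φ.hasCompactSupport_normed
  have hs : ContDiff ℝ 1 (φ.normed (volume : Measure Plane)) := φ.contDiff_normed
  have h := hc.hasFDerivAt_convolution_left (L := ContinuousLinearMap.lsmul ℝ ℝ) hs
    hui.locallyIntegrable z
  have hpart : ∀ j, (((fderiv ℝ (φ.normed (volume : Measure Plane)))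
      ⋆[(ContinuousLinearMap.lsmul ℝ ℝ).precompL Plane, volume] (Ω.indicator u)) z)
        (EuclideanSpace.single j 1) = mollify Ω φ (v j) z := by
    intro j
    have hex := ((hc.fderiv ℝ).convolutionExists_left ((ContinuousLinearMap.lsmul ℝ ℝ).precompL Plane)
      (hs.continuous_fderiv one_ne_zero) hui.locallyIntegrable z (μ := volume)).integrable_swap
    rw [convolution_eq_swap, ContinuousLinearMap.integral_apply hex]
    set ψ : Plane → ℝ := fun t => φ.normed volume (z - t) with hψ
    have hψd : ∀ t, partialDeriv j ψ t =
        - fderiv ℝ (φ.normed (volume : Measure Plane)) (z - t) (EuclideanSpace.single j 1) := by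
      intro t
      have h1 : HasFDerivAt (fun t : Plane => z - t) (-ContinuousLinearMap.id ℝ Plane) t :=
        (hasFDerivAt_id t).const_sub z
      have h2 := ((hs.differentiable one_ne_zero (z - t)).hasFDerivAt).comp t h1
      rw [partialDeriv, show ψ = (φ.normed (volume : Measure Plane)) ∘ (fun t => z - t) from rfl,
        h2.fderiv]
      simp
    have hψs : tsupport ψ ⊆ closedBall z φ.rOut := by
      refine closure_minimal ?_ isClosed_closedBall
      intro t ht
      have : z - t ∈ Function.support (φ.normed (volume : Measure Plane)) := ht
      rw [φ.support_normed_eq] at this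
      rw [mem_closedBall, dist_comm, dist_eq_norm]
      exact (mem_ball_zero_iff.1 this).le
    have hψc : HasCompactSupport ψ :=
      (isCompact_closedBall z φ.rOut).of_isClosed_subset (isClosed_tsupport _) hψs
    have hψsm : ContDiff ℝ (⊤ : ℕ∞) ψ := φ.contDiff_normed.comp (contDiff_const.sub contDiff_id)
    have hw := (hv j).2.2 ψ hψsm hψc (hψs.trans hz)
    rw [mollify_apply Ω hΩ.measurableSet]
    have e1 : ∫ t in Ω, u t * partialDeriv j ψ t =
        - ∫ t, (((ContinuousLinearMap.lsmul ℝ ℝ).precompL Plane)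
          (fderiv ℝ (φ.normed (volume : Measure Plane)) (z - t)) (Ω.indicator u t))
            (EuclideanSpace.single j 1) := by
      rw [← integral_neg, ← integral_indicator hΩ.measurableSet]
      congr 1; ext t
      by_cases ht : t ∈ Ω
      · simp [ht, hψd, mul_comm]
      · simp [ht]
    rw [e1] at hw
    linarith
  refine h.congr_fderiv (ContinuousLinearMap.ext fun w => ?_)
  conv_lhs => rw [plane_eq_smul_single w]
  rw [map_add, map_smul, map_smul, hpart, hpart]
  simp [inner_plane, mul_comm]

/-- A family of bump functions shrinking to the origin. -/
def shrinkingBump (n : ℕ) : ContDiffBump (0 : Plane) where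
  rIn := 1 / (2 * ((n : ℝ) + 1))
  rOut := 1 / ((n : ℝ) + 1)
  rIn_pos := by positivity
  rIn_lt_rOut := by
    apply one_div_lt_one_div_of_lt <;> nlinarith [(Nat.cast_nonneg n : (0 : ℝ) ≤ n)]

lemma tendsto_shrinkingBump_rOut : Tendsto (fun n => (shrinkingBump n).rOut) atTop (𝓝 0) :=
  tendsto_one_div_add_atTop_nhds_zero_nat

lemma tendsto_mollify {Ω : Set Plane} (hΩ : IsOpen Ω) {u : Plane → ℝ}
    (hu : ContinuousOn u Ω) {z : Plane} (hz : z ∈ Ω) :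
    Tendsto (fun n => mollify Ω (shrinkingBump n) u z) atTop (𝓝 (u z)) := by
  have hm : AEStronglyMeasurable (Ω.indicator u) (volume : Measure Plane) :=
    (aestronglyMeasurable_indicator_iff hΩ.measurableSet).2
      (hu.aestronglyMeasurable hΩ.measurableSet)
  refine ContDiffBump.convolution_tendsto_right tendsto_shrinkingBump_rOut
    (Eventually.of_forall fun _ => hm) ?_ tendsto_const_nhds
  have hc : ContinuousAt (Ω.indicator u) z := by
    have : ContinuousAt u z := hu.continuousAt (hΩ.mem_nhds hz)
    refine this.congr ?_
    filter_upwards [hΩ.mem_nhds hz] with t ht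
    simp [ht]
  have : Tendsto (Ω.indicator u) (𝓝 z) (𝓝 (u z)) := by
    have := hc.tendsto
    rwa [indicator_of_mem hz] at this
  exact this.comp tendsto_snd

lemma eventually_closedBall_subset {Ω : Set Plane} (hΩ : IsOpen Ω) {S : Set Plane}
    (hS : IsCompact S) (h : S ⊆ Ω) :
    ∀ᶠ n in atTop, ∀ z ∈ S, closedBall z (shrinkingBump n).rOut ⊆ Ω := by
  obtain ⟨δ, hδ, hsub⟩ := hS.exists_cthickening_subset_open hΩ h
  filter_upwards [tendsto_shrinkingBump_rOut.eventually (gt_mem_nhds hδ)] with n hn z hz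
  exact (closedBall_subset_cthickening hz _).trans ((cthickening_mono hn.le _).trans hsub)

lemma isCompact_segment (x y : Plane) : IsCompact (segment ℝ x y) := by
  rw [segment_eq_image]
  exact isCompact_Icc.image (by fun_prop)

lemma norm_plane_le (a b : ℝ) : ‖(!₂[a, b] : Plane)‖ ≤ |a| + |b| := by
  rw [EuclideanSpace.norm_eq, Real.sqrt_le_left (by positivity)]
  simp only [Fin.sum_univ_two, Real.norm_eq_abs, sq_abs]
  have e1 := sq_abs a
  have e2 := sq_abs b
  simp
  nlinarith [abs_nonneg a, abs_nonneg b]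

lemma abs_mollify_sub_le {Ω : Set Plane} (hΩ : IsOpen Ω) (hb : Bornology.IsBounded Ω)
    {φ : ContDiffBump (0 : Plane)} {u : Plane → ℝ} {v : Fin 2 → Plane → ℝ} {K : ℝ} (hK0 : 0 ≤ K)
    (hu : MemLp u ⊤ (volume.restrict Ω)) (hv : ∀ j, HasWeakDeriv Ω j u (v j))
    (hK : ∀ j, eLpNorm (v j) ⊤ (volume.restrict Ω) ≤ ENNReal.ofReal K) {x y : Plane}
    (hz : ∀ z ∈ segment ℝ x y, closedBall z φ.rOut ⊆ Ω) :
    |mollify Ω φ u y - mollify Ω φ u x| ≤ 2 * K * ‖y - x‖ := by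
  refine (convex_segment x y).norm_image_sub_le_of_norm_hasFDerivWithin_le
    (fun z hzs => (hasFDerivAt_mollify hΩ hb hu hv (hz z hzs)).hasFDerivWithinAt) ?_
    (left_mem_segment ℝ x y) (right_mem_segment ℝ x y)
  intro z _
  rw [innerSL_apply_norm]
  refine (norm_plane_le _ _).trans ?_
  have := abs_mollify_le hΩ.measurableSet hK0 (hK 0) (φ := φ) z
  have := abs_mollify_le hΩ.measurableSet hK0 (hK 1) (φ := φ) z
  linarith

/-- A continuous function in `W^{2,∞}` has a gradient that is bounded, Lipschitz along segments,
and gives a first order Taylor expansion along segments. -/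
theorem exists_gradient {Ω : Set Plane} (hΩ : IsOpen Ω) (hb : Bornology.IsBounded Ω)
    {u : Plane → ℝ} (hu : ContinuousOn u Ω) (hS : MemSobolevInf Ω 2 u) {K : ℝ} (hK0 : 0 ≤ K)
    (hK : ∀ j, sobolevInfNorm Ω 1 (weakDeriv Ω j u) ≤ ENNReal.ofReal K) :
    ∃ G : Plane → Plane, (∀ x, ‖G x‖ ≤ 2 * K) ∧
      ∀ x y, segment ℝ x y ⊆ Ω → ‖G y - G x‖ ≤ 4 * K * ‖y - x‖ ∧
        |u y - u x - inner ℝ (G x) (y - x)| ≤ 4 * K * ‖y - x‖ ^ 2 := by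
  set v : Fin 2 → Plane → ℝ := fun j => weakDeriv Ω j u with hvdef
  have hv : ∀ j, HasWeakDeriv Ω j u (v j) := fun j => (hS.weakDeriv hΩ j).1
  have hvS : ∀ j, MemSobolevInf Ω 1 (v j) := fun j => (hS.weakDeriv hΩ j).2
  have hvK : ∀ j, eLpNorm (v j) ⊤ (volume.restrict Ω) ≤ ENNReal.ofReal K := fun j =>
    le_trans (by simp only [sobolevInfNorm]; exact le_sup_left) (hK j)
  have hvvK : ∀ j k, eLpNorm (weakDeriv Ω k (v j)) ⊤ (volume.restrict Ω) ≤ ENNReal.ofReal K :=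
    fun j k => le_trans (by
      simp only [sobolevInfNorm]
      exact le_trans (le_iSup (fun k => eLpNorm (weakDeriv Ω k (v j)) ⊤ (volume.restrict Ω)) k)
        le_sup_right) (hK j)
  have hvv : ∀ j k, HasWeakDeriv Ω k (v j) (weakDeriv Ω k (v j)) :=
    fun j k => ((hvS j).weakDeriv hΩ k).1
  set g : ℕ → Plane → Plane := fun n z =>
    !₂[mollify Ω (shrinkingBump n) (v 0) z, mollify Ω (shrinkingBump n) (v 1) z] with hg
  have hgb : ∀ n z, ‖g n z‖ ≤ 2 * K := by
    intro n z
    refine (norm_plane_le _ _).trans ?_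
    have := abs_mollify_le hΩ.measurableSet hK0 (hvK 0) (φ := shrinkingBump n) z
    have := abs_mollify_le hΩ.measurableSet hK0 (hvK 1) (φ := shrinkingBump n) z
    linarith
  -- The mollified gradients stay in a fixed compact ball, so an ultrafilter provides a limit at all
  -- points simultaneously, without equicontinuity or subsequences. The inequalities wanted for `G`
  -- are closed conditions and survive the limit.
  have hlim : ∀ z, ∃ l : Plane, l ∈ closedBall (0 : Plane) (2 * K) ∧
      Tendsto (fun n => g n z) (hyperfilter ℕ : Filter ℕ) (𝓝 l) := by
    intro z
    have := (isCompact_closedBall (0 : Plane) (2 * K)).ultrafilter_le_nhds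
      ((hyperfilter ℕ).map (fun n => g n z)) (by
        rw [le_principal_iff]
        change ∀ᶠ n in (hyperfilter ℕ : Filter ℕ), g n z ∈ closedBall (0 : Plane) (2 * K)
        exact Eventually.of_forall fun n => by simpa using hgb n z)
    exact this
  choose G hGb hGl using hlim
  have hle : (hyperfilter ℕ : Filter ℕ) ≤ atTop := Nat.hyperfilter_le_atTop
  refine ⟨G, fun x => by simpa using hGb x, fun x y hxy => ?_⟩
  have hev := (eventually_closedBall_subset hΩ (isCompact_segment x y) hxy).filter_mono hle
  have hglip : ∀ n, (∀ z ∈ segment ℝ x y, closedBall z (shrinkingBump n).rOut ⊆ Ω) →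
      ∀ z ∈ segment ℝ x y, ‖g n z - g n x‖ ≤ 4 * K * ‖z - x‖ := by
    intro n hn z hz
    have hsub : segment ℝ x z ⊆ segment ℝ x y :=
      (convex_segment x y).segment_subset (left_mem_segment ℝ x y) hz
    have hj : ∀ j, |mollify Ω (shrinkingBump n) (v j) z - mollify Ω (shrinkingBump n) (v j) x|
        ≤ 2 * K * ‖z - x‖ := fun j =>
      abs_mollify_sub_le hΩ hb hK0 (hvS j).memLp (hvv j) (hvvK j) fun t ht => hn t (hsub ht)
    have e : g n z - g n x = !₂[mollify Ω (shrinkingBump n) (v 0) z -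
        mollify Ω (shrinkingBump n) (v 0) x, mollify Ω (shrinkingBump n) (v 1) z -
        mollify Ω (shrinkingBump n) (v 1) x] := by
      ext i; fin_cases i <;> simp [hg]
    rw [e]
    refine (norm_plane_le _ _).trans ?_
    linarith [hj 0, hj 1]
  have hx : x ∈ Ω := hxy (left_mem_segment ℝ x y)
  have hy : y ∈ Ω := hxy (right_mem_segment ℝ x y)
  constructor
  · refine le_of_tendsto ((hGl y).sub (hGl x)).norm ?_
    filter_upwards [hev] with n hn
    exact hglip n hn y (right_mem_segment ℝ x y)
  · have t1 : Tendsto (fun n => |mollify Ω (shrinkingBump n) u y - mollify Ω (shrinkingBump n) u x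
        - inner ℝ (g n x) (y - x)|) (hyperfilter ℕ : Filter ℕ)
        (𝓝 |u y - u x - inner ℝ (G x) (y - x)|) :=
      ((((tendsto_mollify hΩ hu hy).mono_left hle).sub ((tendsto_mollify hΩ hu hx).mono_left hle)).sub
        ((hGl x).inner tendsto_const_nhds)).abs
    refine le_of_tendsto t1 ?_
    filter_upwards [hev] with n hn
    -- Mean value inequality after subtracting the linear part at `x`: the derivative then varies by
    -- at most `4 * K * ‖y - x‖`, which yields the quadratic remainder.
    have := (convex_segment x y).norm_image_sub_le_of_norm_hasFDerivWithin_le'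
      (f := mollify Ω (shrinkingBump n) u) (f' := fun z => innerSL ℝ (g n z))
      (φ := innerSL ℝ (g n x)) (C := 4 * K * ‖y - x‖)
      (fun z hzs => (hasFDerivAt_mollify hΩ hb hS.memLp hv (hn z hzs)).hasFDerivWithinAt) ?_
      (left_mem_segment ℝ x y) (right_mem_segment ℝ x y)
    · simpa [pow_two, mul_assoc] using this
    · intro z hz
      rw [← map_sub, innerSL_apply_norm]
      refine (hglip n hn z hz).trans ?_
      refine mul_le_mul_of_nonneg_left ?_ (by positivity)
      obtain ⟨s, hs, rfl⟩ := (segment_eq_image' ℝ x y) ▸ hz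
      simp only [add_sub_cancel_left, norm_smul, Real.norm_eq_abs, abs_of_nonneg hs.1]
      exact mul_le_of_le_one_left (norm_nonneg _) hs.2

/-- The real-valued seminorm is a `toReal`, which would turn `⊤` into `0`; the work is to see that
the supremum is finite. -/
lemma sobolevInfNorm_weakDeriv_le {Ω : Set Plane} (hΩ : IsOpen Ω) {p : Plane → Plane}
    (hp : MemW2InfVec Ω p) (i j : Fin 2) :
    sobolevInfNorm Ω 1 (weakDeriv Ω j (fun x => p x i)) ≤ ENNReal.ofReal (gradNorm1Inf Ω p) := by
  have hfin : ∀ i j, sobolevInfNorm Ω 1 (weakDeriv Ω j (fun x => p x i)) < ⊤ := fun i j =>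
    sobolevInfNorm_lt_top hΩ ((hp.2 i).weakDeriv hΩ j).2
  rw [gradNorm1Inf, ENNReal.ofReal_toReal]
  · exact le_iSup₂ (f := fun i j => sobolevInfNorm Ω 1 (weakDeriv Ω j (fun x => p x i))) i j
  · refine ne_of_lt ((iSup₂_le fun i j => ?_).trans_lt (b := ∑ i, ∑ j,
      sobolevInfNorm Ω 1 (weakDeriv Ω j (fun x => p x i)))
      (ENNReal.sum_lt_top.2 fun i _ => ENNReal.sum_lt_top.2 fun j _ => hfin i j))
    exact (Finset.single_le_sum (f := fun j => sobolevInfNorm Ω 1 (weakDeriv Ω j (fun x => p x i)))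
      (fun _ _ => zero_le) (Finset.mem_univ j)).trans
      (Finset.single_le_sum (f := fun i => ∑ j, sobolevInfNorm Ω 1 (weakDeriv Ω j (fun x => p x i)))
      (fun _ _ => zero_le) (Finset.mem_univ i))

/-! ### Geometry of Lipschitz polygons -/

namespace IsLipschitzPolygon

variable {Ω : Set Plane}

lemma isCompact_closure (hΩ : IsLipschitzPolygon Ω) : IsCompact (closure Ω) :=
  hΩ.isBounded.isCompact_closure

lemma le_of_mem_closure {R : Plane ≃ₗᵢ[ℝ] Plane} {φ : ℝ → ℝ} {L : NNReal}
    (hφ : LipschitzWith L φ) {x y : Plane} {r : ℝ}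
    (h : ∀ y ∈ ball x r, (y ∈ Ω ↔ φ (R y 0) < R y 1)) (hy : y ∈ ball x r) (hyc : y ∈ closure Ω) :
    φ (R y 0) ≤ R y 1 := by
  have hcl : IsClosed {y : Plane | φ (R y 0) ≤ R y 1} := by
    have := hφ.continuous
    refine isClosed_le ?_ ?_ <;> fun_prop
  have hsub : closure (ball x r ∩ Ω) ⊆ {y : Plane | φ (R y 0) ≤ R y 1} :=
    closure_minimal (fun z hz => ((h z hz.1).1 hz.2).le) hcl
  exact hsub (isOpen_ball.inter_closure ⟨hy, hyc⟩)

/-- The Lipschitz condition excludes slits: from a frontier point, moving down in the local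
coordinates leaves the closed epigraph, hence the closure of `Ω`. -/
lemma interior_closure (hΩ : IsLipschitzPolygon Ω) : interior (closure Ω) = Ω := by
  refine Subset.antisymm (fun x hx => ?_) (hΩ.isOpen.subset_interior_iff.2 subset_closure)
  by_contra hxn
  have hxf : x ∈ frontier Ω := by
    rw [hΩ.isOpen.frontier_eq]; exact ⟨interior_subset hx, hxn⟩
  obtain ⟨R, φ, L, r, hr, hφ, h⟩ := hΩ.lipschitz x hxf
  have hc : Tendsto (fun s : ℝ => x - s • R.symm (EuclideanSpace.single 1 1)) (𝓝[>] 0) (𝓝 x) := by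
    have : ContinuousAt (fun s : ℝ => x - s • R.symm (EuclideanSpace.single 1 1)) 0 := by fun_prop
    have := this.tendsto
    simp only [zero_smul, sub_zero] at this
    exact this.mono_left nhdsWithin_le_nhds
  have h1 := hc.eventually (isOpen_interior.mem_nhds hx)
  have h2 := hc.eventually (ball_mem_nhds x hr)
  obtain ⟨s, ⟨hs1, hs2⟩, hs⟩ := ((h1.and h2).and self_mem_nhdsWithin).exists
  have hle := le_of_mem_closure hφ h hs2 (interior_subset hs1)
  have hx' : ¬ φ (R x 0) < R x 1 := fun hlt => hxn ((h x (mem_ball_self hr)).2 hlt)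
  simp at hle hs
  linarith

lemma segment_null (x y : Plane) : volume (segment ℝ x y) = 0 := by
  have h : volume (line[ℝ, x, y] : Set Plane) = 0 := by
    refine Measure.addHaar_affineSubspace volume _ ?_
    intro htop
    have h1 : Module.finrank ℝ (line[ℝ, x, y]).direction ≤ 1 :=
      collinear_iff_finrank_le_one.1 (collinear_pair ℝ x y) |>.trans' (by
        rw [direction_affineSpan])
    rw [htop, AffineSubspace.direction_top, finrank_top, finrank_euclideanSpace_fin] at h1
    omega
  refine measure_mono_null ?_ h
  intro z hz
  obtain ⟨θ, _, rfl⟩ := (segment_eq_image_lineMap ℝ x y) ▸ hz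
  exact AffineMap.lineMap_mem_affineSpan_pair θ x y

lemma volume_frontier (hΩ : IsLipschitzPolygon Ω) : volume (frontier Ω) = 0 := by
  obtain ⟨S, hS⟩ := hΩ.polygonal
  rw [hS]
  refine (measure_biUnion_null_iff S.countable_toSet).2 fun s _ => segment_null _ _

lemma hausdorffMeasure_frontier_lt_top (hΩ : IsLipschitzPolygon Ω) :
    Measure.hausdorffMeasure 1 (frontier Ω) < ⊤ := by
  obtain ⟨S, hS⟩ := hΩ.polygonal
  rw [hS]
  refine (measure_biUnion_finset_le S _).trans_lt (ENNReal.sum_lt_top.2 fun s _ => ?_)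
  rw [hausdorffMeasure_segment]
  exact edist_lt_top _ _

/-- Near each point of its closure, a Lipschitz polygon is star shaped with respect to every point
of a fixed ball. -/
theorem exists_star_ball (hΩ : IsLipschitzPolygon Ω) {x₀ : Plane} (hx₀ : x₀ ∈ closure Ω) :
    ∃ ε > 0, ∃ (y₀ : Plane) (ρ D : ℝ), 0 < ρ ∧ ρ ≤ D ∧ ∀ x ∈ closure Ω, x ∈ ball x₀ ε →
      ∀ z ∈ ball y₀ ρ, ρ ≤ ‖z - x‖ ∧ ‖z - x‖ ≤ D ∧ ∀ s ∈ Ioc (0 : ℝ) 1, x + s • (z - x) ∈ Ω := by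
  by_cases hxΩ : x₀ ∈ Ω
  · obtain ⟨r, hr, hb⟩ := Metric.isOpen_iff.1 hΩ.isOpen x₀ hxΩ
    refine ⟨r / 8, by positivity, x₀ + (r / 2) • EuclideanSpace.single 0 1, r / 8, 2 * r,
      by positivity, by linarith, fun x _ hx z hz => ?_⟩
    have hn : ‖(r / 2) • (EuclideanSpace.single 0 1 : Plane)‖ = r / 2 := by
      rw [norm_smul]; simp [abs_of_pos hr]
    rw [mem_ball, dist_eq_norm] at hx hz
    have e : z - x = (r / 2) • (EuclideanSpace.single 0 1 : Plane)
        + (z - (x₀ + (r / 2) • EuclideanSpace.single 0 1)) - (x - x₀) := by abel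
    have hup := norm_sub_le ((r / 2) • (EuclideanSpace.single 0 1 : Plane)
        + (z - (x₀ + (r / 2) • EuclideanSpace.single 0 1))) (x - x₀)
    have hup2 := norm_add_le ((r / 2) • (EuclideanSpace.single 0 1 : Plane))
        (z - (x₀ + (r / 2) • EuclideanSpace.single 0 1))
    have hlo := norm_sub_norm_le ((r / 2) • (EuclideanSpace.single 0 1 : Plane)
        + (z - (x₀ + (r / 2) • EuclideanSpace.single 0 1))) (x - x₀)
    have hlo2 := norm_sub_le_norm_add ((r / 2) • (EuclideanSpace.single 0 1 : Plane))
        (z - (x₀ + (r / 2) • EuclideanSpace.single 0 1))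
    rw [← e] at hup hlo
    refine ⟨by linarith, by linarith, fun s hs => hb ?_⟩
    refine (convex_ball x₀ r).add_smul_sub_mem ?_ ?_ ⟨hs.1.le, hs.2⟩
    · rw [mem_ball, dist_eq_norm]; linarith
    · rw [mem_ball, dist_eq_norm]
      have e2 : z - x₀ = (r / 2) • (EuclideanSpace.single 0 1 : Plane)
        + (z - (x₀ + (r / 2) • EuclideanSpace.single 0 1)) := by abel
      rw [e2]; linarith
  · have hxf : x₀ ∈ frontier Ω := by
      rw [hΩ.isOpen.frontier_eq]; exact ⟨hx₀, hxΩ⟩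
    obtain ⟨R, φ, L, r, hr, hφ, h⟩ := hΩ.lipschitz x₀ hxf
    set t : ℝ := r / 2 with ht
    have ht0 : 0 < t := by positivity
    -- The direction from `x` to `z` differs from the vertical vector of length `t` by less than `2
    -- * ρ`. This choice gives `L * (2 * ρ) < t - 2 * ρ`, so the direction is steeper than the graph
    -- and the segment stays strictly above it.
    set ρ : ℝ := t / (4 * (L + 1)) with hρ
    have hL : (0 : ℝ) ≤ L := L.2
    have hρ0 : 0 < ρ := by positivity
    have hρt : ρ * (4 * (L + 1)) = t := by rw [hρ]; field_simp
    have hρ4 : ρ ≤ t / 4 := by nlinarith [mul_nonneg hρ0.le hL]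
    set d : Plane := t • R.symm (EuclideanSpace.single 1 1) with hd
    have hn : ‖d‖ = t := by
      rw [hd, norm_smul]; simp [abs_of_pos ht0]
    refine ⟨ρ, hρ0, x₀ + d, ρ, 2 * t, hρ0, by linarith, fun x hxc hx z hz => ?_⟩
    have hxr : x ∈ ball x₀ r := ball_subset_ball (by linarith) hx
    have hφx := le_of_mem_closure hφ h hxr hxc
    rw [mem_ball, dist_eq_norm] at hx hz
    have e : z - x = d + (z - (x₀ + d)) - (x - x₀) := by abel
    have hup := norm_sub_le (d + (z - (x₀ + d))) (x - x₀)
    have hup2 := norm_add_le d (z - (x₀ + d))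
    have hlo := norm_sub_norm_le (d + (z - (x₀ + d))) (x - x₀)
    have hlo2 := norm_sub_le_norm_add d (z - (x₀ + d))
    rw [← e] at hup hlo
    refine ⟨by linarith, by linarith, fun s hs => ?_⟩
    have hin : x + s • (z - x) ∈ ball x₀ r := by
      refine (convex_ball x₀ r).add_smul_sub_mem hxr ?_ ⟨hs.1.le, hs.2⟩
      rw [mem_ball, dist_eq_norm]
      have e2 : z - x₀ = d + (z - (x₀ + d)) := by abel
      rw [e2]; linarith
    rw [h _ hin]
    set w : Plane := R (z - x) with hw
    have hwe : w - t • EuclideanSpace.single 1 1 = R ((z - (x₀ + d)) - (x - x₀)) := by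
      have : z - x = d + ((z - (x₀ + d)) - (x - x₀)) := by abel
      rw [hw, this, map_add, hd]
      simp
    have hwn : ‖w - t • EuclideanSpace.single 1 1‖ < 2 * ρ := by
      rw [hwe, R.norm_map]
      have := norm_sub_le (z - (x₀ + d)) (x - x₀)
      linarith
    have hw0 : |w 0| < 2 * ρ := by
      have := PiLp.norm_apply_le (w - t • EuclideanSpace.single 1 1) 0
      simp at this
      linarith
    have hw1 : t - 2 * ρ < w 1 := by
      have := PiLp.norm_apply_le (w - t • EuclideanSpace.single 1 1) 1
      simp at this
      have := (abs_le.1 this).1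
      linarith
    have hlip := hφ.dist_le_mul (R x 0 + s * w 0) (R x 0)
    rw [Real.dist_eq, Real.dist_eq, add_sub_cancel_left, abs_mul, abs_of_pos hs.1] at hlip
    have hlip' := (abs_le.1 hlip).2
    have e0 : R (x + s • (z - x)) = R x + s • w := by rw [map_add, map_smul]
    rw [e0]
    simp only [PiLp.add_apply, PiLp.smul_apply, smul_eq_mul]
    have : (L : ℝ) * |w 0| < w 1 := by
      have : (L : ℝ) * |w 0| ≤ L * (2 * ρ) := mul_le_mul_of_nonneg_left hw0.le hL
      nlinarith
    nlinarith [hs.1, mul_lt_mul_of_pos_left this hs.1]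

/-- A bounded field which is Lipschitz along segments in a Lipschitz polygon is Lipschitz. -/
theorem exists_lipschitz_const (hΩ : IsLipschitzPolygon Ω) :
    ∃ C, 0 ≤ C ∧ ∀ (K : ℝ) (G : Plane → Plane), 0 ≤ K → (∀ x, ‖G x‖ ≤ K) →
      (∀ x y, segment ℝ x y ⊆ Ω → ‖G y - G x‖ ≤ K * ‖y - x‖) →
      ∀ x ∈ Ω, ∀ y ∈ Ω, ‖G y - G x‖ ≤ C * K * ‖y - x‖ := by
  have loc : ∀ x₀ : closure Ω, ∃ ε > 0, ∃ C, 0 ≤ C ∧ ∀ (K : ℝ) (G : Plane → Plane), 0 ≤ K →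
      (∀ x y, segment ℝ x y ⊆ Ω → ‖G y - G x‖ ≤ K * ‖y - x‖) →
      ∀ x ∈ Ω, x ∈ ball (x₀ : Plane) ε → ∀ y ∈ Ω, y ∈ ball (x₀ : Plane) ε →
        ‖G y - G x‖ ≤ C * K * ‖y - x‖ := by
    intro x₀
    obtain ⟨ε, hε, y₀, ρ, D, hρ, hρD, h⟩ := hΩ.exists_star_ball x₀.2
    have hD : 0 < D := hρ.trans_le hρD
    refine ⟨min ε (ρ / 8), by positivity, 4 * D / ρ + 1, by positivity, ?_⟩
    intro K G hK hG x hxΩ hx y hyΩ hy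
    rcases eq_or_ne x y with rfl | hne
    · simp
    have hxy : ‖y - x‖ < ρ / 4 := by
      have := ball_subset_ball (min_le_right _ _) hx
      have := ball_subset_ball (min_le_right _ _) hy
      rw [mem_ball] at *
      rw [← dist_eq_norm]
      have := dist_triangle_right y x (x₀ : Plane)
      linarith
    have hxy0 : 0 < ‖y - x‖ := norm_pos_iff.2 (sub_ne_zero.2 hne.symm)
    -- The points are joined by the path `x`, `x + s • (y₀ - x)`, `y + s • (y₀ - y)`, `y`. The outer
    -- legs run towards the centre of the star ball and have length at most `s * D`. The middle leg
    -- must lie in the ball of radius `s * ρ = 2 * ‖y - x‖` obtained by contracting the star ball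
    -- towards `x`.
    set s : ℝ := 2 * ‖y - x‖ / ρ with hs
    have hs0 : 0 < s := by positivity
    have hs1 : s ≤ 1 := by rw [hs, div_le_one hρ]; linarith
    have hsρ : s * ρ = 2 * ‖y - x‖ := by rw [hs]; field_simp
    have hx' := h x (subset_closure hxΩ) (ball_subset_ball (min_le_left _ _) hx)
    have hy' := h y (subset_closure hyΩ) (ball_subset_ball (min_le_left _ _) hy)
    have leg : ∀ x ∈ Ω, (∀ z ∈ ball y₀ ρ, ρ ≤ ‖z - x‖ ∧ ‖z - x‖ ≤ D ∧
        ∀ s ∈ Ioc (0 : ℝ) 1, x + s • (z - x) ∈ Ω) →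
        ‖G (x + s • (y₀ - x)) - G x‖ ≤ K * (s * D) := by
      intro x hx hx'
      obtain ⟨_, h2, h3⟩ := hx' y₀ (mem_ball_self hρ)
      refine (hG x (x + s • (y₀ - x)) ?_).trans ?_
      · rw [segment_eq_image']
        rintro _ ⟨θ, hθ, rfl⟩
        simp only [add_sub_cancel_left, smul_smul]
        rcases hθ.1.eq_or_lt with h0 | h0
        · simpa [← h0] using hx
        · exact h3 _ ⟨by positivity, mul_le_one₀ hθ.2 hs0.le hs1⟩
      · rw [add_sub_cancel_left, norm_smul, Real.norm_eq_abs, abs_of_pos hs0]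
        gcongr
    have mid : ‖G (y + s • (y₀ - y)) - G (x + s • (y₀ - x))‖ ≤ K * ‖y - x‖ := by
      refine (hG _ _ ?_).trans ?_
      · have hconv : Convex ℝ ((fun z => x + s • (z - x)) '' ball y₀ ρ) := by
          have : (fun z => x + s • (z - x)) = fun z => AffineMap.homothety x s z := by
            ext z; simp [AffineMap.homothety_apply, add_comm]
          rw [this]
          exact (convex_ball y₀ ρ).affine_image _
        -- The second witness solves `x + s • (z - x) = y + s • (y₀ - y)` for `z`; its distance from
        -- `y₀` is `(1 - s) * ‖y - x‖ / s < ρ`.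
        refine (hconv.segment_subset ⟨y₀, mem_ball_self hρ, rfl⟩
          ⟨y₀ + ((1 - s) / s) • (y - x), ?_, ?_⟩).trans ?_
        · rw [mem_ball, dist_eq_norm, add_sub_cancel_left, norm_smul, Real.norm_eq_abs,
            abs_of_nonneg (by have := sub_nonneg.2 hs1; positivity), div_mul_eq_mul_div,
            div_lt_iff₀ hs0]
          nlinarith
        · have : s • ((1 - s) / s) • (y - x) = (1 - s) • (y - x) := by
            rw [smul_smul]; congr 1; field_simp
          simp only [smul_sub, smul_add, sub_smul, one_smul] at this ⊢
          rw [this]; abel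
        · rintro _ ⟨z, hz, rfl⟩
          exact (hx' z hz).2.2 s ⟨hs0, hs1⟩
      · have e : y + s • (y₀ - y) - (x + s • (y₀ - x)) = (1 - s) • (y - x) := by
          simp only [smul_sub, sub_smul, one_smul]; abel
        rw [e, norm_smul, Real.norm_eq_abs, abs_of_nonneg (sub_nonneg.2 hs1)]
        refine mul_le_mul_of_nonneg_left ?_ hK
        exact mul_le_of_le_one_left (norm_nonneg _) (by linarith)
    have l1 := leg x hxΩ hx'
    have l2 := leg y hyΩ hy'
    have e : G y - G x = -(G (y + s • (y₀ - y)) - G y) +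
        (G (y + s • (y₀ - y)) - G (x + s • (y₀ - x))) + (G (x + s • (y₀ - x)) - G x) := by abel
    rw [e]
    have n1 := norm_add₃_le (a := -(G (y + s • (y₀ - y)) - G y))
      (b := G (y + s • (y₀ - y)) - G (x + s • (y₀ - x))) (c := G (x + s • (y₀ - x)) - G x)
    rw [norm_neg] at n1
    have e3 : (4 * D / ρ + 1) * K * ‖y - x‖ = 2 * (K * (s * D)) + K * ‖y - x‖ := by
      rw [hs]; field_simp; ring
    rw [e3]; linarith
  choose ε hε Cl hCl hl using loc
  obtain ⟨t, ht⟩ := hΩ.isCompact_closure.elim_finite_subcover (fun i : closure Ω => ball (i : Plane) (ε i))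
    (fun i => isOpen_ball) (fun x hx => mem_iUnion.2 ⟨⟨x, hx⟩, mem_ball_self (hε _)⟩)
  obtain ⟨δ, hδ, hleb⟩ := lebesgue_number_lemma_of_metric
    (c := fun i : t => ball (i.1 : Plane) (ε i.1)) hΩ.isCompact_closure (fun i => isOpen_ball)
    (fun x hx => by
      obtain ⟨i, hi, hxi⟩ := mem_iUnion₂.1 (ht hx)
      exact mem_iUnion.2 ⟨⟨i, hi⟩, hxi⟩)
  have hsum : 0 ≤ ∑ i ∈ t, Cl i := Finset.sum_nonneg fun i _ => hCl i
  refine ⟨∑ i ∈ t, Cl i + 2 / δ, by positivity, fun K G hK hGb hG x hx y hy => ?_⟩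
  -- Below the Lebesgue number both points lie in one chart; beyond it the boundedness of `G`
  -- suffices.
  rcases lt_or_ge ‖y - x‖ δ with hlt | hge
  · obtain ⟨i, hi⟩ := hleb x (subset_closure hx)
    refine (hl i.1 K G hK hG x hx (hi (mem_ball_self hδ)) y hy (hi ?_)).trans ?_
    · rwa [mem_ball, dist_eq_norm]
    · have : Cl i.1 ≤ ∑ i ∈ t, Cl i := Finset.single_le_sum (fun i _ => hCl i) i.2
      gcongr
      exact this.trans (le_add_of_nonneg_right (by positivity))
  · have h1 := norm_sub_le (G y) (G x)
    have h2 : 2 * K ≤ 2 / δ * K * ‖y - x‖ := by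
      rw [div_mul_eq_mul_div, div_mul_eq_mul_div, le_div_iff₀ hδ]
      gcongr
    have h3 : 0 ≤ (∑ i ∈ t, Cl i) * K * ‖y - x‖ := by positivity
    have := hGb x
    have := hGb y
    nlinarith

end IsLipschitzPolygon

/-! ### Plane vector algebra -/

/-- The determinant of two plane vectors. -/
def cross (u v : Plane) : ℝ := u 0 * v 1 - u 1 * v 0

/-- The clockwise rotation by a right angle. -/
def rot (v : Plane) : Plane := !₂[v 1, -v 0]

@[simp] lemma rot_zero_apply (v : Plane) : rot v 0 = v 1 := rfl
@[simp] lemma rot_one_apply (v : Plane) : rot v 1 = -v 0 := rfl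

lemma norm_sq_plane (v : Plane) : ‖v‖ ^ 2 = v 0 ^ 2 + v 1 ^ 2 := by
  rw [EuclideanSpace.norm_sq_eq]; simp [Fin.sum_univ_two]

lemma norm_rot (v : Plane) : ‖rot v‖ = ‖v‖ := by
  rw [← sq_eq_sq₀ (norm_nonneg _) (norm_nonneg _), norm_sq_plane, norm_sq_plane]
  simp; ring

lemma inner_sq_add_cross_sq (u v : Plane) :
    inner ℝ u v ^ 2 + cross u v ^ 2 = ‖u‖ ^ 2 * ‖v‖ ^ 2 := by
  rw [norm_sq_plane, norm_sq_plane, inner_plane, cross]; ring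

lemma abs_cross_le (u v : Plane) : |cross u v| ≤ ‖u‖ * ‖v‖ := by
  rw [← sq_le_sq₀ (abs_nonneg _) (by positivity), sq_abs, mul_pow]
  nlinarith [inner_sq_add_cross_sq u v, sq_nonneg (inner ℝ u v : ℝ)]

/-- The linear map of the plane with rows `g 0`, `g 1`. -/
def rowApply (g : Fin 2 → Plane) (x : Plane) : Plane := !₂[inner ℝ (g 0) x, inner ℝ (g 1) x]

@[simp] lemma rowApply_zero_apply (g : Fin 2 → Plane) (x : Plane) :
    rowApply g x 0 = inner ℝ (g 0) x := rfl
@[simp] lemma rowApply_one_apply (g : Fin 2 → Plane) (x : Plane) :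
    rowApply g x 1 = inner ℝ (g 1) x := rfl

/-- The quadratic form `u ↦ Ju · g u`, with `J` the clockwise rotation. -/
def quad (g : Fin 2 → Plane) (u : Plane) : ℝ := inner ℝ (rot u) (rowApply g u)

lemma norm_rowApply_le {g : Fin 2 → Plane} {K : ℝ} (hg : ∀ i, ‖g i‖ ≤ K) (x : Plane) :
    ‖rowApply g x‖ ≤ 2 * K * ‖x‖ := by
  refine (norm_plane_le _ _).trans ?_
  have h : ∀ i, |(inner ℝ (g i) x : ℝ)| ≤ K * ‖x‖ := fun i =>
    (abs_real_inner_le_norm _ _).trans (mul_le_mul_of_nonneg_right (hg i) (norm_nonneg _))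
  linarith [h 0, h 1]

lemma abs_quad_le {g : Fin 2 → Plane} {K : ℝ} (hg : ∀ i, ‖g i‖ ≤ K) (u : Plane) :
    |quad g u| ≤ 2 * K * ‖u‖ ^ 2 := by
  refine (abs_real_inner_le_norm _ _).trans ?_
  rw [norm_rot]
  nlinarith [mul_le_mul_of_nonneg_left (norm_rowApply_le hg u) (norm_nonneg u)]

lemma abs_quad_sub_le {g : Fin 2 → Plane} {K : ℝ} (hg : ∀ i, ‖g i‖ ≤ K) (u u' : Plane) :
    |quad g u - quad g u'| ≤ 2 * K * (‖u‖ + ‖u'‖) * ‖u - u'‖ := by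
  have e : quad g u - quad g u' =
      inner ℝ (rot (u - u')) (rowApply g u) + inner ℝ (rot u') (rowApply g (u - u')) := by
    simp only [quad, inner_plane, rot_zero_apply, rot_one_apply, rowApply_zero_apply,
      rowApply_one_apply, PiLp.sub_apply]
    ring
  rw [e]
  refine (abs_add_le _ _).trans ?_
  have h1 := abs_real_inner_le_norm (rot (u - u')) (rowApply g u)
  have h2 := abs_real_inner_le_norm (rot u') (rowApply g (u - u'))
  rw [norm_rot] at h1 h2
  have h3 := mul_le_mul_of_nonneg_left (norm_rowApply_le hg u) (norm_nonneg (u - u'))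
  have h4 := mul_le_mul_of_nonneg_left (norm_rowApply_le hg (u - u')) (norm_nonneg u')
  linarith

/-- The coefficient of an edge of a triangle whose other two edge vectors are `u` and `v` in the
local expansion of the interpolation error. -/
def edgeCoef (g : Fin 2 → Plane) (u v : Plane) : ℝ :=
  inner ℝ u v * (quad g u - quad g v) / (12 * cross u v)

lemma quad_neg (g : Fin 2 → Plane) (u : Plane) : quad g (-u) = quad g u := by
  simp only [quad, inner_plane, rot_zero_apply, rot_one_apply, rowApply_zero_apply,
      rowApply_one_apply, PiLp.neg_apply]
  ring

/-- Two triangles forming an exact parallelogram are related by a half-turn, so for equal gradients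
their coefficients on the common edge coincide. -/
lemma edgeCoef_neg (g : Fin 2 → Plane) (u v : Plane) : edgeCoef g (-u) (-v) = edgeCoef g u v := by
  have h : cross (-u) (-v) = cross u v := by simp [cross]
  simp [edgeCoef, quad_neg, h]

lemma edgeCoef_sub (g g' : Fin 2 → Plane) (u v : Plane) :
    edgeCoef g u v - edgeCoef g' u v = edgeCoef (fun i => g i - g' i) u v := by
  have h : ∀ w, quad (fun i => g i - g' i) w = quad g w - quad g' w := fun w => by
    simp only [quad, inner_plane, rot_zero_apply, rot_one_apply, rowApply_zero_apply,
      rowApply_one_apply, PiLp.sub_apply]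
    ring
  rw [edgeCoef, edgeCoef, edgeCoef, h, h, ← sub_div]
  ring

lemma abs_edgeCoef_le {g : Fin 2 → Plane} {K : ℝ} (hK : 0 ≤ K) (hg : ∀ i, ‖g i‖ ≤ K) {u v : Plane}
    {H lam : ℝ} (hu : ‖u‖ ≤ H) (hv : ‖v‖ ≤ H) (hc : 0 < cross u v) (hH : H ^ 2 ≤ lam * cross u v) :
    |edgeCoef g u v| ≤ lam * K * H ^ 2 := by
  have hH0 : 0 ≤ H := (norm_nonneg u).trans hu
  rw [edgeCoef, abs_div, abs_mul, abs_of_pos (by positivity : 0 < 12 * cross u v),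
    div_le_iff₀ (by positivity)]
  have h1 : |(inner ℝ u v : ℝ)| ≤ H ^ 2 := (abs_real_inner_le_norm _ _).trans (by
    rw [pow_two]; gcongr)
  have h2 : |quad g u - quad g v| ≤ 4 * K * H ^ 2 := by
    refine (abs_sub _ _).trans ?_
    have := abs_quad_le hg u
    have := abs_quad_le hg v
    have : 2 * K * ‖u‖ ^ 2 ≤ 2 * K * H ^ 2 := by gcongr
    have : 2 * K * ‖v‖ ^ 2 ≤ 2 * K * H ^ 2 := by gcongr
    linarith
  calc |(inner ℝ u v : ℝ)| * |quad g u - quad g v| ≤ H ^ 2 * (4 * K * H ^ 2) := by gcongr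
    _ ≤ (lam * cross u v) * (4 * K * H ^ 2) := by gcongr
    _ ≤ lam * K * H ^ 2 * (12 * cross u v) := by
      have : 0 ≤ lam * cross u v * (K * H ^ 2) :=
        mul_nonneg ((sq_nonneg H).trans hH) (by positivity)
      nlinarith

/-! ### Stability of the edge coefficient under changes of edge lengths and direction -/

lemma abs_sq_sub_sq_le {a b H δ : ℝ} (ha : 0 ≤ a) (hb : 0 ≤ b) (haH : a ≤ H) (hbH : b ≤ H)
    (h : |a - b| ≤ δ) : |a ^ 2 - b ^ 2| ≤ 2 * H * δ := by
  rw [sq_sub_sq, abs_mul, abs_of_nonneg (add_nonneg ha hb)]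
  exact mul_le_mul (by linarith) h (abs_nonneg _) (by linarith)

lemma abs_inner_le_sq {u v : Plane} {H : ℝ} (hu : ‖u‖ ≤ H) (hv : ‖v‖ ≤ H) :
    |(inner ℝ u v : ℝ)| ≤ H ^ 2 :=
  (abs_real_inner_le_norm _ _).trans (by
    have := (norm_nonneg u).trans hu
    rw [pow_two]; gcongr)

/-- The law of cosines, in Lipschitz form. -/
lemma abs_inner_sub_inner_le {u v u' v' : Plane} {H δ : ℝ}
    (hu : ‖u‖ ≤ H) (hv : ‖v‖ ≤ H) (hu' : ‖u'‖ ≤ H) (hv' : ‖v'‖ ≤ H) (hw : ‖u + v‖ ≤ H)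
    (hw' : ‖u' + v'‖ ≤ H) (d0 : |‖u + v‖ - ‖u' + v'‖| ≤ δ) (d1 : |‖u‖ - ‖u'‖| ≤ δ)
    (d2 : |‖v‖ - ‖v'‖| ≤ δ) :
    |(inner ℝ u v - inner ℝ u' v' : ℝ)| ≤ 3 * H * δ := by
  have s0 := abs_sq_sub_sq_le (norm_nonneg _) (norm_nonneg _) hw hw' d0
  have s1 := abs_sq_sub_sq_le (norm_nonneg _) (norm_nonneg _) hu hu' d1
  have s2 := abs_sq_sub_sq_le (norm_nonneg _) (norm_nonneg _) hv hv' d2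
  have e1 := norm_add_sq_real u v
  have e2 := norm_add_sq_real u' v'
  rw [abs_le] at s0 s1 s2 ⊢
  constructor <;> linarith

/-- Heron's formula, in Lipschitz form. -/
lemma abs_cross_sub_cross_le {u v u' v' : Plane} {H lam δ : ℝ} (hH0 : 0 < H)
    (hu : ‖u‖ ≤ H) (hv : ‖v‖ ≤ H) (hu' : ‖u'‖ ≤ H) (hv' : ‖v'‖ ≤ H)
    (hc : 0 < cross u v) (hH : H ^ 2 ≤ lam * cross u v) (hc' : 0 < cross u' v')
    (hX : |(inner ℝ u v - inner ℝ u' v' : ℝ)| ≤ 3 * H * δ) (d1 : |‖u‖ - ‖u'‖| ≤ δ)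
    (d2 : |‖v‖ - ‖v'‖| ≤ δ) : |cross u v - cross u' v'| ≤ 10 * lam * H * δ := by
  have hδ : 0 ≤ δ := (abs_nonneg _).trans d1
  have hlam : 0 < lam := by
    by_contra hn
    have := mul_nonpos_of_nonpos_of_nonneg (not_lt.1 hn) hc.le
    have := pow_pos hH0 2
    linarith
  have s1 := abs_sq_sub_sq_le (norm_nonneg _) (norm_nonneg _) hu hu' d1
  have s2 := abs_sq_sub_sq_le (norm_nonneg _) (norm_nonneg _) hv hv' d2
  have hXH := abs_inner_le_sq hu hv
  have hXH' := abs_inner_le_sq hu' hv'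
  have e1 := inner_sq_add_cross_sq u v
  have e2 := inner_sq_add_cross_sq u' v'
  -- Only squares of the areas are polynomial in the edge lengths and inner products. The factor
  -- `cross u v + cross u' v'` is divided out at the end, being at least `cross u v ≥ H ^ 2 / lam`.
  have e3 : (cross u v - cross u' v') * (cross u v + cross u' v') =
      (‖u‖ ^ 2 - ‖u'‖ ^ 2) * ‖v‖ ^ 2 + ‖u'‖ ^ 2 * (‖v‖ ^ 2 - ‖v'‖ ^ 2)
        - (inner ℝ u v - inner ℝ u' v') * (inner ℝ u v + inner ℝ u' v') := by
    linear_combination e1 - e2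
  have a1 : |(‖u‖ ^ 2 - ‖u'‖ ^ 2) * ‖v‖ ^ 2| ≤ 2 * H * δ * H ^ 2 := by
    rw [abs_mul, abs_of_nonneg (sq_nonneg ‖v‖)]; gcongr
  have a2 : |‖u'‖ ^ 2 * (‖v‖ ^ 2 - ‖v'‖ ^ 2)| ≤ H ^ 2 * (2 * H * δ) := by
    rw [abs_mul, abs_of_nonneg (sq_nonneg ‖u'‖)]; gcongr
  have a3 : |(inner ℝ u v - inner ℝ u' v') * (inner ℝ u v + inner ℝ u' v' : ℝ)|
      ≤ 3 * H * δ * (2 * H ^ 2) := by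
    rw [abs_mul]
    have : |(inner ℝ u v + inner ℝ u' v' : ℝ)| ≤ 2 * H ^ 2 := (abs_add_le _ _).trans (by linarith)
    gcongr
  have e4 : |(cross u v - cross u' v') * (cross u v + cross u' v')| ≤ 10 * H ^ 3 * δ := by
    rw [e3]
    refine (abs_sub _ _).trans ((add_le_add_left (abs_add_le _ _) _).trans ?_)
    linarith
  rw [abs_mul, abs_of_pos (add_pos hc hc')] at e4
  have e5 : |cross u v - cross u' v'| * H ^ 2 ≤ 10 * lam * H * δ * H ^ 2 := by
    calc |cross u v - cross u' v'| * H ^ 2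
        ≤ |cross u v - cross u' v'| * (lam * (cross u v + cross u' v')) := by
          have : 0 ≤ lam * cross u' v' := by positivity
          gcongr; linarith
      _ = lam * (|cross u v - cross u' v'| * (cross u v + cross u' v')) := by ring
      _ ≤ lam * (10 * H ^ 3 * δ) := by gcongr
      _ = _ := by ring
  exact le_of_mul_le_mul_right e5 (by positivity)

/-- The coordinates of a side of a triangle in the orthonormal frame of another side. -/
lemma edge_frame {u v t : Plane} {l : ℝ} (ht : ‖t‖ = 1) (he : u + v = -(l • t)) :
    l * inner ℝ u t = -(‖u‖ ^ 2 + inner ℝ u v) ∧ l * inner ℝ u (rot t) = - cross u v ∧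
      u = (inner ℝ u t : ℝ) • t + (inner ℝ u (rot t) : ℝ) • rot t := by
  have e0 : u 0 + v 0 = -(l * t 0) := by have := congrArg (· 0) he; simpa using this
  have e1 : u 1 + v 1 = -(l * t 1) := by have := congrArg (· 1) he; simpa using this
  have ht2 : t 0 ^ 2 + t 1 ^ 2 = 1 := by rw [← norm_sq_plane, ht]; norm_num
  refine ⟨?_, ?_, ?_⟩
  · rw [norm_sq_plane, inner_plane, inner_plane]
    linear_combination u 0 * e0 + u 1 * e1
  · rw [inner_plane, cross]; simp only [rot_zero_apply, rot_one_apply]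
    linear_combination u 0 * e1 - u 1 * e0
  · ext i; fin_cases i
    · simp [inner_plane]; linear_combination -(u 0) * ht2
    · simp [inner_plane]; linear_combination -(u 1) * ht2

/-- If three terms are controlled by `H δ`, then so is the quotient by a comparable length. -/
lemma abs_sub_le_of_mul {l H lam c δ a : ℝ} (hl : 0 < l) (hHl : H ≤ lam * l) (hc : 0 ≤ c)
    (hδ : 0 ≤ δ) (h : |l * a| ≤ c * H * δ) : |a| ≤ c * lam * δ := by
  rw [abs_mul, abs_of_pos hl] at h
  refine le_of_mul_le_mul_left (h.trans ?_) hl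
  calc c * H * δ ≤ c * (lam * l) * δ := by gcongr
    _ = _ := by ring

/-- In the frame `t, rot t` the side `u` has coordinates `-(‖u‖ ^ 2 + inner u v) / l` and `-cross u
v / l`, which the two preceding estimates control. The change of frame accounts for `η`, and `v`
follows because the sides close up. -/
lemma norm_side_sub_le {u v u' v' t t' : Plane} {H lam l l' δ η : ℝ} (hlam : 1 ≤ lam)
    (hu : ‖u‖ ≤ H) (hv : ‖v‖ ≤ H) (hu' : ‖u'‖ ≤ H) (hv' : ‖v'‖ ≤ H)
    (hl : 0 < l) (hl' : 0 < l') (hlH : l ≤ H) (hlH' : l' ≤ H)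
    (ht : ‖t‖ = 1) (ht' : ‖t'‖ = 1) (he : u + v = -(l • t)) (he' : u' + v' = -(l' • t'))
    (hc : 0 < cross u v) (hH : H ^ 2 ≤ lam * cross u v) (hc' : 0 < cross u' v')
    (d0 : |l - l'| ≤ δ) (d1 : |‖u‖ - ‖u'‖| ≤ δ) (d2 : |‖v‖ - ‖v'‖| ≤ δ) (dt : ‖t - t'‖ ≤ η) :
    ‖u - u'‖ ≤ 17 * lam ^ 2 * δ + 2 * H * η ∧ ‖v - v'‖ ≤ 18 * lam ^ 2 * δ + 3 * H * η := by
  have hδ : 0 ≤ δ := (abs_nonneg _).trans d0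
  have hH0 : 0 < H := hl.trans_le hlH
  have hlam0 : 0 < lam := by linarith
  have n0 : ‖u + v‖ = l := by rw [he, norm_neg, norm_smul, ht, mul_one, Real.norm_of_nonneg hl.le]
  have n0' : ‖u' + v'‖ = l' := by
    rw [he', norm_neg, norm_smul, ht', mul_one, Real.norm_of_nonneg hl'.le]
  have hXd := abs_inner_sub_inner_le hu hv hu' hv' (n0.trans_le hlH) (n0'.trans_le hlH')
    (by rwa [n0, n0']) d1 d2
  have hYY := abs_cross_sub_cross_le hH0 hu hv hu' hv' hc hH hc' hXd d1 d2
  have s1 := abs_sq_sub_sq_le (norm_nonneg _) (norm_nonneg _) hu hu' d1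
  obtain ⟨hx, hy, hxy⟩ := edge_frame ht he
  obtain ⟨hx', hy', hxy'⟩ := edge_frame ht' he'
  have hHl : H ≤ lam * l := by
    have h1 : cross u v ≤ H * l := by
      have e : cross u v = cross u (u + v) := by simp [cross]; ring
      rw [e]
      refine (le_abs_self _).trans ((abs_cross_le _ _).trans ?_)
      rw [n0]; gcongr
    refine le_of_mul_le_mul_right ?_ hH0
    calc H * H = H ^ 2 := by ring
      _ ≤ lam * (H * l) := hH.trans (by gcongr)
      _ = _ := by ring
  generalize inner ℝ u t = x at *
  generalize inner ℝ u (rot t) = y at *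
  have hx₁H : |(inner ℝ u' t' : ℝ)| ≤ H :=
    (abs_real_inner_le_norm _ _).trans (by rw [ht', mul_one]; exact hu')
  have hy₁H : |(inner ℝ u' (rot t') : ℝ)| ≤ H := (abs_real_inner_le_norm _ _).trans (by
    rw [norm_rot, ht', mul_one]; exact hu')
  generalize inner ℝ u' t' = x₁ at *
  generalize inner ℝ u' (rot t') = y₁ at *
  have hxx : |x - x₁| ≤ 6 * lam * δ := by
    refine abs_sub_le_of_mul hl hHl (by norm_num) hδ ?_
    have e : l * (x - x₁) = -(‖u‖ ^ 2 - ‖u'‖ ^ 2) - (inner ℝ u v - inner ℝ u' v') - (l - l') * x₁ := by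
      linear_combination hx - hx'
    have b3 : |(l - l') * x₁| ≤ δ * H := by rw [abs_mul]; gcongr
    rw [e]
    rw [abs_le] at s1 hXd b3 ⊢
    constructor <;> linarith
  have hyy : |y - y₁| ≤ 11 * lam * lam * δ := by
    refine abs_sub_le_of_mul hl hHl (by positivity) hδ ?_
    have e : l * (y - y₁) = -(cross u v - cross u' v') - (l - l') * y₁ := by
      linear_combination hy - hy'
    have b3 : |(l - l') * y₁| ≤ δ * H := by rw [abs_mul]; gcongr
    have b4 : δ * H ≤ lam * H * δ := by
      calc δ * H = 1 * (H * δ) := by ring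
        _ ≤ lam * (H * δ) := by gcongr
        _ = _ := by ring
    rw [e]
    rw [abs_le] at hYY b3 ⊢
    constructor <;> linarith
  have b5 : 6 * lam * δ ≤ 6 * lam ^ 2 * δ := by
    have : lam ≤ lam ^ 2 := by nlinarith only [hlam]
    gcongr
  have huu : ‖u - u'‖ ≤ 17 * lam ^ 2 * δ + 2 * H * η := by
    have e : u - u' = (x - x₁) • t + (y - y₁) • rot t + x₁ • (t - t') + y₁ • rot (t - t') := by
      have : rot (t - t') = rot t - rot t' := by ext i; fin_cases i <;> simp; ring
      rw [this]
      nth_rewrite 1 [hxy, hxy']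
      simp only [sub_smul, smul_sub]; abel
    rw [e]
    refine (norm_add_le _ _).trans ((add_le_add_left (norm_add₃_le) _).trans ?_)
    simp only [norm_smul, norm_rot, ht, mul_one, Real.norm_eq_abs]
    have b1 : |x₁| * ‖t - t'‖ ≤ H * η := by gcongr
    have b2 : |y₁| * ‖t - t'‖ ≤ H * η := by gcongr
    linarith
  refine ⟨huu, ?_⟩
  have e : v - v' = -(u - u') - (l - l') • t - l' • (t - t') := by
    have e1 : v = -(l • t) - u := by rw [← he]; abel
    have e2 : v' = -(l' • t') - u' := by rw [← he']; abel
    rw [e1, e2]; simp only [sub_smul, smul_sub]; abel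
  rw [e]
  refine (norm_sub_le _ _).trans ((add_le_add_left (norm_sub_le _ _) _).trans ?_)
  rw [norm_neg, norm_smul, norm_smul, ht, Real.norm_eq_abs, Real.norm_eq_abs, abs_of_pos hl',
    mul_one]
  have b1 : l' * ‖t - t'‖ ≤ H * η := by gcongr
  have b3 : δ ≤ lam ^ 2 * δ := le_mul_of_one_le_left hδ (by nlinarith only [hlam])
  linarith

/-- The edge coefficient depends on the three edge lengths and the direction of the edge in a
Lipschitz way. -/
lemma abs_edgeCoef_sub_le {g : Fin 2 → Plane} {K : ℝ} (hK : 0 ≤ K) (hg : ∀ i, ‖g i‖ ≤ K)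
    {u v u' v' t t' : Plane} {H lam l l' δ η : ℝ} (hlam : 1 ≤ lam)
    (hu : ‖u‖ ≤ H) (hv : ‖v‖ ≤ H) (hu' : ‖u'‖ ≤ H) (hv' : ‖v'‖ ≤ H)
    (hl : 0 < l) (hl' : 0 < l') (hlH : l ≤ H) (hlH' : l' ≤ H)
    (ht : ‖t‖ = 1) (ht' : ‖t'‖ = 1) (he : u + v = -(l • t)) (he' : u' + v' = -(l' • t'))
    (hc : 0 < cross u v) (hH : H ^ 2 ≤ lam * cross u v)
    (hc' : 0 < cross u' v') (hX' : |(inner ℝ u' v' : ℝ)| ≤ lam * cross u' v')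
    (d0 : |l - l'| ≤ δ) (d1 : |‖u‖ - ‖u'‖| ≤ δ) (d2 : |‖v‖ - ‖v'‖| ≤ δ) (dt : ‖t - t'‖ ≤ η) :
    |edgeCoef g u v - edgeCoef g u' v'| ≤ 16 * lam ^ 3 * K * H * (δ + H * η) := by
  have hδ : 0 ≤ δ := (abs_nonneg _).trans d0
  have hη : 0 ≤ η := (norm_nonneg _).trans dt
  have hH0 : 0 < H := hl.trans_le hlH
  have hlam0 : 0 < lam := by linarith
  have n0 : ‖u + v‖ = l := by rw [he, norm_neg, norm_smul, ht, mul_one, Real.norm_of_nonneg hl.le]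
  have n0' : ‖u' + v'‖ = l' := by
    rw [he', norm_neg, norm_smul, ht', mul_one, Real.norm_of_nonneg hl'.le]
  have hXd := abs_inner_sub_inner_le hu hv hu' hv' (n0.trans_le hlH) (n0'.trans_le hlH')
    (by rwa [n0, n0']) d1 d2
  have hYY := abs_cross_sub_cross_le hH0 hu hv hu' hv' hc hH hc' hXd d1 d2
  obtain ⟨huu, hvv⟩ := norm_side_sub_le hlam hu hv hu' hv' hl hl' hlH hlH' ht ht' he he' hc hH hc'
    d0 d1 d2 dt
  have hXH := abs_inner_le_sq hu hv
  have hNN : |(quad g u - quad g v) - (quad g u' - quad g v')|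
      ≤ 4 * K * H * (35 * lam ^ 2 * δ + 5 * H * η) := by
    have e : (quad g u - quad g v) - (quad g u' - quad g v')
        = (quad g u - quad g u') - (quad g v - quad g v') := by ring
    rw [e]
    refine (abs_sub _ _).trans ?_
    have b1 := abs_quad_sub_le hg u u'
    have b2 := abs_quad_sub_le hg v v'
    have b3 : 2 * K * (‖u‖ + ‖u'‖) * ‖u - u'‖
        ≤ 2 * K * (H + H) * (17 * lam ^ 2 * δ + 2 * H * η) := by gcongr
    have b4 : 2 * K * (‖v‖ + ‖v'‖) * ‖v - v'‖
        ≤ 2 * K * (H + H) * (18 * lam ^ 2 * δ + 3 * H * η) := by gcongr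
    linarith
  have hN₁b : |quad g u' - quad g v'| ≤ 4 * K * H ^ 2 := by
    refine (abs_sub _ _).trans ?_
    have := abs_quad_le hg u'
    have := abs_quad_le hg v'
    have : 2 * K * ‖u'‖ ^ 2 ≤ 2 * K * H ^ 2 := by gcongr
    have : 2 * K * ‖v'‖ ^ 2 ≤ 2 * K * H ^ 2 := by gcongr
    linarith
  unfold edgeCoef
  generalize (inner ℝ u v : ℝ) = X at *
  generalize (inner ℝ u' v' : ℝ) = X₁ at *
  generalize cross u v = Y at *
  generalize cross u' v' = Y₁ at *
  generalize quad g u - quad g v = N at *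
  generalize quad g u' - quad g v' = N₁ at *
  -- Arranged so that `Y₁` occurs only in the bounded quotient `X₁ / Y₁`: the bound by `H ^ 2` is
  -- assumed for the first triangle alone. The final constant is `(140 + 52) / 12 = 16`.
  have hdecomp : X * N / (12 * Y) - X₁ * N₁ / (12 * Y₁) =
      1 / 12 * (X / Y * (N - N₁) + ((X - X₁) - X₁ / Y₁ * (Y - Y₁)) / Y * N₁) := by
    field_simp
    ring
  have hXY : |X / Y| ≤ lam := by
    rw [abs_div, abs_of_pos hc, div_le_iff₀ hc]; exact hXH.trans hH
  have hXY' : |X₁ / Y₁| ≤ lam := by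
    rw [abs_div, abs_of_pos hc', div_le_iff₀ hc']; exact hX'
  have hlam2 : 1 ≤ lam ^ 2 := one_le_pow₀ hlam
  have hsecond : |((X - X₁) - X₁ / Y₁ * (Y - Y₁)) / Y * N₁| ≤ 52 * (lam ^ 3 * K * H * δ) := by
    rw [abs_mul, abs_div, abs_of_pos hc, div_mul_eq_mul_div, div_le_iff₀ hc]
    have b1 : |(X - X₁) - X₁ / Y₁ * (Y - Y₁)| ≤ 13 * lam ^ 2 * H * δ := by
      refine (abs_sub _ _).trans ?_
      rw [abs_mul]
      have c1 : |X₁ / Y₁| * |Y - Y₁| ≤ lam * (10 * lam * H * δ) := by gcongr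
      have c2 : 1 * (H * δ) ≤ lam ^ 2 * (H * δ) := by gcongr
      linarith
    calc _ ≤ 13 * lam ^ 2 * H * δ * (4 * K * H ^ 2) := by gcongr
      _ ≤ 13 * lam ^ 2 * H * δ * (4 * K * (lam * Y)) := by gcongr
      _ = _ := by ring
  have hfirst : |X / Y * (N - N₁)| ≤ lam * (4 * K * H * (35 * lam ^ 2 * δ + 5 * H * η)) := by
    rw [abs_mul]; gcongr
  have hlast : 1 * (lam * K * H * (H * η)) ≤ lam ^ 2 * (lam * K * H * (H * η)) := by
    gcongr
  have habs := abs_add_le (X / Y * (N - N₁)) (((X - X₁) - X₁ / Y₁ * (Y - Y₁)) / Y * N₁)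
  have hpos : 0 ≤ lam ^ 3 * K * H * (H * η) := by positivity
  rw [hdecomp, abs_mul, abs_of_pos (by norm_num : (0 : ℝ) < 1 / 12)]
  linarith

/-! ### The reference triangle -/

/-- The reference triangle in `ℝ × ℝ`. -/
def refTriangle : Set (ℝ × ℝ) := {x | 0 ≤ x.1 ∧ 0 ≤ x.2 ∧ x.1 + x.2 ≤ 1}

lemma isCompact_refTriangle : IsCompact refTriangle := by
  refine (isCompact_Icc (a := ((0 : ℝ), (0 : ℝ))) (b := ((1 : ℝ), (1 : ℝ)))).of_isClosed_subset ?_ ?_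
  · exact (isClosed_le continuous_const continuous_fst).inter
      ((isClosed_le continuous_const continuous_snd).inter
        (isClosed_le (continuous_fst.add continuous_snd) continuous_const))
  · rintro ⟨x, y⟩ ⟨h1, h2, h3⟩
    simp only at h1 h2 h3
    exact ⟨⟨h1, h2⟩, ⟨by simp; linarith, by simp; linarith⟩⟩

lemma integral_refTriangle (α β γ : ℝ) :
    ∫ x in refTriangle, (α + β * x.1 + γ * x.2) = α / 2 + β / 6 + γ / 6 := by
  have hint : Integrable (refTriangle.indicator fun x : ℝ × ℝ => α + β * x.1 + γ * x.2) := by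
    refine IntegrableOn.integrable_indicator ?_ isCompact_refTriangle.measurableSet
    exact (by fun_prop : Continuous fun x : ℝ × ℝ => α + β * x.1 + γ * x.2).continuousOn
      |>.integrableOn_compact isCompact_refTriangle
  rw [← integral_indicator isCompact_refTriangle.measurableSet, Measure.volume_eq_prod,
    integral_prod _ (by rwa [← Measure.volume_eq_prod])]
  have inner_eq : ∀ x : ℝ, ∫ y, refTriangle.indicator (fun x : ℝ × ℝ => α + β * x.1 + γ * x.2) (x, y)
      = (Icc (0 : ℝ) 1).indicator (fun x => (α + β * x) * (1 - x) + γ * (1 - x) ^ 2 / 2) x := by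
    intro x
    by_cases hx : x ∈ Icc (0 : ℝ) 1
    · rw [indicator_of_mem hx]
      have : (fun y => refTriangle.indicator (fun x : ℝ × ℝ => α + β * x.1 + γ * x.2) (x, y))
          = (Icc (0 : ℝ) (1 - x)).indicator (fun y => α + β * x + γ * y) := by
        ext y
        by_cases hy : y ∈ Icc (0 : ℝ) (1 - x)
        · rw [indicator_of_mem hy, indicator_of_mem]
          exact ⟨hx.1, hy.1, by simp; linarith [hy.2]⟩
        · rw [indicator_of_notMem hy, indicator_of_notMem]
          rintro ⟨_, h2, h3⟩
          exact hy ⟨h2, by simp at h3; linarith⟩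
      rw [this, integral_indicator measurableSet_Icc, integral_Icc_eq_integral_Ioc,
        ← intervalIntegral.integral_of_le (by linarith [hx.2])]
      rw [intervalIntegral.integral_add (Continuous.intervalIntegrable (by fun_prop) _ _)
        (Continuous.intervalIntegrable (by fun_prop) _ _), intervalIntegral.integral_const,
        intervalIntegral.integral_const_mul, integral_id]
      simp; ring
    · rw [indicator_of_notMem hx]
      have : (fun y => refTriangle.indicator (fun x : ℝ × ℝ => α + β * x.1 + γ * x.2) (x, y))
          = fun _ => 0 := by
        ext y
        rw [indicator_of_notMem]
        rintro ⟨h1, h2, h3⟩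
        exact hx ⟨h1, by simp at h1 h2 h3; linarith⟩
      rw [this, integral_zero]
  simp_rw [inner_eq]
  rw [integral_indicator measurableSet_Icc, integral_Icc_eq_integral_Ioc,
    ← intervalIntegral.integral_of_le zero_le_one]
  have : ∀ x : ℝ, (α + β * x) * (1 - x) + γ * (1 - x) ^ 2 / 2 =
      (α + γ / 2) + (β - α - γ) * x + (γ / 2 - β) * x ^ 2 := fun x => by ring
  simp_rw [this]
  rw [intervalIntegral.integral_add, intervalIntegral.integral_add,
    intervalIntegral.integral_const, intervalIntegral.integral_const_mul,
    intervalIntegral.integral_const_mul, integral_id, integral_pow]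
  · norm_num; ring
  all_goals exact Continuous.intervalIntegrable (by fun_prop) _ _

lemma eq_or_eq_add_one_or_eq_add_two : ∀ j k : Fin 3, j = k ∨ j = k + 1 ∨ j = k + 2 := by
  decide

/-! ### Edge vectors, barycentric coordinates and area of a triangle -/

namespace Triangle

variable (τ : Triangle)

/-- The edge vector of `e_k`, oriented counterclockwise. -/
def vec (k : Fin 3) : Plane := τ.a (k + 2) - τ.a (k + 1)

/-- Twice the area. -/
def det : ℝ := (τ.a 1 0 - τ.a 0 0) * (τ.a 2 1 - τ.a 0 1) - (τ.a 1 1 - τ.a 0 1) * (τ.a 2 0 - τ.a 0 0)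

lemma det_pos : 0 < τ.det := τ.ccw

/-- The centroid. -/
def centroid : Plane := (1 / 3 : ℝ) • (τ.a 0 + τ.a 1 + τ.a 2)

lemma cross_vec (k : Fin 3) : cross (τ.vec (k + 1)) (τ.vec (k + 2)) = τ.det := by
  fin_cases k <;> simp [cross, vec, det] <;> ring

lemma vec_add (k : Fin 3) : τ.vec (k + 1) + τ.vec (k + 2) = -τ.vec k := by
  fin_cases k <;> simp [vec]

lemma len_eq (k : Fin 3) : τ.len k = ‖τ.vec k‖ := by
  rw [len, dist_comm, dist_eq_norm, vec]

lemma vec_ne_zero (k : Fin 3) : τ.vec k ≠ 0 := by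
  intro h
  have h1 := τ.cross_vec (k + 2)
  have : k + 2 + 1 = k := by fin_cases k <;> rfl
  rw [this, h] at h1
  have := τ.det_pos
  simp [cross] at h1
  linarith

lemma len_pos (k : Fin 3) : 0 < τ.len k := by
  rw [len_eq]; exact norm_pos_iff.2 (τ.vec_ne_zero k)

lemma vec_eq (k : Fin 3) : τ.vec k = τ.len k • τ.tangent k := by
  rw [tangent, smul_smul, mul_inv_cancel₀ (τ.len_pos k).ne', one_smul, vec]

lemma norm_tangent (k : Fin 3) : ‖τ.tangent k‖ = 1 := by
  have h := congrArg norm (τ.vec_eq k)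
  rw [norm_smul, ← len_eq, Real.norm_of_nonneg (τ.len_pos k).le] at h
  have := τ.len_pos k
  field_simp at h
  exact h.symm

lemma len_smul_normal (k : Fin 3) : τ.len k • τ.normal k = rot (τ.vec k) := by
  rw [vec_eq]; ext i; fin_cases i <;> simp [normal, rot]

lemma flux_eq (q : Plane → Plane) (k : Fin 3) : τ.flux q k =
    ∫ s in (0 : ℝ)..1, inner ℝ (q (AffineMap.lineMap (τ.a (k + 1)) (τ.a (k + 2)) s))
      (rot (τ.vec k)) := by
  rw [flux, ← intervalIntegral.integral_const_mul]
  congr 1; ext s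
  rw [← len_smul_normal, inner_smul_right]

lemma vertex_mem (k : Fin 3) : τ.a k ∈ τ.carrier := subset_convexHull ℝ _ ⟨k, rfl⟩

lemma convex_carrier : Convex ℝ τ.carrier := convex_convexHull ℝ _

lemma isCompact_carrier : IsCompact τ.carrier := (finite_range τ.a).isCompact_convexHull (𝕜 := ℝ)

/-- The barycentric coordinate belonging to the vertex `a k`. -/
def bary (k : Fin 3) (x : Plane) : ℝ := cross (τ.vec k) (x - τ.a (k + 1)) / τ.det

lemma bary_self (k : Fin 3) : τ.bary k (τ.a k) = 1 := by
  rw [bary, div_eq_one_iff_eq τ.det_pos.ne']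
  fin_cases k <;> simp [cross, vec, det] <;> ring

lemma bary_add_one (k : Fin 3) : τ.bary k (τ.a (k + 1)) = 0 := by simp [bary, cross]

lemma bary_add_two (k : Fin 3) : τ.bary k (τ.a (k + 2)) = 0 := by
  simp [bary, cross, vec]; left; ring

lemma bary_combo (k : Fin 3) (x y : Plane) (s t : ℝ) (h : s + t = 1) :
    τ.bary k (s • x + t • y) = s * τ.bary k x + t * τ.bary k y := by
  obtain rfl : s = 1 - t := by linarith
  simp only [bary, cross, PiLp.add_apply, PiLp.sub_apply, PiLp.smul_apply, smul_eq_mul]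
  ring

lemma sum_bary (x : Plane) : τ.bary 0 x + τ.bary 1 x + τ.bary 2 x = 1 := by
  simp only [bary]
  rw [← add_div, ← add_div, div_eq_one_iff_eq τ.det_pos.ne']
  simp [cross, vec, det]; ring

lemma sum_bary_smul (x : Plane) : τ.bary 0 x • τ.a 0 + τ.bary 1 x • τ.a 1 + τ.bary 2 x • τ.a 2 = x := by
  have h := τ.det_pos.ne'
  ext i
  fin_cases i
  · simp only [bary, Fin.zero_eta, PiLp.add_apply, PiLp.smul_apply, smul_eq_mul]
    field_simp
    simp [cross, vec, det]; ring
  · simp only [bary, Fin.mk_one, PiLp.add_apply, PiLp.smul_apply, smul_eq_mul]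
    field_simp
    simp [cross, vec, det]; ring

lemma continuous_bary (k : Fin 3) : Continuous (τ.bary k) := by
  unfold bary cross; fun_prop

lemma mem_carrier_iff (x : Plane) : x ∈ τ.carrier ↔ ∀ k, 0 ≤ τ.bary k x := by
  constructor
  · intro hx k
    have hconv : Convex ℝ {y | 0 ≤ τ.bary k y} := by
      intro y hy z hz s t hs ht hst
      simp only [mem_ofPred_eq] at *
      rw [bary_combo _ _ _ _ _ _ hst]
      positivity
    refine convexHull_min ?_ hconv hx
    rintro _ ⟨j, rfl⟩
    have : j = k ∨ j = k + 1 ∨ j = k + 2 := eq_or_eq_add_one_or_eq_add_two j k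
    rcases this with rfl | rfl | rfl
    · simp [bary_self]
    · simp [bary_add_one]
    · simp [bary_add_two]
  · intro h
    have hx := τ.sum_bary_smul x
    rw [← hx]
    have := τ.convex_carrier.sum_mem (t := Finset.univ) (w := fun k => τ.bary k x) (z := τ.a)
      (fun k _ => h k) (by rw [Fin.sum_univ_three]; exact τ.sum_bary x) (fun k _ => τ.vertex_mem k)
    rwa [Fin.sum_univ_three] at this

lemma mem_interior_of_bary_pos {x : Plane} (h : ∀ k, 0 < τ.bary k x) : x ∈ interior τ.carrier := by
  rw [mem_interior]
  refine ⟨⋂ k, {y | 0 < τ.bary k y}, ?_, ?_, ?_⟩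
  · intro y hy
    rw [mem_carrier_iff]
    exact fun k => (mem_iInter.1 hy k).le
  · exact isOpen_iInter_of_finite fun k => isOpen_lt continuous_const (τ.continuous_bary k)
  · exact mem_iInter.2 h

lemma bary_centroid (k : Fin 3) : τ.bary k τ.centroid = 1 / 3 := by
  rw [bary, div_eq_iff τ.det_pos.ne']
  fin_cases k <;> simp [cross, vec, det, centroid] <;> ring

lemma centroid_mem_interior : τ.centroid ∈ interior τ.carrier :=
  τ.mem_interior_of_bary_pos fun k => by rw [bary_centroid]; norm_num

lemma interior_nonempty : (interior τ.carrier).Nonempty := ⟨_, τ.centroid_mem_interior⟩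

lemma carrier_subset_closure_interior : τ.carrier ⊆ closure (interior τ.carrier) := by
  rw [τ.convex_carrier.closure_interior_eq_closure_of_nonempty_interior τ.interior_nonempty]
  exact subset_closure

lemma volume_frontier : volume (frontier τ.carrier) = 0 := τ.convex_carrier.addHaar_frontier volume

lemma interior_ae_eq : interior τ.carrier =ᵐ[volume] τ.carrier :=
  interior_ae_eq_of_null_frontier τ.volume_frontier

lemma bary_eq_zero_of_mem_edgeSet {k : Fin 3} {x : Plane} (hx : x ∈ τ.edgeSet k) :
    τ.bary k x = 0 := by
  obtain ⟨s, t, _, _, hst, rfl⟩ := hx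
  rw [bary_combo _ _ _ _ _ _ hst, bary_add_one, bary_add_two]; simp

lemma edgeSet_subset (k : Fin 3) : τ.edgeSet k ⊆ τ.carrier :=
  τ.convex_carrier.segment_subset (τ.vertex_mem _) (τ.vertex_mem _)

/-- The integral of an affine function over a triangle. -/
lemma integral_affine (g : Plane) (b : ℝ) :
    ∫ x in τ.carrier, (inner ℝ g x + b) = τ.det / 2 * (inner ℝ g τ.centroid + b) := by
  set u := τ.a 1 - τ.a 0 with hu
  set v := τ.a 2 - τ.a 0 with hv
  set L : Plane →L[ℝ] Plane := (EuclideanSpace.proj (𝕜 := ℝ) (0 : Fin 2)).smulRight u +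
    (EuclideanSpace.proj (𝕜 := ℝ) (1 : Fin 2)).smulRight v with hL
  have hLa : ∀ y : Plane, L y = y 0 • u + y 1 • v := fun y => by simp [hL]
  have hdet : L.det = τ.det := by
    rw [ContinuousLinearMap.det, ← LinearMap.det_toMatrix (EuclideanSpace.basisFun (Fin 2) ℝ).toBasis,
      Matrix.det_fin_two]
    simp [LinearMap.toMatrix_apply, hLa, hu, hv, det]
    ring
  set T₀ : Set Plane := {y | 0 ≤ y 0 ∧ 0 ≤ y 1 ∧ y 0 + y 1 ≤ 1} with hT₀
  have hT₀c : IsClosed T₀ := by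
    exact (isClosed_le (f := fun _ : Plane => (0 : ℝ)) (g := fun y => y 0) (by fun_prop)
      (by fun_prop)).inter ((isClosed_le (f := fun _ : Plane => (0 : ℝ)) (g := fun y => y 1)
      (by fun_prop) (by fun_prop)).inter (isClosed_le (f := fun y : Plane => y 0 + y 1)
      (g := fun _ => (1 : ℝ)) (by fun_prop) (by fun_prop)))
  have hb : ∀ y : Plane, τ.bary 1 (τ.a 0 + L y) = y 0 ∧ τ.bary 2 (τ.a 0 + L y) = y 1 := by
    intro y
    have := τ.det_pos.ne'
    constructor
    · rw [bary, div_eq_iff this]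
      simp [hLa, hu, hv, cross, vec, det]; ring
    · rw [bary, div_eq_iff this]
      simp [hLa, hu, hv, cross, vec, det]; ring
  have himg : (fun y => τ.a 0 + L y) '' T₀ = τ.carrier := by
    ext x
    constructor
    · rintro ⟨y, ⟨h1, h2, h3⟩, rfl⟩
      rw [mem_carrier_iff]
      have hs := τ.sum_bary (τ.a 0 + L y)
      obtain ⟨hb1, hb2⟩ := hb y
      intro k
      fin_cases k
      · change 0 ≤ τ.bary 0 _; linarith
      · change 0 ≤ τ.bary 1 _; linarith
      · change 0 ≤ τ.bary 2 _; linarith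
    · intro hx
      rw [mem_carrier_iff] at hx
      refine ⟨!₂[τ.bary 1 x, τ.bary 2 x], ⟨hx 1, hx 2, ?_⟩, ?_⟩
      · have := τ.sum_bary x
        have := hx 0
        simp; linarith
      · simp only [hLa]
        conv_rhs => rw [← τ.sum_bary_smul x]
        have : τ.bary 0 x = 1 - τ.bary 1 x - τ.bary 2 x := by linarith [τ.sum_bary x]
        rw [this]
        simp only [hu, hv, smul_sub, sub_smul, one_smul]
        simp
        abel
  have hinj : InjOn (fun y => τ.a 0 + L y) T₀ := by
    intro y _ z _ h
    ext i
    have h1 := (hb y).1.symm.trans ((congrArg (τ.bary 1) h).trans (hb z).1)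
    have h2 := (hb y).2.symm.trans ((congrArg (τ.bary 2) h).trans (hb z).2)
    fin_cases i
    · exact h1
    · exact h2
  rw [← himg, integral_image_eq_integral_abs_det_fderiv_smul volume hT₀c.measurableSet
    (fun y _ => (L.hasFDerivAt.const_add (τ.a 0)).hasFDerivWithinAt) hinj, hdet,
    abs_of_pos τ.det_pos, integral_smul, smul_eq_mul]
  -- The integral over the reference triangle was computed by Fubini in `ℝ × ℝ`; this carries it
  -- over to the Euclidean plane.
  have he : MeasurePreserving (fun y : Plane => (y 0, y 1)) volume volume := by
    exact (volume_preserving_finTwoArrow ℝ).comp (PiLp.volume_preserving_ofLp (Fin 2))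
  have hemb : MeasurableEmbedding (fun y : Plane => (y 0, y 1)) := by
    exact (MeasurableEquiv.finTwoArrow.measurableEmbedding).comp
      (MeasurableEquiv.toLp 2 (Fin 2 → ℝ)).symm.measurableEmbedding
  have key := he.setIntegral_preimage_emb hemb (fun x : ℝ × ℝ => (inner ℝ g (τ.a 0) + b)
    + (inner ℝ g u) * x.1 + (inner ℝ g v) * x.2) refTriangle
  rw [integral_refTriangle] at key
  have e : ∀ y : Plane, inner ℝ g (τ.a 0 + L y) + b = (inner ℝ g (τ.a 0) + b)
    + (inner ℝ g u) * y 0 + (inner ℝ g v) * y 1 := fun y => by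
      rw [hLa, inner_add_right, inner_add_right, inner_smul_right, inner_smul_right]; ring
  simp_rw [e]
  have : (fun y : Plane => (y 0, y 1)) ⁻¹' refTriangle = T₀ := rfl
  rw [this] at key
  rw [key, centroid, hu, hv]
  simp only [inner_sub_right, inner_smul_right, inner_add_right]
  ring

lemma volume_real_carrier : volume.real τ.carrier = τ.det / 2 := by
  have := τ.integral_affine 0 1
  simpa using this

end Triangle

/-! ### The local expansion of the interpolation error -/

/-- Here `u, v, w` are the edge vectors and `g₀` is the centroid value of an affine field minus an
`RT0` field with divergence part `b`. The vectors with factor `1 / 6` lead from the centroid to the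
edge midpoints, so the inner products with `rot w`, `rot u`, `rot v` are the fluxes of the
difference; those with factor `1 / 3` lead from the opposite vertices to the centroid. An `RT0`
field with fluxes `N_k` has centroid value `∑ N_k (c - a_k) / det`, so the last bracket accounts for
the interpolant of the difference. The coefficient terms are what interpolation misses,
independently of `b`. The identity is a polynomial one after clearing `cross u v`. -/
lemma centroid_expansion (g : Fin 2 → Plane) (u v w g₀ q : Plane) (b : ℝ) (hw : u + v = -w)
    (hD : cross u v ≠ 0) :
    cross u v / 2 * inner ℝ g₀ q =
      edgeCoef g u v * inner ℝ q (rot w) + edgeCoef g v w * inner ℝ q (rot u)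
      + edgeCoef g w u * inner ℝ q (rot v) + 1 / 2 * (
        inner ℝ (g₀ + (rowApply g ((1 / 6 : ℝ) • (v - u)) - b • (1 / 6 : ℝ) • (v - u))) (rot w)
          * inner ℝ ((1 / 3 : ℝ) • (v - u)) q
      + inner ℝ (g₀ + (rowApply g ((1 / 6 : ℝ) • (w - v)) - b • (1 / 6 : ℝ) • (w - v))) (rot u)
          * inner ℝ ((1 / 3 : ℝ) • (w - v)) q
      + inner ℝ (g₀ + (rowApply g ((1 / 6 : ℝ) • (u - w)) - b • (1 / 6 : ℝ) • (u - w))) (rot v)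
          * inner ℝ ((1 / 3 : ℝ) • (u - w)) q) := by
  obtain rfl : w = -(u + v) := by rw [hw, neg_neg]
  have e1 : cross v (-(u + v)) = cross u v := by simp [cross]; ring
  have e2 : cross (-(u + v)) u = cross u v := by simp [cross]; ring
  simp only [edgeCoef, e1, e2]
  have hD' := hD
  field_simp
  simp only [cross, quad, inner_plane, rot_zero_apply, rot_one_apply, rowApply_zero_apply,
    rowApply_one_apply, PiLp.add_apply, PiLp.sub_apply, PiLp.neg_apply, PiLp.smul_apply,
    smul_eq_mul]
  ring

namespace Triangle

variable (τ : Triangle)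

/-- The coefficient of the edge `e_k` in the local expansion of the interpolation error. -/
def coef (k : Fin 3) (g : Fin 2 → Plane) : ℝ := edgeCoef g (τ.vec (k + 1)) (τ.vec (k + 2))

lemma dist_le_diam {x y : Plane} (hx : x ∈ τ.carrier) (hy : y ∈ τ.carrier) :
    dist x y ≤ diam τ.carrier := dist_le_diam_of_mem τ.isCompact_carrier.isBounded hx hy

lemma len_le_diam (k : Fin 3) : τ.len k ≤ diam τ.carrier :=
  τ.dist_le_diam (τ.vertex_mem _) (τ.vertex_mem _)

lemma norm_vec_le (k : Fin 3) : ‖τ.vec k‖ ≤ diam τ.carrier := by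
  rw [← len_eq]; exact τ.len_le_diam k

lemma diam_pos : 0 < diam τ.carrier := (τ.len_pos 0).trans_le (τ.len_le_diam 0)

lemma det_le_len_mul (k : Fin 3) : τ.det ≤ τ.len k * diam τ.carrier := by
  have h := τ.cross_vec (k + 2)
  have e1 : k + 2 + 1 = k := (by decide : ∀ k : Fin 3, k + 2 + 1 = k) k
  rw [e1] at h
  rw [← h, len_eq]
  exact (le_abs_self _).trans ((abs_cross_le _ _).trans
    (mul_le_mul_of_nonneg_left (τ.norm_vec_le _) (norm_nonneg _)))

lemma det_le : τ.det ≤ diam τ.carrier ^ 2 := by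
  refine (τ.det_le_len_mul 0).trans ?_
  rw [pow_two]
  exact mul_le_mul_of_nonneg_right (τ.len_le_diam 0) diam_nonneg

lemma diam_le_len {lam : ℝ} (h : diam τ.carrier ^ 2 ≤ lam * τ.det) (hlam : 0 ≤ lam) (k : Fin 3) :
    diam τ.carrier ≤ lam * τ.len k := by
  refine le_of_mul_le_mul_right ?_ τ.diam_pos
  calc diam τ.carrier * diam τ.carrier = diam τ.carrier ^ 2 := by ring
    _ ≤ lam * (τ.len k * diam τ.carrier) := h.trans (mul_le_mul_of_nonneg_left (τ.det_le_len_mul k) hlam)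
    _ = _ := by ring

/-- Comparison of the areas of the disk and the triangle. This is the form in which shape regularity
is used from here on, with `lam = 1 + μ ^ 2`. -/
lemma diam_sq_le_of_closedBall {μ : ℝ} (hμ : 0 < μ) {x : Plane}
    (h : closedBall x (diam τ.carrier / μ) ⊆ τ.carrier) :
    diam τ.carrier ^ 2 ≤ (1 + μ ^ 2) * τ.det := by
  have h1 : volume.real (ball x (diam τ.carrier / μ)) ≤ volume.real τ.carrier :=
    measureReal_mono (ball_subset_closedBall.trans h) τ.isCompact_carrier.measure_lt_top.ne
  have hr : 0 ≤ diam τ.carrier / μ := div_nonneg diam_nonneg hμ.le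
  rw [volume_real_carrier, measureReal_def, EuclideanSpace.volume_ball_fin_two,
    ENNReal.toReal_mul, ENNReal.toReal_pow, ENNReal.toReal_ofReal hr] at h1
  have hπ : (3 : ℝ) < (ENNReal.ofReal Real.pi).toReal := by
    rw [ENNReal.toReal_ofReal Real.pi_pos.le]; exact Real.pi_gt_three
  have h2 : diam τ.carrier ^ 2 = (diam τ.carrier / μ) ^ 2 * μ ^ 2 := by field_simp
  have h3 : (diam τ.carrier / μ) ^ 2 ≤ τ.det := by nlinarith [sq_nonneg (diam τ.carrier / μ)]
  have := mul_le_mul_of_nonneg_right h3 (sq_nonneg μ)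
  have := τ.det_pos
  rw [h2]; linarith

lemma centroid_mem : τ.centroid ∈ τ.carrier := interior_subset τ.centroid_mem_interior

lemma centroid_sub (k : Fin 3) :
    τ.centroid - τ.a k = (1 / 3 : ℝ) • (τ.vec (k + 2) - τ.vec (k + 1)) := by
  ext i
  fin_cases k <;> simp [centroid, vec] <;> ring

lemma midpoint_sub_centroid (k : Fin 3) :
    AffineMap.lineMap (τ.a (k + 1)) (τ.a (k + 2)) (1 / 2 : ℝ) - τ.centroid
      = (1 / 6 : ℝ) • (τ.vec (k + 2) - τ.vec (k + 1)) := by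
  ext i
  fin_cases k <;> simp [centroid, vec, AffineMap.lineMap_apply] <;> ring

lemma lineMap_mem (k : Fin 3) {s : ℝ} (hs : s ∈ Icc (0 : ℝ) 1) :
    AffineMap.lineMap (τ.a (k + 1)) (τ.a (k + 2)) s ∈ τ.carrier := by
  refine τ.edgeSet_subset k ?_
  rw [edgeSet, segment_eq_image_lineMap]
  exact ⟨s, hs, rfl⟩

/-- The integral of the interpolation error against a constant field, up to second order. -/
theorem abs_integral_sub_sum_coef_le {p f : Plane → Plane} {q p₀ : Plane} {g : Fin 2 → Plane} {ε : ℝ}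
    (hp : ContinuousOn p τ.carrier) (hf : f ∈ RT0) (hfl : ∀ k, τ.flux f k = τ.flux p k)
    (happ : ∀ x ∈ τ.carrier, ‖p x - (p₀ + rowApply g (x - τ.centroid))‖ ≤ ε) :
    |(∫ x in τ.carrier, inner ℝ (p x - f x) q) - ∑ k, τ.coef k g * inner ℝ q (rot (τ.vec k))|
      ≤ 2 * ε * diam τ.carrier ^ 2 * ‖q‖ := by
  obtain ⟨a, b, rfl⟩ := hf
  have hε : 0 ≤ ε := (norm_nonneg _).trans (happ _ τ.centroid_mem)
  set H := diam τ.carrier with hH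
  have hH0 : 0 < H := τ.diam_pos
  set c := τ.centroid with hc
  have hra : Continuous (rowApply g) := by
    unfold rowApply
    exact (PiLp.continuous_toLp 2 _).comp (continuous_pi fun i => by
      fin_cases i <;> simp <;> fun_prop)
  set lin : Plane → Plane := fun x => p₀ + rowApply g (x - c) with hlin
  have hlinc : Continuous lin := continuous_const.add (hra.comp (continuous_id.sub continuous_const))
  set g₀ : Plane := p₀ - (a + b • c) with hg₀
  have hd : ∀ x, lin x - (a + b • x) = g₀ + (rowApply g (x - c) - b • (x - c)) := by
    intro x; simp only [hlin, hg₀, smul_sub]; abel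
  -- the fluxes of the affine part
  have hη : ∀ k, |(inner ℝ (g₀ + (rowApply g ((1 / 6 : ℝ) • (τ.vec (k + 2) - τ.vec (k + 1)))
      - b • (1 / 6 : ℝ) • (τ.vec (k + 2) - τ.vec (k + 1)))) (rot (τ.vec k)) : ℝ)| ≤ ε * H := by
    intro k
    set m : ℝ → Plane := fun s => AffineMap.lineMap (τ.a (k + 1)) (τ.a (k + 2)) s with hm
    have hmc : Continuous m := AffineMap.lineMap_continuous
    -- The integrand is affine in `s`, so its mean is its midpoint value, the quantity occurring in
    -- `centroid_expansion`.
    have e1 : ∫ s in (0 : ℝ)..1, (inner ℝ (lin (m s) - (a + b • m s)) (rot (τ.vec k)) : ℝ) =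
        inner ℝ (lin (m (1 / 2)) - (a + b • m (1 / 2))) (rot (τ.vec k)) := by
      set A : ℝ := inner ℝ (lin (m 0) - (a + b • m 0)) (rot (τ.vec k)) with hA
      set B : ℝ := inner ℝ (rowApply g (τ.vec k) - b • τ.vec k) (rot (τ.vec k)) with hB
      have e : ∀ s, inner ℝ (lin (m s) - (a + b • m s)) (rot (τ.vec k)) = A + B * s := by
        intro s
        have hms : m s = m 0 + s • τ.vec k := by
          simp [hm, vec, AffineMap.lineMap_apply, add_comm]
        rw [hms, hA, hB]
        simp only [hlin, inner_plane, rot_zero_apply, rot_one_apply, rowApply_zero_apply,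
          rowApply_one_apply, PiLp.add_apply, PiLp.sub_apply, PiLp.smul_apply, smul_eq_mul]
        ring
      simp_rw [e]
      rw [intervalIntegral.integral_add (Continuous.intervalIntegrable (by fun_prop) _ _)
        (Continuous.intervalIntegrable (by fun_prop) _ _), intervalIntegral.integral_const,
        intervalIntegral.integral_const_mul, integral_id]
      simp
    have e2 : m (1 / 2) - c = (1 / 6 : ℝ) • (τ.vec (k + 2) - τ.vec (k + 1)) :=
      τ.midpoint_sub_centroid k
    rw [hd, e2] at e1
    rw [← e1]
    have e3 := hfl k
    rw [flux_eq, flux_eq] at e3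
    have hpi : IntervalIntegrable (fun s => (inner ℝ (p (m s)) (rot (τ.vec k)) : ℝ)) volume 0 1 := by
      refine ContinuousOn.intervalIntegrable ?_
      rw [uIcc_of_le zero_le_one]
      exact (hp.comp hmc.continuousOn fun s hs => τ.lineMap_mem k hs).inner continuousOn_const
    -- The interpolant has the fluxes of `p`, so it may be replaced by `p`; what remains is the flux
    -- of the Taylor remainder.
    have e4 : ∫ s in (0 : ℝ)..1, (inner ℝ (lin (m s) - (a + b • m s)) (rot (τ.vec k)) : ℝ) =
        ∫ s in (0 : ℝ)..1, (inner ℝ (lin (m s) - p (m s)) (rot (τ.vec k)) : ℝ) := by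
      simp_rw [inner_sub_left]
      rw [intervalIntegral.integral_sub, intervalIntegral.integral_sub _ hpi]
      · exact congrArg _ e3
      all_goals exact Continuous.intervalIntegrable (by fun_prop) _ _
    rw [e4]
    have := intervalIntegral.norm_integral_le_of_norm_le_const (a := 0) (b := 1) (C := ε * H)
      (f := fun s => (inner ℝ (lin (m s) - p (m s)) (rot (τ.vec k)) : ℝ)) (by
        intro s hs
        rw [uIoc_of_le zero_le_one] at hs
        refine (norm_inner_le_norm _ _).trans ?_
        rw [norm_rot, norm_sub_rev]
        exact mul_le_mul (happ _ (τ.lineMap_mem k ⟨hs.1.le, hs.2⟩)) (τ.norm_vec_le k)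
          (norm_nonneg _) hε)
    simpa using this
  have hexp := centroid_expansion g (τ.vec 1) (τ.vec 2) (τ.vec 0) g₀ q b
    (by have := τ.vec_add 0; simpa using this)
    (by have := τ.cross_vec 0; simp at this; rw [this]; exact τ.det_pos.ne')
  have hcr : cross (τ.vec 1) (τ.vec 2) = τ.det := by have := τ.cross_vec 0; simpa using this
  have hca : ∀ k, ‖(1 / 3 : ℝ) • (τ.vec (k + 2) - τ.vec (k + 1))‖ ≤ H := by
    intro k
    rw [← centroid_sub, ← dist_eq_norm]
    exact τ.dist_le_diam τ.centroid_mem (τ.vertex_mem k)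
  have hterm : ∀ k, |(inner ℝ (g₀ + (rowApply g ((1 / 6 : ℝ) • (τ.vec (k + 2) - τ.vec (k + 1)))
      - b • (1 / 6 : ℝ) • (τ.vec (k + 2) - τ.vec (k + 1)))) (rot (τ.vec k)) : ℝ) *
      inner ℝ ((1 / 3 : ℝ) • (τ.vec (k + 2) - τ.vec (k + 1))) q| ≤ ε * H * (H * ‖q‖) := by
    intro k
    rw [abs_mul]
    refine mul_le_mul (hη k) ((abs_real_inner_le_norm _ _).trans ?_) (abs_nonneg _) (by positivity)
    exact mul_le_mul_of_nonneg_right (hca k) (norm_nonneg _)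
  have hcarr : IsCompact τ.carrier := τ.isCompact_carrier
  have hi1 : IntegrableOn (fun x => (inner ℝ (p x - lin x) q : ℝ)) τ.carrier :=
    ((hp.sub hlinc.continuousOn).inner continuousOn_const).integrableOn_compact hcarr
  have hi2 : IntegrableOn (fun x => (inner ℝ (lin x - (a + b • x)) q : ℝ)) τ.carrier :=
    ((hlinc.sub (by fun_prop)).inner continuous_const).continuousOn.integrableOn_compact hcarr
  have hsplit : ∫ x in τ.carrier, (inner ℝ (p x - (a + b • x)) q : ℝ) =
      (∫ x in τ.carrier, (inner ℝ (p x - lin x) q : ℝ)) +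
        ∫ x in τ.carrier, (inner ℝ (lin x - (a + b • x)) q : ℝ) := by
    rw [← integral_add hi1 hi2]
    congr 1; ext x
    rw [← inner_add_left]; congr 1; abel
  have haff : ∫ x in τ.carrier, (inner ℝ (lin x - (a + b • x)) q : ℝ) = τ.det / 2 * inner ℝ g₀ q := by
    set G : Plane := q 0 • g 0 + q 1 • g 1 - b • q with hG
    have e : ∀ x, (inner ℝ (lin x - (a + b • x)) q : ℝ) = inner ℝ G x + (inner ℝ g₀ q - inner ℝ G c) := by
      intro x
      rw [hd, hG]
      simp only [inner_plane, rowApply_zero_apply, rowApply_one_apply, PiLp.add_apply,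
        PiLp.sub_apply, PiLp.smul_apply, smul_eq_mul]
      ring
    simp_rw [e]
    rw [τ.integral_affine, ← hc]
    ring
  have hrest : |∫ x in τ.carrier, (inner ℝ (p x - lin x) q : ℝ)| ≤ ε * ‖q‖ * (τ.det / 2) := by
    rw [← volume_real_carrier]
    rw [← Real.norm_eq_abs]
    refine norm_setIntegral_le_of_norm_le_const (hcarr.measure_lt_top (μ := volume)) ?_
    intro x hx
    exact (norm_inner_le_norm _ _).trans (mul_le_mul_of_nonneg_right (happ x hx) (norm_nonneg _))
  rw [hsplit, haff, ← hcr, hexp, Fin.sum_univ_three]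
  have c0 : τ.coef 0 g = edgeCoef g (τ.vec 1) (τ.vec 2) := rfl
  have c1 : τ.coef 1 g = edgeCoef g (τ.vec 2) (τ.vec 0) := rfl
  have c2 : τ.coef 2 g = edgeCoef g (τ.vec 0) (τ.vec 1) := rfl
  rw [c0, c1, c2]
  have t0 := hterm 0
  have t1 := hterm 1
  have t2 := hterm 2
  have i1 : (1 : Fin 3) + 2 = 0 := rfl
  have i2 : (1 : Fin 3) + 1 = 2 := rfl
  have i3 : (2 : Fin 3) + 2 = 1 := rfl
  have i4 : (2 : Fin 3) + 1 = 0 := rfl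
  rw [zero_add, zero_add] at t0
  rw [i1, i2] at t1
  rw [i3, i4] at t2
  have hdet : ε * ‖q‖ * (τ.det / 2) ≤ ε * ‖q‖ * (H ^ 2 / 2) := by
    have := τ.det_le
    gcongr
  rw [abs_le] at t0 t1 t2 hrest ⊢
  constructor <;> linarith

lemma abs_coef_le {g : Fin 2 → Plane} {K lam : ℝ} (hK : 0 ≤ K) (hg : ∀ i, ‖g i‖ ≤ K)
    (h : diam τ.carrier ^ 2 ≤ lam * τ.det) (k : Fin 3) :
    |τ.coef k g| ≤ lam * K * diam τ.carrier ^ 2 := by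
  refine abs_edgeCoef_le hK hg (τ.norm_vec_le _) (τ.norm_vec_le _) ?_ ?_
  · rw [cross_vec]; exact τ.det_pos
  · rwa [cross_vec]

lemma coef_sub (k : Fin 3) (g g' : Fin 2 → Plane) :
    τ.coef k g - τ.coef k g' = τ.coef k (fun i => g i - g' i) := edgeCoef_sub _ _ _ _

lemma EdgesClose.symm {τ τ' : Triangle} {k k' : Fin 3} {δ : ℝ} (h : τ.EdgesClose k τ' k' δ) :
    τ'.EdgesClose k' τ k δ := fun j => by rw [abs_sub_comm]; exact h j

/-- The sign `ς` is `-1` for two triangles on opposite sides of a common edge, whose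
counterclockwise tangents are opposite, and `1` for consecutive boundary edges. The half-turn
invariance of the coefficient lets both cases be treated alike. -/
lemma abs_coef_sub_coef_le {τ τ' : Triangle} {k k' : Fin 3} {g : Fin 2 → Plane}
    {K lam H δ η ς : ℝ} (hK : 0 ≤ K) (hg : ∀ i, ‖g i‖ ≤ K) (hlam : 1 ≤ lam)
    (h : diam τ.carrier ^ 2 ≤ lam * τ.det) (h' : diam τ'.carrier ^ 2 ≤ lam * τ'.det)
    (hH : diam τ.carrier ≤ H) (hH' : diam τ'.carrier ≤ H)
    (hς : ς = 1 ∨ ς = -1) (hcl : τ.EdgesClose k τ' k' δ)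
    (ht : ‖τ.tangent k - ς • τ'.tangent k'‖ ≤ η) :
    |τ.coef k g - τ'.coef k' g| ≤ 16 * lam ^ 3 * K * H * (δ + H * η) := by
  -- `abs_edgeCoef_sub_le` needs `H ^ 2 ≤ lam * cross u v` for its first triangle with an `H`
  -- bounding the sides of both, so the larger triangle comes first.
  wlog hle : diam τ'.carrier ≤ diam τ.carrier generalizing τ τ' k k'
  · rw [abs_sub_comm]
    refine this h' h hH' hH hcl.symm ?_ (le_of_not_ge hle)
    have e : τ'.tangent k' - ς • τ.tangent k = -ς • (τ.tangent k - ς • τ'.tangent k') := by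
      rcases hς with rfl | rfl <;> simp [add_comm]
    rw [e, norm_smul]
    rcases hς with rfl | rfl <;> simpa using ht
  have hH0 : 0 ≤ H := diam_nonneg.trans hH
  have hδ : 0 ≤ δ := (abs_nonneg _).trans (hcl 0)
  have hη : 0 ≤ η := (norm_nonneg _).trans ht
  have hςa : |ς| = 1 := by rcases hς with rfl | rfl <;> simp
  have hcoef : τ'.coef k' g = edgeCoef g (ς • τ'.vec (k' + 1)) (ς • τ'.vec (k' + 2)) := by
    rcases hς with rfl | rfl
    · simp [coef]
    · simp [coef, edgeCoef_neg]
  have hcr : cross (ς • τ'.vec (k' + 1)) (ς • τ'.vec (k' + 2)) = τ'.det := by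
    rw [← τ'.cross_vec k']
    rcases hς with rfl | rfl <;> simp [cross]
  have hin : (inner ℝ (ς • τ'.vec (k' + 1)) (ς • τ'.vec (k' + 2)) : ℝ)
      = inner ℝ (τ'.vec (k' + 1)) (τ'.vec (k' + 2)) := by
    rcases hς with rfl | rfl <;> simp
  have hn : ∀ j, ‖ς • τ'.vec j‖ = τ'.len j := fun j => by
    rw [norm_smul, Real.norm_eq_abs, hςa, one_mul, len_eq]
  have d0 := hcl 0
  have d1 := hcl 1
  have d2 := hcl 2
  rw [add_zero, add_zero] at d0
  have main := abs_edgeCoef_sub_le (g := g) (K := K) (u := τ.vec (k + 1)) (v := τ.vec (k + 2))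
    (u' := ς • τ'.vec (k' + 1)) (v' := ς • τ'.vec (k' + 2)) (t := τ.tangent k)
    (t' := ς • τ'.tangent k') (H := diam τ.carrier) (lam := lam) (l := τ.len k) (l' := τ'.len k')
    (δ := δ) (η := η) hK hg hlam (τ.norm_vec_le _) (τ.norm_vec_le _)
    (by rw [hn]; exact (τ'.len_le_diam _).trans hle) (by rw [hn]; exact (τ'.len_le_diam _).trans hle)
    (τ.len_pos k) (τ'.len_pos k') (τ.len_le_diam k) ((τ'.len_le_diam _).trans hle)
    (τ.norm_tangent k) (by rw [norm_smul, norm_tangent, Real.norm_eq_abs, hςa, one_mul])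
    (by rw [vec_add, ← vec_eq]) (by rw [← smul_add, vec_add, vec_eq, smul_neg, smul_comm])
    (by rw [cross_vec]; exact τ.det_pos) (by rwa [cross_vec]) (by rw [hcr]; exact τ'.det_pos)
    (by
      rw [hcr, hin]
      exact (abs_inner_le_sq (τ'.norm_vec_le _) (τ'.norm_vec_le _)).trans h')
    d0 (by rw [hn, ← len_eq]; exact d1) (by rw [hn, ← len_eq]; exact d2) ht
  rw [hcoef]
  refine main.trans ?_
  have := diam_nonneg (s := τ.carrier)
  gcongr

end Triangle

/-! ### Combinatorics of conforming triangulations -/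

namespace Triangle

variable (τ : Triangle)

lemma bary_of_ne {j k : Fin 3} (h : j ≠ k) : τ.bary k (τ.a j) = 0 := by
  rcases eq_or_eq_add_one_or_eq_add_two j k with rfl | rfl | rfl
  · exact absurd rfl h
  · exact τ.bary_add_one k
  · exact τ.bary_add_two k

lemma injective_a : Function.Injective τ.a := by
  intro i j h
  by_contra hne
  have h1 := τ.bary_self i
  rw [h, τ.bary_of_ne (Ne.symm hne)] at h1
  exact zero_ne_one h1

lemma sum_bary' (k : Fin 3) (x : Plane) : τ.bary k x + τ.bary (k + 1) x + τ.bary (k + 2) x = 1 := by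
  have h := τ.sum_bary x
  fin_cases k
  · exact h
  · change τ.bary 1 x + τ.bary 2 x + τ.bary 0 x = 1; linarith
  · change τ.bary 2 x + τ.bary 0 x + τ.bary 1 x = 1; linarith

lemma sum_bary_smul' (k : Fin 3) (x : Plane) :
    τ.bary k x • τ.a k + τ.bary (k + 1) x • τ.a (k + 1) + τ.bary (k + 2) x • τ.a (k + 2) = x := by
  have h := τ.sum_bary_smul x
  fin_cases k
  · exact h
  · change τ.bary 1 x • τ.a 1 + τ.bary 2 x • τ.a 2 + τ.bary 0 x • τ.a 0 = x
    conv_rhs => rw [← h]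
    abel
  · change τ.bary 2 x • τ.a 2 + τ.bary 0 x • τ.a 0 + τ.bary 1 x • τ.a 1 = x
    conv_rhs => rw [← h]
    abel

lemma mem_edgeSet_of_bary {k : Fin 3} {x : Plane} (hx : x ∈ τ.carrier) (h : τ.bary k x = 0) :
    x ∈ τ.edgeSet k := by
  have h1 := τ.sum_bary_smul' k x
  have h2 := τ.sum_bary' k x
  rw [h, zero_smul, zero_add] at h1
  rw [h, zero_add] at h2
  rw [mem_carrier_iff] at hx
  exact ⟨_, _, hx _, hx _, h2, h1⟩

lemma bary_eq_zero_of_mem_convexHull {k : Fin 3} {R : Set Plane} (hR : R ⊆ range τ.a)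
    (hk : τ.a k ∉ R) {x : Plane} (hx : x ∈ convexHull ℝ R) : τ.bary k x = 0 := by
  have hconv : Convex ℝ {y | τ.bary k y = 0} := by
    intro y hy z hz s t hs ht hst
    simp only [mem_ofPred_eq] at *
    rw [bary_combo _ _ _ _ _ _ hst, hy, hz]; simp
  refine convexHull_min ?_ hconv hx
  intro y hy
  obtain ⟨j, rfl⟩ := hR hy
  refine τ.bary_of_ne ?_
  rintro rfl
  exact hk hy

lemma range_eq_of_subset {τ τ' : Triangle} (h : range τ.a ⊆ range τ'.a) : range τ.a = range τ'.a := by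
  refine eq_of_subset_of_ncard_le h ?_ (finite_range _)
  rw [← image_univ, ← image_univ, ncard_image_of_injective _ τ.injective_a,
    ncard_image_of_injective _ τ'.injective_a]

lemma mem_range_edge {τ τ' : Triangle} {k : Fin 3} (h1 : τ.a (k + 1) ∈ range τ'.a)
    (h2 : τ.a (k + 2) ∈ range τ'.a) : ∃ k', τ'.edge k' = τ.edge k := by
  obtain ⟨i, hi⟩ := h1
  obtain ⟨j, hj⟩ := h2
  have hij : i ≠ j := by
    rintro rfl
    have := τ.injective_a (hi.symm.trans hj)
    exact absurd this ((by decide : ∀ k : Fin 3, k + 1 ≠ k + 2) k)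
  have hd : ∀ i j : Fin 3, i ≠ j → ∃ k, (k + 1 = i ∧ k + 2 = j) ∨ (k + 1 = j ∧ k + 2 = i) := by
    decide
  obtain ⟨k', h | h⟩ := hd i j hij
  · exact ⟨k', by rw [edge, edge, h.1, h.2, hi, hj]⟩
  · exact ⟨k', by rw [edge, edge, h.1, h.2, hi, hj, Sym2.eq_swap]⟩

lemma edge_injective : Function.Injective τ.edge := by
  intro k k' h
  simp only [edge, Sym2.eq_iff] at h
  have hd : ∀ k k' : Fin 3, (k + 1 = k' + 1 ∧ k + 2 = k' + 2) ∨ (k + 1 = k' + 2 ∧ k + 2 = k' + 1) →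
      k = k' := by decide
  refine hd k k' ?_
  rcases h with h | h
  · exact Or.inl ⟨τ.injective_a h.1, τ.injective_a h.2⟩
  · exact Or.inr ⟨τ.injective_a h.1, τ.injective_a h.2⟩

end Triangle

namespace Triangulation

variable {Ω : Set Plane} (T : Triangulation Ω) {τ τ' : Triangle}

lemma carrier_subset (hτ : τ ∈ T.elems) : τ.carrier ⊆ closure Ω := by
  rw [T.cover]; exact subset_biUnion_of_mem (u := fun τ : Triangle => τ.carrier) hτ

lemma interior_subset (hΩ : IsLipschitzPolygon Ω) (hτ : τ ∈ T.elems) : interior τ.carrier ⊆ Ω := by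
  rw [← hΩ.interior_closure]; exact interior_mono (T.carrier_subset hτ)

/-- Two triangles sharing a relatively interior point of an edge share that edge. -/
lemma exists_edge_eq (hτ : τ ∈ T.elems) (hτ' : τ' ∈ T.elems) (hne : τ ≠ τ') {k : Fin 3} {m : Plane}
    (hm : m ∈ τ.edgeSet k) (h1 : 0 < τ.bary (k + 1) m) (h2 : 0 < τ.bary (k + 2) m)
    (hm' : m ∈ τ'.carrier) : ∃ k', τ'.edge k' = τ.edge k := by
  have hc := (T.conforming τ hτ τ' hτ' hne).2
  have hmc : m ∈ convexHull ℝ (range τ.a ∩ range τ'.a) := by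
    rw [← hc]; exact ⟨τ.edgeSet_subset k hm, hm'⟩
  refine Triangle.mem_range_edge ?_ ?_
  · by_contra hn
    exact h1.ne' (τ.bary_eq_zero_of_mem_convexHull inter_subset_left (fun h => hn h.2) hmc)
  · by_contra hn
    exact h2.ne' (τ.bary_eq_zero_of_mem_convexHull inter_subset_left (fun h => hn h.2) hmc)

/-- Two triangles sharing an edge lie on different sides of it. -/
lemma edge_orientation (hτ : τ ∈ T.elems) (hτ' : τ' ∈ T.elems) (hne : τ ≠ τ') {k k' : Fin 3}
    (h : τ.edge k = τ'.edge k') : τ'.a (k' + 1) = τ.a (k + 2) ∧ τ'.a (k' + 2) = τ.a (k + 1) := by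
  rw [Triangle.edge, Triangle.edge, Sym2.eq_iff] at h
  rcases h with ⟨h1, h2⟩ | ⟨h1, h2⟩
  · exfalso
    obtain ⟨hr, hc⟩ := T.conforming τ hτ τ' hτ' hne
    have hk : τ.a k ∉ range τ'.a := by
      intro hk
      refine hr (Triangle.range_eq_of_subset ?_)
      rintro _ ⟨j, rfl⟩
      rcases eq_or_eq_add_one_or_eq_add_two j k with rfl | rfl | rfl
      · exact hk
      · exact ⟨_, h1.symm⟩
      · exact ⟨_, h2.symm⟩
    -- With equal orientations both triangles lie on the same side of the edge. Points slightly off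
    -- the midpoint towards the centroid of `τ` then belong to both, hence to the hull of the common
    -- vertices. As `τ.a k` is not common, such points would have vanishing coordinate `bary k`.
    set M : Plane := (1 / 2 : ℝ) • τ.a (k + 1) + (1 / 2 : ℝ) • τ.a (k + 2) with hM
    have hv : τ'.vec k' = τ.vec k := by rw [Triangle.vec, Triangle.vec, h1, h2]
    have hcpos : 0 < τ'.bary k' τ.centroid := by
      have := τ.bary_centroid k
      rw [Triangle.bary, div_eq_iff τ.det_pos.ne'] at this
      rw [Triangle.bary, hv, ← h1, this]
      have := τ.det_pos
      have := τ'.det_pos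
      positivity
    have hMk : ∀ j, τ'.bary j M = 1 / 2 * τ'.bary j (τ'.a (k' + 1)) + 1 / 2 * τ'.bary j (τ'.a (k' + 2)) := by
      intro j
      rw [hM, Triangle.bary_combo _ _ _ _ _ _ (by norm_num), h1, h2]
    have hM0 : τ'.bary k' M = 0 := by
      rw [hMk, Triangle.bary_add_one, Triangle.bary_add_two]; simp
    have hne1 : k' + 2 ≠ k' + 1 := (by decide : ∀ k : Fin 3, k + 2 ≠ k + 1) k'
    have hM1 : τ'.bary (k' + 1) M = 1 / 2 := by
      rw [hMk, Triangle.bary_self, Triangle.bary_of_ne _ hne1]; simp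
    have hM2 : τ'.bary (k' + 2) M = 1 / 2 := by
      rw [hMk, Triangle.bary_self, Triangle.bary_of_ne _ hne1.symm]; simp
    have hcont : ∀ j, Tendsto (fun s : ℝ => τ'.bary j ((1 - s) • M + s • τ.centroid)) (𝓝[>] 0)
        (𝓝 (τ'.bary j M)) := by
      intro j
      have : Continuous (fun s : ℝ => τ'.bary j ((1 - s) • M + s • τ.centroid)) :=
        (τ'.continuous_bary j).comp (by fun_prop)
      have := this.tendsto 0
      simp only [sub_zero, one_smul, zero_smul, add_zero] at this
      exact this.mono_left nhdsWithin_le_nhds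
    have ev1 := (hcont (k' + 1)).eventually (lt_mem_nhds (by rw [hM1]; norm_num : 0 < τ'.bary (k' + 1) M))
    have ev2 := (hcont (k' + 2)).eventually (lt_mem_nhds (by rw [hM2]; norm_num : 0 < τ'.bary (k' + 2) M))
    have ev3 : ∀ᶠ s : ℝ in 𝓝[>] 0, s < 1 := nhdsWithin_le_nhds (gt_mem_nhds zero_lt_one)
    obtain ⟨s, ⟨⟨e1, e2⟩, e3⟩, hs : 0 < s⟩ := (((ev1.and ev2).and ev3).and self_mem_nhdsWithin).exists
    set x : Plane := (1 - s) • M + s • τ.centroid with hx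
    have hxτ' : x ∈ τ'.carrier := by
      rw [Triangle.mem_carrier_iff]
      intro j
      rcases eq_or_eq_add_one_or_eq_add_two j k' with rfl | rfl | rfl
      · rw [hx, Triangle.bary_combo _ _ _ _ _ _ (by ring), hM0]
        have := mul_pos hs hcpos
        linarith
      · exact e1.le
      · exact e2.le
    have hMτ : M ∈ τ.edgeSet k := ⟨1 / 2, 1 / 2, by norm_num, by norm_num, by norm_num, rfl⟩
    have hxτ : x ∈ τ.carrier := τ.convex_carrier (τ.edgeSet_subset k hMτ) τ.centroid_mem
      (by linarith) hs.le (by ring)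
    have hxR : x ∈ convexHull ℝ (range τ.a ∩ range τ'.a) := by rw [← hc]; exact ⟨hxτ, hxτ'⟩
    have h0 := τ.bary_eq_zero_of_mem_convexHull inter_subset_left (fun h => hk h.2) hxR
    rw [hx, Triangle.bary_combo _ _ _ _ _ _ (by ring), τ.bary_eq_zero_of_mem_edgeSet hMτ,
      Triangle.bary_centroid] at h0
    linarith
  · exact ⟨h2.symm, h1.symm⟩

/-- Some vertex of `τ` is not a vertex of `τ'`; the intersection, spanned by the common vertices,
then lies in the opposite edge of `τ`. -/
lemma aedisjoint (hτ : τ ∈ T.elems) (hτ' : τ' ∈ T.elems) (hne : τ ≠ τ') :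
    AEDisjoint volume τ.carrier τ'.carrier := by
  obtain ⟨hr, hc⟩ := T.conforming τ hτ τ' hτ' hne
  have : ∃ j, τ.a j ∉ range τ'.a := by
    by_contra! h
    exact hr (Triangle.range_eq_of_subset (by rintro _ ⟨j, rfl⟩; exact h j))
  obtain ⟨j, hj⟩ := this
  refine measure_mono_null (fun x hx => ?_) (IsLipschitzPolygon.segment_null (τ.a (j + 1)) (τ.a (j + 2)))
  refine τ.mem_edgeSet_of_bary hx.1 ?_
  rw [hc] at hx
  exact τ.bary_eq_zero_of_mem_convexHull inter_subset_left (fun h => hj h.2) hx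

lemma restrict_eq_sum (hΩ : IsLipschitzPolygon Ω) :
    (volume : Measure Plane).restrict Ω = ∑ τ ∈ T.elems, volume.restrict τ.carrier := by
  have h1 : (volume : Measure Plane).restrict Ω = volume.restrict (closure Ω) :=
    Measure.restrict_congr_set (closure_ae_eq_of_null_frontier hΩ.volume_frontier).symm
  have h2 : closure Ω = ⋃ τ : T.elems, τ.1.carrier := by
    rw [T.cover, iUnion_subtype]
  rw [h1, h2, Measure.restrict_iUnion_ae]
  · rw [Measure.sum_fintype, Finset.sum_coe_sort T.elems (fun τ => volume.restrict τ.carrier)]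
  · intro i j hij
    exact T.aedisjoint i.2 j.2 (fun h => hij (Subtype.ext h))
  · exact fun i => i.1.isCompact_carrier.measurableSet.nullMeasurableSet

open Classical in
/-- The number of triangles containing a given point is bounded in terms of shape regularity. -/
lemma card_filter_mem_le {lam : ℝ} (hlam : 0 ≤ lam)
    (hreg : ∀ τ ∈ T.elems, diam τ.carrier ^ 2 ≤ lam * τ.det)
    (x : Plane) : ((T.elems.filter fun τ => x ∈ τ.carrier).card : ℝ) ≤ 8 * lam := by
  set S := T.elems.filter fun τ => x ∈ τ.carrier with hS
  rcases S.eq_empty_or_nonempty with h0 | hne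
  · rw [h0]; simpa using hlam
  obtain ⟨τ₀, _, hmin⟩ := S.exists_min_image (fun τ => diam τ.carrier) hne
  set ε := diam τ₀.carrier with hε
  have hε0 : 0 < ε := τ₀.diam_pos
  -- Each triangle at `x` is contracted towards `x` until the scaled diameter is the smallest one,
  -- `ε`. The copies remain in their triangles, so they are essentially disjoint; they lie in a disk
  -- of radius `ε` and have area at least `ε ^ 2 / (2 * lam)`. The count is at most `2 * π * lam ≤ 8
  -- * lam`.
  set I : Triangle → Set Plane := fun τ => AffineMap.homothety x (ε / diam τ.carrier) '' τ.carrier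
    with hI
  have hIm : ∀ τ, MeasurableSet (I τ) := fun τ =>
    (τ.isCompact_carrier.image (AffineMap.continuous_of_finiteDimensional _)).measurableSet
  have hsub : ∀ τ ∈ S, I τ ⊆ τ.carrier := by
    rintro τ hτ _ ⟨y, hy, rfl⟩
    have hd := τ.diam_pos
    rw [AffineMap.homothety_eq_lineMap]
    exact τ.convex_carrier.lineMap_mem (Finset.mem_filter.1 hτ).2 hy
      ⟨by positivity, (div_le_one hd).2 (hmin τ hτ)⟩
  have hball : ∀ τ ∈ S, I τ ⊆ closedBall x ε := by
    rintro τ hτ _ ⟨y, hy, rfl⟩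
    have hd := τ.diam_pos
    rw [mem_closedBall, AffineMap.homothety_eq_lineMap, dist_lineMap_left,
      Real.norm_of_nonneg (by positivity), div_mul_eq_mul_div, div_le_iff₀ hd]
    exact mul_le_mul_of_nonneg_left (τ.dist_le_diam (Finset.mem_filter.1 hτ).2 hy) hε0.le
  have hvol : ∀ τ ∈ S, ε ^ 2 ≤ 2 * lam * volume.real (I τ) := by
    intro τ hτ
    have hd := τ.diam_pos
    have h1 := hreg τ (Finset.mem_filter.1 hτ).1
    have : volume.real (I τ) = (ε / diam τ.carrier) ^ 2 * (τ.det / 2) := by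
      rw [← τ.volume_real_carrier, measureReal_def, hI, Measure.addHaar_image_homothety,
        finrank_euclideanSpace_fin, ENNReal.toReal_mul, ENNReal.toReal_ofReal (abs_nonneg _),
        abs_of_nonneg (by positivity)]
      rfl
    rw [this, div_pow]
    calc ε ^ 2 = ε ^ 2 / diam τ.carrier ^ 2 * diam τ.carrier ^ 2 := by field_simp
      _ ≤ ε ^ 2 / diam τ.carrier ^ 2 * (lam * τ.det) := by gcongr
      _ = _ := by ring
  have hdis : (S : Set Triangle).Pairwise (Function.onFun (AEDisjoint volume) I) := by
    intro τ hτ τ' hτ' hne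
    exact (T.aedisjoint (Finset.mem_filter.1 hτ).1 (Finset.mem_filter.1 hτ').1 hne).mono
      (hsub τ hτ) (hsub τ' hτ')
  have hsum : ∑ τ ∈ S, volume.real (I τ) ≤ Real.pi * ε ^ 2 := by
    have h2 : volume.real (closedBall x ε) = Real.pi * ε ^ 2 := by
      rw [measureReal_def, Measure.addHaar_closedBall_eq_addHaar_ball,
        EuclideanSpace.volume_ball_fin_two, ENNReal.toReal_mul, ENNReal.toReal_pow,
        ENNReal.toReal_ofReal hε0.le, mul_comm]
      simp [Real.pi_pos.le]
    rw [← h2, ← measureReal_biUnion_finset₀ hdis (fun τ _ => (hIm τ).nullMeasurableSet)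
      (fun τ hτ => ne_top_of_le_ne_top measure_closedBall_lt_top.ne (measure_mono (hball τ hτ)))]
    exact measureReal_mono (iUnion₂_subset hball) measure_closedBall_lt_top.ne
  have h4 : (S.card : ℝ) * ε ^ 2 ≤ 2 * lam * (Real.pi * ε ^ 2) := by
    calc (S.card : ℝ) * ε ^ 2 = ∑ τ ∈ S, ε ^ 2 := by simp
      _ ≤ ∑ τ ∈ S, 2 * lam * volume.real (I τ) := Finset.sum_le_sum hvol
      _ ≤ _ := by rw [← Finset.mul_sum]; gcongr
  have h5 : (S.card : ℝ) * ε ^ 2 ≤ 8 * lam * ε ^ 2 := by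
    have : lam * Real.pi * ε ^ 2 ≤ lam * 4 * ε ^ 2 := by
      have := Real.pi_le_four
      gcongr
    linarith
  exact le_of_mul_le_mul_right h5 (by positivity)

/-! ### Half-edges -/

/-- The half-edges of a triangulation: pairs of a triangle and one of its edges. -/
def halfEdges : Finset (Triangle × Fin 3) := T.elems ×ˢ Finset.univ

open Classical in
/-- The half-edges whose edge belongs to one triangle only. -/
def boundaryHalfEdges : Finset (Triangle × Fin 3) :=
  T.halfEdges.filter fun b => b.1.edge b.2 ∉ T.interiorEdges

lemma mem_halfEdges {b : Triangle × Fin 3} : b ∈ T.halfEdges ↔ b.1 ∈ T.elems := by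
  simp [halfEdges]

lemma mem_boundaryHalfEdges {b : Triangle × Fin 3} :
    b ∈ T.boundaryHalfEdges ↔ b.1 ∈ T.elems ∧ b.1.edge b.2 ∉ T.interiorEdges := by
  simp [boundaryHalfEdges, mem_halfEdges]

lemma eq_of_edge_eq {b b' : Triangle × Fin 3} (hb : b ∈ T.boundaryHalfEdges) (hb' : b' ∈ T.halfEdges)
    (h : b'.1.edge b'.2 = b.1.edge b.2) : b' = b := by
  rw [mem_boundaryHalfEdges] at hb
  rw [mem_halfEdges] at hb'
  obtain ⟨τ, k⟩ := b
  obtain ⟨τ', k'⟩ := b'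
  by_cases hτ : τ' = τ
  · subst hτ
    exact Prod.ext rfl (τ'.edge_injective h)
  · exact absurd ⟨τ', hb', τ, hb.1, hτ, ⟨k', h⟩, ⟨k, rfl⟩⟩ hb.2

/-- An interior edge carries exactly two half-edges, with opposite orientations. -/
lemma exists_pair {e : Sym2 Plane} (he : e ∈ T.interiorEdges) :
    ∃ b ∈ T.halfEdges, ∃ b' ∈ T.halfEdges, b.1 ≠ b'.1 ∧ b.1.edge b.2 = e ∧ b'.1.edge b'.2 = e ∧
      b'.1.a (b'.2 + 1) = b.1.a (b.2 + 2) ∧ b'.1.a (b'.2 + 2) = b.1.a (b.2 + 1) ∧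
      ∀ x ∈ T.halfEdges, x.1.edge x.2 = e → x = b ∨ x = b' := by
  obtain ⟨τ, hτ, τ', hτ', hne, ⟨k, hk⟩, ⟨k', hk'⟩⟩ := he
  obtain ⟨o1, o2⟩ := T.edge_orientation hτ hτ' hne (hk.trans hk'.symm)
  refine ⟨(τ, k), T.mem_halfEdges.2 hτ, (τ', k'), T.mem_halfEdges.2 hτ', hne, hk, hk', o1, o2, ?_⟩
  rintro ⟨σ, j⟩ hσ hj
  rw [mem_halfEdges] at hσ
  simp only at hσ hj
  by_cases h1 : σ = τ
  · subst h1
    exact Or.inl (by rw [σ.edge_injective (hj.trans hk.symm)])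
  by_cases h2 : σ = τ'
  · subst h2
    exact Or.inr (by rw [σ.edge_injective (hj.trans hk'.symm)])
  exfalso
  obtain ⟨p1, p2⟩ := T.edge_orientation hτ hσ (Ne.symm h1) (hk.trans hj.symm)
  obtain ⟨q1, q2⟩ := T.edge_orientation hτ' hσ (Ne.symm h2) (hk'.trans hj.symm)
  -- A third triangle would traverse the edge opposite to both `τ` and `τ'`, which are already
  -- opposite to each other.
  have : τ'.a (k' + 1) = τ'.a (k' + 2) := by rw [o1, ← p1, q1]
  exact (by decide : ∀ k : Fin 3, k + 1 ≠ k + 2) k' (τ'.injective_a this)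

open Classical in
lemma sum_filter_edge_eq {e : Sym2 Plane} (F : Triangle × Fin 3 → ℝ) {b b' : Triangle × Fin 3}
    (hb : b ∈ T.halfEdges) (hb' : b' ∈ T.halfEdges) (hne : b.1 ≠ b'.1) (h : b.1.edge b.2 = e)
    (h' : b'.1.edge b'.2 = e) (hall : ∀ x ∈ T.halfEdges, x.1.edge x.2 = e → x = b ∨ x = b') :
    ∑ x ∈ T.halfEdges with x.1.edge x.2 = e, F x = F b + F b' := by
  have : T.halfEdges.filter (fun x => x.1.edge x.2 = e) = {b, b'} := by
    ext x
    simp only [Finset.mem_filter, Finset.mem_insert, Finset.mem_singleton]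
    constructor
    · exact fun hx => hall x hx.1 hx.2
    · rintro (rfl | rfl)
      · exact ⟨hb, h⟩
      · exact ⟨hb', h'⟩
  rw [this, Finset.sum_pair]
  rintro rfl
  exact hne rfl

open Classical in
lemma sum_halfEdges_eq {E : Finset (Sym2 Plane)} (hE : (E : Set (Sym2 Plane)) = T.interiorEdges)
    (F : Triangle × Fin 3 → ℝ) :
    ∑ b ∈ T.halfEdges, F b = ∑ e ∈ E, ∑ b ∈ T.halfEdges with b.1.edge b.2 = e, F b
      + ∑ b ∈ T.boundaryHalfEdges, F b := by
  have hE' : ∀ e, e ∈ E ↔ e ∈ T.interiorEdges := fun e => by rw [← hE]; simp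
  rw [← Finset.sum_filter_add_sum_filter_not T.halfEdges (fun b => b.1.edge b.2 ∈ T.interiorEdges) F]
  congr 1
  rw [← Finset.sum_fiberwise_of_maps_to (s := T.halfEdges.filter fun b => b.1.edge b.2 ∈ T.interiorEdges)
    (t := E) (g := fun b => b.1.edge b.2) (fun b hb => (hE' _).2 (Finset.mem_filter.1 hb).2) F]
  refine Finset.sum_congr rfl fun e he => Finset.sum_congr ?_ fun _ _ => rfl
  ext b
  simp only [Finset.mem_filter]
  constructor
  · exact fun h => ⟨h.1.1, h.2⟩
  · exact fun h => ⟨⟨h.1, by rw [h.2]; exact (hE' _).1 he⟩, h.2⟩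

lemma finite_interiorEdges : T.interiorEdges.Finite := by
  classical
  refine (T.halfEdges.image fun b => b.1.edge b.2).finite_toSet.subset ?_
  rintro e ⟨τ, hτ, _, _, _, ⟨k, hk⟩, _⟩
  exact Finset.mem_coe.2 (Finset.mem_image.2 ⟨(τ, k), T.mem_halfEdges.2 hτ, hk⟩)

/-- The boundary chain of a triangulation is a cycle. -/
lemma sum_boundary_sub_eq_zero (χ : Plane → ℝ) :
    ∑ b ∈ T.boundaryHalfEdges, (χ (b.1.a (b.2 + 2)) - χ (b.1.a (b.2 + 1))) = 0 := by
  classical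
  -- Summed over all half-edges the increments telescope around each triangle; summed over interior
  -- edges they cancel in pairs. The boundary part is the difference.
  have h := T.sum_halfEdges_eq (E := T.finite_interiorEdges.toFinset) (by simp)
    (fun b => χ (b.1.a (b.2 + 2)) - χ (b.1.a (b.2 + 1)))
  have h0 : ∑ b ∈ T.halfEdges, (χ (b.1.a (b.2 + 2)) - χ (b.1.a (b.2 + 1))) = 0 := by
    rw [halfEdges, Finset.sum_product]
    refine Finset.sum_eq_zero fun τ _ => ?_
    rw [Fin.sum_univ_three]
    change (χ (τ.a 2) - χ (τ.a 1)) + (χ (τ.a 0) - χ (τ.a 2)) + (χ (τ.a 1) - χ (τ.a 0)) = 0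
    ring
  have h1 : ∑ e ∈ T.finite_interiorEdges.toFinset, ∑ b ∈ T.halfEdges with b.1.edge b.2 = e,
      (χ (b.1.a (b.2 + 2)) - χ (b.1.a (b.2 + 1))) = 0 := by
    refine Finset.sum_eq_zero fun e he => ?_
    obtain ⟨b, hb, b', hb', hne, h1, h2, o1, o2, hall⟩ := T.exists_pair (by simpa using he)
    rw [T.sum_filter_edge_eq _ hb hb' hne h1 h2 hall, o1, o2]
    ring
  linarith

/-- An edge belonging to one triangle only lies on the boundary of the domain. -/
lemma edgeSet_subset_frontier {b : Triangle × Fin 3} (hb : b ∈ T.boundaryHalfEdges) (hΩ : IsOpen Ω) :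
    b.1.edgeSet b.2 ⊆ frontier Ω := by
  obtain ⟨τ, k⟩ := b
  obtain ⟨hτ, hint⟩ := T.mem_boundaryHalfEdges.1 hb
  simp only at hτ hint ⊢
  intro m hm
  have hmc := T.carrier_subset hτ (τ.edgeSet_subset k hm)
  rw [hΩ.frontier_eq]
  refine ⟨hmc, fun hmΩ => hint ?_⟩
  -- Since `Ω` is open, `m` can be moved slightly towards the midpoint within the edge and within
  -- `Ω`; the new point `x` is not an endpoint of the edge.
  set M : Plane := (1 / 2 : ℝ) • τ.a (k + 1) + (1 / 2 : ℝ) • τ.a (k + 2) with hM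
  have hMe : M ∈ τ.edgeSet k := ⟨1 / 2, 1 / 2, by norm_num, by norm_num, by norm_num, rfl⟩
  have hne1 : k + 2 ≠ k + 1 := (by decide : ∀ k : Fin 3, k + 2 ≠ k + 1) k
  have hM1 : τ.bary (k + 1) M = 1 / 2 := by
    rw [hM, Triangle.bary_combo _ _ _ _ _ _ (by norm_num), Triangle.bary_self,
      Triangle.bary_of_ne _ hne1]; simp
  have hM2 : τ.bary (k + 2) M = 1 / 2 := by
    rw [hM, Triangle.bary_combo _ _ _ _ _ _ (by norm_num), Triangle.bary_self,
      Triangle.bary_of_ne _ hne1.symm]; simp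
  have hcont : Tendsto (fun s : ℝ => (1 - s) • m + s • M) (𝓝[>] 0) (𝓝 m) := by
    have : Continuous (fun s : ℝ => (1 - s) • m + s • M) := by fun_prop
    have := this.tendsto 0
    simp only [sub_zero, one_smul, zero_smul, add_zero] at this
    exact this.mono_left nhdsWithin_le_nhds
  have ev1 := hcont.eventually (hΩ.mem_nhds hmΩ)
  have ev3 : ∀ᶠ s : ℝ in 𝓝[>] 0, s < 1 := nhdsWithin_le_nhds (gt_mem_nhds zero_lt_one)
  obtain ⟨s, ⟨e1, e3⟩, hs : 0 < s⟩ := ((ev1.and ev3).and self_mem_nhdsWithin).exists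
  set x : Plane := (1 - s) • m + s • M with hx
  have hxe : x ∈ τ.edgeSet k := convex_segment _ _ hm hMe (by linarith) hs.le (by ring)
  have hmb := (τ.mem_carrier_iff m).1 (τ.edgeSet_subset k hm)
  have hx1 : 0 < τ.bary (k + 1) x := by
    rw [hx, Triangle.bary_combo _ _ _ _ _ _ (by ring), hM1]
    have := mul_nonneg (by linarith : 0 ≤ 1 - s) (hmb (k + 1))
    linarith
  have hx2 : 0 < τ.bary (k + 2) x := by
    rw [hx, Triangle.bary_combo _ _ _ _ _ _ (by ring), hM2]
    have := mul_nonneg (by linarith : 0 ≤ 1 - s) (hmb (k + 2))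
    linarith
  by_cases hex : ∃ τ' ∈ T.elems, τ ≠ τ' ∧ x ∈ τ'.carrier
  · obtain ⟨τ', hτ', hne, hxτ'⟩ := hex
    obtain ⟨k', hk'⟩ := T.exists_edge_eq hτ hτ' hne hxe hx1 hx2 hxτ'
    exact ⟨τ, hτ, τ', hτ', hne, ⟨k, rfl⟩, ⟨k', hk'⟩⟩
  · exfalso
    classical
    push Not at hex
    have hcl : IsClosed (⋃ τ' ∈ T.elems.erase τ, τ'.carrier) :=
      (T.elems.erase τ).finite_toSet.isClosed_biUnion fun τ' _ => τ'.isCompact_carrier.isClosed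
    have hxn : x ∉ ⋃ τ' ∈ T.elems.erase τ, τ'.carrier := by
      simp only [mem_iUnion, not_exists]
      intro τ' hτ'
      rw [Finset.mem_erase] at hτ'
      exact hex τ' hτ'.2 hτ'.1.symm
    -- If no other triangle contains `x`, a small step away from the centroid of `τ` stays in `Ω`
    -- and avoids the other triangles. It would have to stay in `τ`, but `bary k` becomes negative.
    have hout : Tendsto (fun t : ℝ => (1 + t) • x + (-t) • τ.centroid) (𝓝[>] 0) (𝓝 x) := by
      have : Continuous (fun t : ℝ => (1 + t) • x + (-t) • τ.centroid) := by fun_prop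
      have := this.tendsto 0
      simp only [add_zero, one_smul, neg_zero, zero_smul] at this
      exact this.mono_left nhdsWithin_le_nhds
    obtain ⟨t, ⟨t1, t2⟩, ht : 0 < t⟩ := (((hout.eventually (hΩ.mem_nhds e1)).and
      (hout.eventually (hcl.isOpen_compl.mem_nhds hxn))).and self_mem_nhdsWithin).exists
    have h3 := subset_closure t1
    rw [T.cover] at h3
    simp only [mem_iUnion] at h3
    obtain ⟨τ', hτ', hy⟩ := h3
    have hττ' : τ' = τ := by
      by_contra hne
      exact t2 (mem_biUnion (Finset.mem_coe.2 (Finset.mem_erase.2 ⟨hne, hτ'⟩)) hy)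
    rw [hττ', Triangle.mem_carrier_iff] at hy
    have := hy k
    rw [Triangle.bary_combo _ _ _ _ _ _ (by ring), τ.bary_eq_zero_of_mem_edgeSet hxe,
      Triangle.bary_centroid] at this
    linarith

/-- The total length of the boundary edges is at most the length of the boundary. -/
lemma sum_len_boundary_le (hΩ : IsLipschitzPolygon Ω) :
    ∑ b ∈ T.boundaryHalfEdges, b.1.len b.2 ≤ (Measure.hausdorffMeasure 1 (frontier Ω)).toReal := by
  have hlen : ∀ b : Triangle × Fin 3, b.1.len b.2 =
      (Measure.hausdorffMeasure 1 (b.1.edgeSet b.2)).toReal := by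
    intro b
    rw [Triangle.edgeSet, hausdorffMeasure_segment, Triangle.len, edist_dist,
      ENNReal.toReal_ofReal dist_nonneg]
  -- Distinct boundary edges meet at most in endpoints, a null set for length: a common point inside
  -- an edge would make two triangles share it, contrary to its being a boundary edge.
  have hdis : (T.boundaryHalfEdges : Set (Triangle × Fin 3)).Pairwise
      (Function.onFun (AEDisjoint (Measure.hausdorffMeasure 1)) fun b => b.1.edgeSet b.2) := by
    rintro ⟨τ, k⟩ hb ⟨τ', k'⟩ hb' hne
    have hfin : ({τ.a (k + 1), τ.a (k + 2)} : Set Plane).Finite := by simp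
    have := Measure.nullSingletonClass_hausdorff Plane (zero_lt_one' ℝ)
    refine measure_mono_null ?_ (hfin.measure_zero (Measure.hausdorffMeasure 1))
    rintro x ⟨hx, hx'⟩
    simp only at hx hx'
    by_contra hxv
    simp only [mem_insert_iff, mem_singleton_iff, not_or] at hxv
    have hb1 := (τ.mem_carrier_iff x).1 (τ.edgeSet_subset k hx)
    have h0 := τ.bary_eq_zero_of_mem_edgeSet hx
    have hsum := τ.sum_bary' k x
    have hsm := τ.sum_bary_smul' k x
    have hx1 : 0 < τ.bary (k + 1) x := by
      refine lt_of_le_of_ne (hb1 _) fun h => hxv.2 ?_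
      have : τ.bary (k + 2) x = 1 := by linarith
      rw [h0, ← h, this] at hsm
      simpa using hsm.symm
    have hx2 : 0 < τ.bary (k + 2) x := by
      refine lt_of_le_of_ne (hb1 _) fun h => hxv.1 ?_
      have : τ.bary (k + 1) x = 1 := by linarith
      rw [h0, ← h, this] at hsm
      simpa using hsm.symm
    have hτ := (T.mem_boundaryHalfEdges.1 hb).1
    have hτ' := (T.mem_boundaryHalfEdges.1 hb').1
    by_cases hττ' : τ = τ'
    · subst hττ'
      have h0' := τ.bary_eq_zero_of_mem_edgeSet hx'
      rcases eq_or_eq_add_one_or_eq_add_two k' k with rfl | rfl | rfl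
      · exact hne rfl
      · exact hx1.ne' h0'
      · exact hx2.ne' h0'
    · obtain ⟨j, hj⟩ := T.exists_edge_eq hτ hτ' hττ' hx hx1 hx2 (τ'.edgeSet_subset k' hx')
      exact (T.mem_boundaryHalfEdges.1 hb).2 ⟨τ, hτ, τ', hτ', hττ', ⟨k, rfl⟩, ⟨j, hj⟩⟩
  have hfr := hΩ.hausdorffMeasure_frontier_lt_top
  have hfinite : ∀ b ∈ T.boundaryHalfEdges, Measure.hausdorffMeasure 1 (b.1.edgeSet b.2) ≠ ⊤ :=
    fun b hb => ne_top_of_le_ne_top hfr.ne (measure_mono (T.edgeSet_subset_frontier hb hΩ.isOpen))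
  simp_rw [hlen]
  have hmeas : ∀ b ∈ T.boundaryHalfEdges, NullMeasurableSet (b.1.edgeSet b.2)
      (Measure.hausdorffMeasure 1) := fun b _ =>
    (isCompact_segment _ _).measurableSet.nullMeasurableSet
  rw [← ENNReal.toReal_sum hfinite, ← measure_biUnion_finset₀ hdis hmeas]
  exact ENNReal.toReal_mono hfr.ne (measure_mono (iUnion₂_subset fun b hb =>
    T.edgeSet_subset_frontier hb hΩ.isOpen))

end Triangulation

/-! ### The discrete Sobolev inequality -/

/-- Uniform bounds for local oscillations of a family of functions on a connected compact set give a
uniform bound for global oscillations. -/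
lemma exists_oscillation_bound {X ι : Type*} [TopologicalSpace X] {K : Set X} (hK : IsCompact K)
    (hpre : IsPreconnected K) (f : ι → X → ℝ) (Q : ι → ℝ) (hQ : ∀ i, 0 ≤ Q i)
    (hloc : ∀ x ∈ K, ∃ U ∈ 𝓝[K] x, ∃ C : ℝ, ∀ i, ∀ y ∈ U, ∀ z ∈ U, |f i y - f i z| ≤ C * Q i) :
    ∃ C : ℝ, 0 ≤ C ∧ ∀ i, ∀ y ∈ K, ∀ z ∈ K, |f i y - f i z| ≤ C * Q i := by
  -- Connectedness chains the local bounds into a constant for each pair of points; compactness then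
  -- makes it uniform over `K`. All constants are independent of `i`.
  have hpair : ∀ x ∈ K, ∀ y ∈ K, ∃ C : ℝ, ∀ i, |f i x - f i y| ≤ C * Q i := by
    intro x hx y hy
    refine hpre.induction₂' (fun x y => ∃ C : ℝ, ∀ i, |f i x - f i y| ≤ C * Q i) ?_ ?_ hx hy
    · intro x hx
      obtain ⟨U, hU, C, hC⟩ := hloc x hx
      have hxU := mem_of_mem_nhdsWithin hx hU
      filter_upwards [hU] with y hy
      exact ⟨⟨C, fun i => hC i x hxU y hy⟩, ⟨C, fun i => hC i y hy x hxU⟩⟩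
    · rintro x y z _ _ _ ⟨C, hC⟩ ⟨C', hC'⟩
      refine ⟨C + C', fun i => (abs_sub_le _ (f i y) _).trans ?_⟩
      rw [add_mul]
      exact add_le_add (hC i) (hC' i)
  rcases K.eq_empty_or_nonempty with rfl | ⟨x₀, hx₀⟩
  · exact ⟨0, le_rfl, fun i y hy => absurd hy (notMem_empty y)⟩
  have hunif : ∃ C : ℝ, ∀ i, ∀ y ∈ K, |f i x₀ - f i y| ≤ C * Q i := by
    refine hK.induction_on (p := fun S => ∃ C : ℝ, ∀ i, ∀ y ∈ S, |f i x₀ - f i y| ≤ C * Q i)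
      ⟨0, fun i y hy => absurd hy (notMem_empty y)⟩ ?_ ?_ ?_
    · rintro s t hst ⟨C, hC⟩
      exact ⟨C, fun i y hy => hC i y (hst hy)⟩
    · rintro s t ⟨C, hC⟩ ⟨C', hC'⟩
      refine ⟨max C C', fun i y hy => ?_⟩
      rcases hy with hy | hy
      · exact (hC i y hy).trans (mul_le_mul_of_nonneg_right (le_max_left _ _) (hQ i))
      · exact (hC' i y hy).trans (mul_le_mul_of_nonneg_right (le_max_right _ _) (hQ i))
    · intro x hx
      obtain ⟨U, hU, C, hC⟩ := hloc x hx
      obtain ⟨C', hC'⟩ := hpair x₀ hx₀ x hx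
      refine ⟨U, hU, C' + C, fun i y hy => (abs_sub_le _ (f i x) _).trans ?_⟩
      rw [add_mul]
      exact add_le_add (hC' i) (hC i x (mem_of_mem_nhdsWithin hx hU) y hy)
  obtain ⟨C, hC⟩ := hunif
  refine ⟨2 * max C 0, by positivity, fun i y hy z hz => ?_⟩
  have h1 := hC i y hy
  have h2 := hC i z hz
  have h3 : C * Q i ≤ max C 0 * Q i := mul_le_mul_of_nonneg_right (le_max_left _ _) (hQ i)
  rw [abs_sub_comm] at h1
  have := abs_sub_le (f i y) (f i x₀) (f i z)
  linarith

/-- `F` is an upper gradient of `w` on `S`, bounded by `Q / δ` and with `L²` norm at most `Q`. -/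
structure HasUpperGradient (S : Set Plane) (w : Plane → ℝ) (F : Plane → ℝ≥0∞) (δ Q : ℝ) : Prop where
  measurable : Measurable F
  le : ∀ x, F x ≤ ENNReal.ofReal (Q / δ)
  lintegral_sq_le : ∫⁻ x, F x ^ 2 ≤ ENNReal.ofReal (Q ^ 2)
  upper : ∀ x v : Plane, ∀ a b : ℝ, a ≤ b → (∀ s ∈ Icc a b, x + s • v ∈ S) →
    ENNReal.ofReal |w (x + b • v) - w (x + a • v)| ≤
      ENNReal.ofReal ‖v‖ * ∫⁻ s in Icc a b, F (x + s • v)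

lemma lintegral_comp_dilation (x : Plane) {s : ℝ} (hs : 0 < s) (f : Plane → ℝ≥0∞) (hf : Measurable f) :
    ∫⁻ z, f (x + s • (z - x)) = ENNReal.ofReal (s ^ 2)⁻¹ * ∫⁻ y, f y := by
  have h1 : ∀ z, f (x + s • (z - x)) = (fun y => f (y + (x - s • x))) (s • z) := by
    intro z; simp only; congr 1; rw [smul_sub]; abel
  have hm : Measurable fun y : Plane => f (y + (x - s • x)) := hf.comp (measurable_add_const _)
  simp_rw [h1]
  rw [← lintegral_map hm (measurable_const_smul s), Measure.map_addHaar_smul volume hs.ne',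
    lintegral_smul_measure, lintegral_add_right_eq_self, finrank_euclideanSpace_fin,
    abs_of_pos (by positivity), smul_eq_mul]

/-- For fixed `s` the dilation `y = x + s • (z - x)` has Jacobian `s ^ 2`, turning the weight `s`
into `s⁻¹`. For fixed `y` at distance `r` from `x`, only `s` between `r / D` and `r / ρ` contribute,
where `s⁻¹ ≤ D / r`; the integral over `s` is at most `D / ρ`. -/
lemma lintegral_star_le {x y₀ : Plane} {ρ D δ : ℝ} (hρ : 0 < ρ) (hρD : ρ ≤ D) (hδ : 0 < δ)
    (hB : ∀ z ∈ ball y₀ ρ, ρ ≤ ‖z - x‖ ∧ ‖z - x‖ ≤ D) {F : Plane → ℝ≥0∞} (hF : Measurable F) :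
    ∫⁻ z in ball y₀ ρ, ∫⁻ s in Icc δ 1, ENNReal.ofReal s * F (x + s • (z - x)) ^ 2 ≤
      ENNReal.ofReal (D / ρ) * ∫⁻ y, F y ^ 2 := by
  have hD : 0 < D := hρ.trans_le hρD
  have hBm : MeasurableSet (ball y₀ ρ) := measurableSet_ball
  set χ : Plane → ℝ≥0∞ := (ball y₀ ρ).indicator 1 with hχ
  have hχm : Measurable χ := measurable_one.indicator hBm
  rw [lintegral_lintegral_swap (by
    refine Measurable.aemeasurable ?_
    refine Measurable.mul ?_ ?_
    · exact ENNReal.measurable_ofReal.comp measurable_snd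
    · refine (hF.comp ?_).pow_const 2
      exact (by fun_prop : Continuous fun q : Plane × ℝ => x + q.2 • (q.1 - x)).measurable)]
  have step : ∀ s ∈ Icc δ 1, ∫⁻ z in ball y₀ ρ, ENNReal.ofReal s * F (x + s • (z - x)) ^ 2 =
      ∫⁻ y, ENNReal.ofReal s⁻¹ * χ (x + s⁻¹ • (y - x)) * F y ^ 2 := by
    intro s hs
    have hs0 : 0 < s := hδ.trans_le hs.1
    have hmul : Measurable fun y => χ (x + s⁻¹ • (y - x)) * F y ^ 2 :=
      (hχm.comp (by fun_prop : Continuous fun y : Plane => x + s⁻¹ • (y - x)).measurable).mul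
        (hF.pow_const 2)
    have h1 := lintegral_comp_dilation x hs0 (fun y => χ (x + s⁻¹ • (y - x)) * F y ^ 2) hmul
    have h2 : ∀ z, χ (x + s⁻¹ • (x + s • (z - x) - x)) = χ z := by
      intro z
      rw [add_sub_cancel_left, smul_smul, inv_mul_cancel₀ hs0.ne', one_smul, add_sub_cancel]
    simp_rw [h2] at h1
    rw [← lintegral_indicator hBm]
    have h3 : ∀ z, (ball y₀ ρ).indicator (fun z => ENNReal.ofReal s * F (x + s • (z - x)) ^ 2) z
        = ENNReal.ofReal s * (χ z * F (x + s • (z - x)) ^ 2) := by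
      intro z
      by_cases hz : z ∈ ball y₀ ρ <;> simp [hχ, hz, indicator]
    simp_rw [h3]
    have hmul2 : Measurable fun z => χ z * F (x + s • (z - x)) ^ 2 :=
      hχm.mul ((hF.comp (by fun_prop : Continuous fun z : Plane => x + s • (z - x)).measurable).pow_const 2)
    rw [lintegral_const_mul _ hmul2, h1, ← mul_assoc, ← ENNReal.ofReal_mul hs0.le]
    have h4 : s * (s ^ 2)⁻¹ = s⁻¹ := by field_simp
    rw [h4, ← lintegral_const_mul _ hmul]
    simp_rw [mul_assoc]
  rw [setLIntegral_congr_fun measurableSet_Icc step, lintegral_lintegral_swap (by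
    refine Measurable.aemeasurable ?_
    refine Measurable.mul (Measurable.mul ?_ ?_) ?_
    · exact ENNReal.measurable_ofReal.comp (measurable_inv.comp measurable_fst)
    · refine hχm.comp ?_
      refine measurable_const.add ?_
      exact (measurable_inv.comp measurable_fst).smul (measurable_snd.sub measurable_const)
    · exact (hF.comp measurable_snd).pow_const 2)]
  rw [← lintegral_const_mul _ (hF.pow_const 2)]
  refine lintegral_mono fun y => ?_
  have hm : Measurable fun s : ℝ => ENNReal.ofReal s⁻¹ * χ (x + s⁻¹ • (y - x)) :=
    (ENNReal.measurable_ofReal.comp measurable_inv).mul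
      (hχm.comp (measurable_const.add (measurable_inv.smul measurable_const)))
  rw [lintegral_mul_const _ hm]
  gcongr
  set r := ‖y - x‖ with hr
  have hmem : ∀ s ∈ Icc δ 1, x + s⁻¹ • (y - x) ∈ ball y₀ ρ → 0 < r ∧ s ∈ Icc (r / D) (r / ρ) := by
    intro s hs hz
    have hs0 : 0 < s := hδ.trans_le hs.1
    obtain ⟨h1, h2⟩ := hB _ hz
    rw [add_sub_cancel_left, norm_smul, norm_inv, Real.norm_of_nonneg hs0.le, ← hr,
      inv_mul_eq_div] at h1 h2
    rw [le_div_iff₀ hs0] at h1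
    rw [div_le_iff₀ hs0] at h2
    refine ⟨by nlinarith, ?_, ?_⟩
    · rw [div_le_iff₀ hD]; linarith
    · rw [le_div_iff₀ hρ]; linarith
  rcases (norm_nonneg (y - x)).eq_or_lt with h0 | h0
  · have : ∫⁻ s in Icc δ 1, ENNReal.ofReal s⁻¹ * χ (x + s⁻¹ • (y - x)) = ∫⁻ s in Icc δ 1, 0 := by
      refine setLIntegral_congr_fun measurableSet_Icc fun s hs => ?_
      have : x + s⁻¹ • (y - x) ∉ ball y₀ ρ := fun h => by
        have := (hmem s hs h).1
        rw [hr, ← h0] at this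
        exact lt_irrefl _ this
      simp [hχ, this]
    rw [this]; simp
  · calc ∫⁻ s in Icc δ 1, ENNReal.ofReal s⁻¹ * χ (x + s⁻¹ • (y - x))
        ≤ ∫⁻ s in Icc δ 1, (Icc (r / D) (r / ρ)).indicator (fun _ => ENNReal.ofReal (D / r)) s := by
          refine setLIntegral_mono' measurableSet_Icc fun s hs => ?_
          by_cases hz : x + s⁻¹ • (y - x) ∈ ball y₀ ρ
          · have h1 := (hmem s hs hz).2
            rw [indicator_of_mem h1]
            simp only [hχ, indicator_of_mem hz, Pi.one_apply, mul_one]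
            refine ENNReal.ofReal_le_ofReal ?_
            rw [inv_le_comm₀ (hδ.trans_le hs.1) (by positivity), inv_div]
            exact h1.1
          · simp [hχ, indicator, hz]
      _ ≤ ∫⁻ s, (Icc (r / D) (r / ρ)).indicator (fun _ => ENNReal.ofReal (D / r)) s :=
          setLIntegral_le_lintegral _ _
      _ = ENNReal.ofReal (D / r) * ENNReal.ofReal (r / ρ - r / D) := by
          rw [lintegral_indicator measurableSet_Icc, setLIntegral_const, Real.volume_Icc]
      _ ≤ ENNReal.ofReal (D / ρ) := by
          rw [← ENNReal.ofReal_mul (by positivity)]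
          refine ENNReal.ofReal_le_ofReal ?_
          have h1 : D / r * (r / ρ - r / D) = D / ρ - 1 := by
            have := h0.ne'
            rw [← hr] at this
            field_simp
          linarith

/-- The increment along the ray from `x` to `z` is split at `s = δ`. The near part uses the
pointwise bound `Q / δ` on an interval of length `δ`. The far part uses a weighted
arithmetic-geometric inequality whose first term integrates to a logarithm and whose second is
averaged over the ball by `lintegral_star_le`. -/
lemma lintegral_abs_sub_le {S : Set Plane} {w : Plane → ℝ} {F : Plane → ℝ≥0∞} {δ Q : ℝ}
    (h : HasUpperGradient S w F δ Q) (hδ : 0 < δ) (hδ1 : δ < 1) (hQ : 0 ≤ Q) {x y₀ : Plane} {ρ D : ℝ}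
    (hρ : 0 < ρ) (hρD : ρ ≤ D) (hx : x ∈ S)
    (hB : ∀ z ∈ ball y₀ ρ, ρ ≤ ‖z - x‖ ∧ ‖z - x‖ ≤ D ∧ ∀ s ∈ Ioc (0 : ℝ) 1, x + s • (z - x) ∈ S)
    {t : ℝ} (ht : 0 < t) :
    ∫⁻ z in ball y₀ ρ, ENNReal.ofReal |w z - w x| ≤
      ENNReal.ofReal (volume.real (ball y₀ ρ) * (D * Q + D * (t * Real.log (1 / δ)))
        + D * (1 / t * (D / ρ * Q ^ 2))) := by
  have hD : 0 < D := hρ.trans_le hρD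
  have hBm : MeasurableSet (ball y₀ ρ) := measurableSet_ball
  have hlog : 0 < Real.log (1 / δ) := Real.log_pos (by rw [lt_div_iff₀ hδ]; linarith)
  have hFc : ∀ z, Measurable fun s : ℝ => F (x + s • (z - x)) := fun z =>
    h.measurable.comp (by fun_prop : Continuous fun s : ℝ => x + s • (z - x)).measurable
  have hamgm : ∀ s ∈ Icc δ 1, ∀ A : ℝ≥0∞, A ≤ ENNReal.ofReal (t * s⁻¹) + ENNReal.ofReal (1 / t) *
      (ENNReal.ofReal s * A ^ 2) := by
    intro s hs A
    have hs0 : 0 < s := hδ.trans_le hs.1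
    rcases le_total A (ENNReal.ofReal (t * s⁻¹)) with hA | hA
    · exact hA.trans le_self_add
    · refine le_trans ?_ le_add_self
      have h1 : (1 : ℝ≥0∞) = ENNReal.ofReal (1 / t) * ENNReal.ofReal s * ENNReal.ofReal (t * s⁻¹) := by
        rw [← ENNReal.ofReal_mul (by positivity), ← ENNReal.ofReal_mul (by positivity)]
        have : 1 / t * s * (t * s⁻¹) = 1 := by field_simp
        rw [this, ENNReal.ofReal_one]
      calc A = 1 * A := (one_mul A).symm
        _ = ENNReal.ofReal (1 / t) * ENNReal.ofReal s * ENNReal.ofReal (t * s⁻¹) * A := by rw [← h1]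
        _ ≤ ENNReal.ofReal (1 / t) * ENNReal.ofReal s * A * A := by gcongr
        _ = _ := by rw [pow_two]; ring
  have hpt : ∀ z ∈ ball y₀ ρ, ENNReal.ofReal |w z - w x| ≤
      ENNReal.ofReal (D * Q + D * (t * Real.log (1 / δ))) + ENNReal.ofReal (D * (1 / t)) *
        ∫⁻ s in Icc δ 1, ENNReal.ofReal s * F (x + s • (z - x)) ^ 2 := by
    intro z hz
    obtain ⟨_, hzD, hzS⟩ := hB z hz
    have hin : ∀ s ∈ Icc (0 : ℝ) 1, x + s • (z - x) ∈ S := by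
      intro s hs
      rcases hs.1.eq_or_lt with h0 | h0
      · rw [← h0]; simpa using hx
      · exact hzS s ⟨h0, hs.2⟩
    have u1 := h.upper x (z - x) 0 δ hδ.le fun s hs => hin s ⟨hs.1, hs.2.trans hδ1.le⟩
    have u2 := h.upper x (z - x) δ 1 hδ1.le fun s hs => hin s ⟨hδ.le.trans hs.1, hs.2⟩
    rw [zero_smul, add_zero] at u1
    rw [one_smul, add_sub_cancel] at u2
    have tri : ENNReal.ofReal |w z - w x| ≤ ENNReal.ofReal |w (x + δ • (z - x)) - w x| +
        ENNReal.ofReal |w z - w (x + δ • (z - x))| := by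
      rw [← ENNReal.ofReal_add (abs_nonneg _) (abs_nonneg _)]
      refine ENNReal.ofReal_le_ofReal ?_
      have := abs_sub_le (w z) (w (x + δ • (z - x))) (w x)
      linarith
    have b1 : ENNReal.ofReal |w (x + δ • (z - x)) - w x| ≤ ENNReal.ofReal (D * Q) := by
      refine u1.trans ?_
      calc ENNReal.ofReal ‖z - x‖ * ∫⁻ s in Icc 0 δ, F (x + s • (z - x))
          ≤ ENNReal.ofReal D * ∫⁻ s in Icc 0 δ, ENNReal.ofReal (Q / δ) := by
            gcongr with s
            exact h.le _
        _ = ENNReal.ofReal (D * Q) := by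
            rw [setLIntegral_const, Real.volume_Icc, ← ENNReal.ofReal_mul (by positivity),
              ← ENNReal.ofReal_mul hD.le]
            congr 1
            field_simp; ring
    have b2 : ∫⁻ s in Icc δ 1, F (x + s • (z - x)) ≤ ENNReal.ofReal (t * Real.log (1 / δ)) +
        ENNReal.ofReal (1 / t) * ∫⁻ s in Icc δ 1, ENNReal.ofReal s * F (x + s • (z - x)) ^ 2 := by
      have hm2 : Measurable fun s : ℝ => ENNReal.ofReal s * F (x + s • (z - x)) ^ 2 :=
        ENNReal.measurable_ofReal.mul ((hFc z).pow_const 2)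
      have hm1 : Measurable fun s : ℝ => ENNReal.ofReal (t * s⁻¹) :=
        ENNReal.measurable_ofReal.comp (measurable_const.mul measurable_inv)
      calc ∫⁻ s in Icc δ 1, F (x + s • (z - x))
          ≤ ∫⁻ s in Icc δ 1, (ENNReal.ofReal (t * s⁻¹) + ENNReal.ofReal (1 / t) *
              (ENNReal.ofReal s * F (x + s • (z - x)) ^ 2)) :=
            setLIntegral_mono' measurableSet_Icc fun s hs => hamgm s hs _
        _ = (∫⁻ s in Icc δ 1, ENNReal.ofReal (t * s⁻¹)) + ENNReal.ofReal (1 / t) *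
              ∫⁻ s in Icc δ 1, ENNReal.ofReal s * F (x + s • (z - x)) ^ 2 := by
            rw [lintegral_add_left hm1, lintegral_const_mul _ hm2]
        _ = _ := by
            congr 1
            have hii : IntervalIntegrable (fun s : ℝ => t * s⁻¹) volume δ 1 := by
              refine ContinuousOn.intervalIntegrable ?_
              refine continuousOn_const.mul (continuousOn_inv₀.mono ?_)
              intro s hs
              rw [uIcc_of_le hδ1.le] at hs
              exact (hδ.trans_le hs.1).ne'
            rw [← ofReal_integral_eq_lintegral_ofReal, integral_Icc_eq_integral_Ioc,
              ← intervalIntegral.integral_of_le hδ1.le, intervalIntegral.integral_const_mul,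
              integral_inv_of_pos hδ one_pos]
            · exact (integrableOn_Icc_iff_integrableOn_Ioc enorm_ne_top).2
                ((intervalIntegrable_iff_integrableOn_Ioc_of_le hδ1.le).1 hii)
            · rw [EventuallyLE, ae_restrict_iff' measurableSet_Icc]
              refine Eventually.of_forall fun s hs => ?_
              have : 0 < s := hδ.trans_le hs.1
              simp only [Pi.zero_apply]; positivity
    refine tri.trans ((add_le_add b1 (u2.trans (mul_le_mul' (ENNReal.ofReal_le_ofReal hzD) b2))).trans
      (le_of_eq ?_))
    rw [mul_add, ← mul_assoc, ← ENNReal.ofReal_mul hD.le, ← ENNReal.ofReal_mul hD.le, ← add_assoc,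
      ← ENNReal.ofReal_add (by positivity) (by positivity)]
  have hmJ : Measurable fun z => ∫⁻ s in Icc δ 1, ENNReal.ofReal s * F (x + s • (z - x)) ^ 2 := by
    refine Measurable.lintegral_prod_right' (f := fun q : Plane × ℝ =>
      ENNReal.ofReal q.2 * F (x + q.2 • (q.1 - x)) ^ 2) ?_
    refine (ENNReal.measurable_ofReal.comp measurable_snd).mul ((h.measurable.comp ?_).pow_const 2)
    exact (by fun_prop : Continuous fun q : Plane × ℝ => x + q.2 • (q.1 - x)).measurable
  calc ∫⁻ z in ball y₀ ρ, ENNReal.ofReal |w z - w x|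
      ≤ ∫⁻ z in ball y₀ ρ, (ENNReal.ofReal (D * Q + D * (t * Real.log (1 / δ))) +
        ENNReal.ofReal (D * (1 / t)) *
          ∫⁻ s in Icc δ 1, ENNReal.ofReal s * F (x + s • (z - x)) ^ 2) :=
        setLIntegral_mono' hBm hpt
    _ = ENNReal.ofReal (D * Q + D * (t * Real.log (1 / δ))) * volume (ball y₀ ρ) +
        ENNReal.ofReal (D * (1 / t)) * ∫⁻ z in ball y₀ ρ,
          ∫⁻ s in Icc δ 1, ENNReal.ofReal s * F (x + s • (z - x)) ^ 2 := by
        rw [lintegral_add_left measurable_const, setLIntegral_const, lintegral_const_mul _ hmJ]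
    _ ≤ ENNReal.ofReal (D * Q + D * (t * Real.log (1 / δ))) * volume (ball y₀ ρ) +
        ENNReal.ofReal (D * (1 / t)) * (ENNReal.ofReal (D / ρ) * ENNReal.ofReal (Q ^ 2)) := by
        gcongr
        exact (lintegral_star_le hρ hρD hδ (fun z hz => ⟨(hB z hz).1, (hB z hz).2.1⟩)
          h.measurable).trans (mul_le_mul_right h.lintegral_sq_le _)
    _ = _ := by
        rw [← ENNReal.ofReal_toReal (measure_ball_lt_top (μ := volume) (x := y₀) (r := ρ)).ne,
          ← measureReal_def, ← ENNReal.ofReal_mul (by positivity), ← ENNReal.ofReal_mul (by positivity),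
          ← ENNReal.ofReal_mul (by positivity), ← ENNReal.ofReal_add (by positivity) (by positivity)]
        congr 1
        ring

lemma abs_sub_le_of_star {S : Set Plane} {w : Plane → ℝ} {F : Plane → ℝ≥0∞} {δ Q : ℝ}
    (h : HasUpperGradient S w F δ Q) (hw : ContinuousOn w S) (hδ : 0 < δ) (hδ1 : δ < 1) (hQ : 0 < Q)
    {x x' y₀ : Plane} {ρ D : ℝ} (hρ : 0 < ρ) (hρD : ρ ≤ D) (hx : x ∈ S) (hx' : x' ∈ S)
    (hB : ∀ z ∈ ball y₀ ρ, ρ ≤ ‖z - x‖ ∧ ‖z - x‖ ≤ D ∧ ∀ s ∈ Ioc (0 : ℝ) 1, x + s • (z - x) ∈ S)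
    (hB' : ∀ z ∈ ball y₀ ρ, ρ ≤ ‖z - x'‖ ∧ ‖z - x'‖ ≤ D ∧
      ∀ s ∈ Ioc (0 : ℝ) 1, x' + s • (z - x') ∈ S) :
    |w x - w x'| ≤ (2 * (volume.real (ball y₀ ρ) * (2 * D) + D * (D / ρ)) / volume.real (ball y₀ ρ)) *
      (Q * √(1 + Real.log (1 / δ))) := by
  have hlog : 0 < Real.log (1 / δ) := Real.log_pos (by rw [lt_div_iff₀ hδ]; linarith)
  set R := √(1 + Real.log (1 / δ)) with hR
  have hR2 : R ^ 2 = 1 + Real.log (1 / δ) := Real.sq_sqrt (by linarith)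
  have hR1 : 1 ≤ R := Real.one_le_sqrt.2 (by linarith)
  set β := volume.real (ball y₀ ρ) with hβ
  have hβ0 : 0 < β := ENNReal.toReal_pos (measure_ball_pos volume y₀ hρ).ne' measure_ball_lt_top.ne
  have hβe : volume (ball y₀ ρ) = ENNReal.ofReal β :=
    (ENNReal.ofReal_toReal measure_ball_lt_top.ne).symm
  have hD : 0 < D := hρ.trans_le hρD
  -- This weight balances the logarithmic term `t * log (1 / δ)` against `Q ^ 2 / t`; both become at
  -- most multiples of `Q * R`.
  have ht : 0 < Q / R := by positivity
  set A := β * (D * Q + D * (Q / R * Real.log (1 / δ))) + D * (1 / (Q / R) * (D / ρ * Q ^ 2)) with hA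
  have hA0 : 0 ≤ A := by positivity
  have e1 := lintegral_abs_sub_le h hδ hδ1 hQ.le hρ hρD hx hB ht
  have e2 := lintegral_abs_sub_le h hδ hδ1 hQ.le hρ hρD hx' hB' ht
  have hsub : ball y₀ ρ ⊆ S := fun z hz => by
    simpa using (hB z hz).2.2 1 ⟨one_pos, le_rfl⟩
  have hm : AEMeasurable (fun z => ENNReal.ofReal |w z - w x|) (volume.restrict (ball y₀ ρ)) := by
    refine ENNReal.measurable_ofReal.comp_aemeasurable (ContinuousOn.aemeasurable ?_ measurableSet_ball)
    exact ((hw.mono hsub).sub continuousOn_const).abs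
  have e3 : ENNReal.ofReal (|w x - w x'| * β) ≤ ENNReal.ofReal (A + A) := by
    calc ENNReal.ofReal (|w x - w x'| * β) = ∫⁻ z in ball y₀ ρ, ENNReal.ofReal |w x - w x'| := by
          rw [setLIntegral_const, hβe, ENNReal.ofReal_mul (abs_nonneg _)]
      _ ≤ ∫⁻ z in ball y₀ ρ, (ENNReal.ofReal |w z - w x| + ENNReal.ofReal |w z - w x'|) := by
          refine lintegral_mono fun z => ?_
          rw [← ENNReal.ofReal_add (abs_nonneg _) (abs_nonneg _)]
          refine ENNReal.ofReal_le_ofReal ?_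
          have := abs_sub_le (w x) (w z) (w x')
          rwa [abs_sub_comm (w x) (w z)] at this
      _ ≤ _ := by
          rw [lintegral_add_left' hm, ENNReal.ofReal_add hA0 hA0]
          exact add_le_add e1 e2
  have e4 := (ENNReal.ofReal_le_ofReal_iff (by positivity)).1 e3
  have e5 : A ≤ (β * (2 * D) + D * (D / ρ)) * (Q * R) := by
    have i1 : Q ≤ Q * R := by nlinarith
    have i2 : Q / R * Real.log (1 / δ) ≤ Q * R := by
      rw [div_mul_eq_mul_div, div_le_iff₀ (by positivity)]
      nlinarith
    have i3 : 1 / (Q / R) * (D / ρ * Q ^ 2) = D / ρ * (Q * R) := by field_simp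
    rw [hA, i3]
    have : β * (D * Q + D * (Q / R * Real.log (1 / δ))) ≤ β * (D * (Q * R) + D * (Q * R)) := by gcongr
    nlinarith
  rw [div_mul_eq_mul_div, le_div_iff₀ hβ0]
  linarith

/-- Functions on a polygon with an upper gradient in `L²` that is bounded by `Q / δ` oscillate by at
most a multiple of `Q √(1 + log (1 / δ))`. -/
theorem IsLipschitzPolygon.exists_oscillation_le {Ω : Set Plane} (hΩ : IsLipschitzPolygon Ω) :
    ∃ C : ℝ, 0 ≤ C ∧ ∀ (w : Plane → ℝ) (F : Plane → ℝ≥0∞) (δ Q : ℝ), 0 < δ → δ < 1 → 0 < Q →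
      ContinuousOn w (closure Ω) → HasUpperGradient (closure Ω) w F δ Q →
      ∀ y ∈ closure Ω, ∀ z ∈ closure Ω, |w y - w z| ≤ C * (Q * √(1 + Real.log (1 / δ))) := by
  -- All admissible data are packed into one index type, so that the compactness argument yields a
  -- constant independent of them.
  let ι := {i : (Plane → ℝ) × (Plane → ℝ≥0∞) × ℝ × ℝ // 0 < i.2.2.1 ∧ i.2.2.1 < 1 ∧ 0 < i.2.2.2 ∧
    ContinuousOn i.1 (closure Ω) ∧ HasUpperGradient (closure Ω) i.1 i.2.1 i.2.2.1 i.2.2.2}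
  obtain ⟨C, hC0, hC⟩ := exists_oscillation_bound (K := closure Ω) hΩ.isCompact_closure
    hΩ.isConnected.isPreconnected.closure (fun i : ι => i.1.1)
    (fun i => i.1.2.2.2 * √(1 + Real.log (1 / i.1.2.2.1)))
    (fun i => mul_nonneg i.2.2.2.1.le (Real.sqrt_nonneg _)) (by
      intro x₀ hx₀
      obtain ⟨ε, hε, y₀, ρ, D, hρ, hρD, hst⟩ := hΩ.exists_star_ball hx₀
      refine ⟨closure Ω ∩ ball x₀ ε, inter_mem self_mem_nhdsWithin
        (mem_nhdsWithin_of_mem_nhds (ball_mem_nhds _ hε)),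
        2 * (volume.real (ball y₀ ρ) * (2 * D) + D * (D / ρ)) / volume.real (ball y₀ ρ), fun i y hy z hz => ?_⟩
      obtain ⟨h1, h2, h3, h4, h5⟩ := i.2
      refine abs_sub_le_of_star h5 h4 h1 h2 h3 hρ hρD hy.1 hz.1 (fun v hv => ?_) (fun v hv => ?_)
      · obtain ⟨g1, g2, g3⟩ := hst y hy.1 hy.2 v hv
        exact ⟨g1, g2, fun s hs => subset_closure (g3 s hs)⟩
      · obtain ⟨g1, g2, g3⟩ := hst z hz.1 hz.2 v hv
        exact ⟨g1, g2, fun s hs => subset_closure (g3 s hs)⟩)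
  exact ⟨C, hC0, fun w F δ Q h1 h2 h3 h4 h5 => hC ⟨(w, F, δ, Q), h1, h2, h3, h4, h5⟩⟩

namespace Triangulation

variable {Ω : Set Plane} (T : Triangulation Ω)

/-- By the intermediate value theorem the interval between the two values is covered by the images
of the pieces of the segment in the triangles, and on each piece `w` is affine. Comparing lengths
requires no subdivision of the segment and also covers segments running along edges. -/
lemma abs_sub_le_sum_volume {w : Plane → ℝ} {gr : Triangle → Plane} {d : Triangle → ℝ}
    (hw : ContinuousOn w (closure Ω))
    (hg : ∀ τ ∈ T.elems, ∀ x ∈ τ.carrier, w x = inner ℝ (gr τ) x + d τ)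
    {x v : Plane} {a b : ℝ} (hab : a ≤ b) (hS : ∀ s ∈ Icc a b, x + s • v ∈ closure Ω) :
    ENNReal.ofReal |w (x + b • v) - w (x + a • v)| ≤ ∑ τ ∈ T.elems,
      ENNReal.ofReal |inner ℝ (gr τ) v| * volume ((fun s : ℝ => x + s • v) ⁻¹' τ.carrier ∩ Icc a b) := by
  set f : ℝ → ℝ := fun s => w (x + s • v) with hf
  have hfc : ContinuousOn f (uIcc a b) := by
    rw [uIcc_of_le hab]
    exact hw.comp (by fun_prop) hS
  set I : Triangle → Set ℝ := fun τ => (fun s : ℝ => x + s • v) ⁻¹' τ.carrier ∩ Icc a b with hI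
  have hcov : uIcc (f a) (f b) ⊆ ⋃ τ ∈ T.elems, f '' I τ := by
    refine (intermediate_value_uIcc hfc).trans ?_
    rw [uIcc_of_le hab]
    rintro _ ⟨s, hs, rfl⟩
    have := hS s hs
    rw [T.cover] at this
    simp only [mem_iUnion, exists_prop] at this ⊢
    obtain ⟨τ, hτ, hx⟩ := this
    exact ⟨τ, hτ, s, ⟨hx, hs⟩, rfl⟩
  have himg : ∀ τ ∈ T.elems, volume (f '' I τ) ≤ ENNReal.ofReal |inner ℝ (gr τ) v| * volume (I τ) := by
    intro τ hτ
    have : f '' I τ ⊆ (fun y => (inner ℝ (gr τ) x + d τ) + y) '' ((inner ℝ (gr τ) v : ℝ) • I τ) := by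
      rintro _ ⟨s, hs, rfl⟩
      refine ⟨_, smul_mem_smul_set hs, ?_⟩
      simp only [hf]
      rw [hg τ hτ _ hs.1, inner_add_right, inner_smul_right, smul_eq_mul]
      ring
    refine (measure_mono this).trans (le_of_eq ?_)
    rw [image_add_left, measure_preimage_add, Measure.addHaar_smul, Module.finrank_self, pow_one]
  calc ENNReal.ofReal |w (x + b • v) - w (x + a • v)| = volume (uIcc (f a) (f b)) := by
        rw [Real.volume_interval]
    _ ≤ ∑ τ ∈ T.elems, volume (f '' I τ) := (measure_mono hcov).trans (measure_biUnion_finset_le _ _)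
    _ ≤ _ := Finset.sum_le_sum himg

lemma lintegral_sum_indicator_sq (c : Triangle → ℝ≥0∞) :
    ∫⁻ x, (∑ τ ∈ T.elems, τ.carrier.indicator (fun _ => c τ) x) ^ 2 =
      ∑ τ ∈ T.elems, c τ ^ 2 * volume τ.carrier := by
  have hm : ∀ τ : Triangle, MeasurableSet τ.carrier := fun τ => τ.isCompact_carrier.measurableSet
  have hmi : ∀ τ : Triangle, Measurable (τ.carrier.indicator fun _ : Plane => c τ) := fun τ =>
    measurable_const.indicator (hm τ)
  have h1 : ∀ x, (∑ τ ∈ T.elems, τ.carrier.indicator (fun _ => c τ) x) ^ 2 =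
      ∑ τ ∈ T.elems, ∑ τ' ∈ T.elems, (τ.carrier ∩ τ'.carrier).indicator (fun _ => c τ * c τ') x := by
    intro x
    rw [sq, Finset.sum_mul_sum]
    refine Finset.sum_congr rfl fun τ _ => Finset.sum_congr rfl fun τ' _ => ?_
    by_cases h : x ∈ τ.carrier <;> by_cases h' : x ∈ τ'.carrier <;> simp [indicator, h, h']
  simp_rw [h1]
  rw [lintegral_finsetSum _ fun τ _ => Finset.measurable_sum _ fun τ' _ =>
    measurable_const.indicator ((hm τ).inter (hm τ'))]
  refine Finset.sum_congr rfl fun τ hτ => ?_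
  rw [lintegral_finsetSum _ fun τ' _ => measurable_const.indicator ((hm τ).inter (hm τ'))]
  rw [Finset.sum_eq_single τ]
  · rw [lintegral_indicator_const ((hm τ).inter (hm τ)), inter_self, sq]
  · intro τ' hτ' hne
    rw [lintegral_indicator_const ((hm τ).inter (hm τ')), T.aedisjoint hτ hτ' hne.symm, mul_zero]
  · exact fun h => absurd hτ h

/-- A continuous piecewise affine function has an upper gradient that equals the length of its
gradient inside each triangle. -/
lemma hasUpperGradient {w : Plane → ℝ} {gr : Triangle → Plane} {d : Triangle → ℝ}
    (hw : ContinuousOn w (closure Ω))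
    (hg : ∀ τ ∈ T.elems, ∀ x ∈ τ.carrier, w x = inner ℝ (gr τ) x + d τ)
    {lam δ Q N : ℝ} (hlam : 0 ≤ lam) (hreg : ∀ τ ∈ T.elems, diam τ.carrier ^ 2 ≤ lam * τ.det)
    (hN : 0 ≤ N) (hgN : ∀ τ ∈ T.elems, ‖gr τ‖ ≤ N) (hNQ : 8 * lam * N ≤ Q / δ)
    (hQ : ∑ τ ∈ T.elems, ‖gr τ‖ ^ 2 * volume.real τ.carrier ≤ Q ^ 2) :
    HasUpperGradient (closure Ω) w
      (fun x => ∑ τ ∈ T.elems, τ.carrier.indicator (fun _ => ENNReal.ofReal ‖gr τ‖) x) δ Q := by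
  classical
  have hm : ∀ τ : Triangle, MeasurableSet τ.carrier := fun τ => τ.isCompact_carrier.measurableSet
  refine ⟨Finset.measurable_sum _ fun τ _ => measurable_const.indicator (hm τ), fun x => ?_, ?_, ?_⟩
  · have h1 : ∑ τ ∈ T.elems, τ.carrier.indicator (fun _ => ENNReal.ofReal ‖gr τ‖) x =
        ∑ τ ∈ T.elems with x ∈ τ.carrier, ENNReal.ofReal ‖gr τ‖ := by
      rw [Finset.sum_filter]; rfl
    rw [h1, ← ENNReal.ofReal_sum_of_nonneg fun _ _ => norm_nonneg _]
    refine ENNReal.ofReal_le_ofReal (le_trans ?_ hNQ)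
    refine (Finset.sum_le_card_nsmul _ _ N fun τ hτ => hgN τ (Finset.mem_filter.1 hτ).1).trans ?_
    rw [nsmul_eq_mul]
    refine mul_le_mul_of_nonneg_right ?_ hN
    convert T.card_filter_mem_le hlam hreg x
  · rw [T.lintegral_sum_indicator_sq]
    refine le_trans (le_of_eq ?_) (ENNReal.ofReal_le_ofReal hQ)
    rw [ENNReal.ofReal_sum_of_nonneg fun _ _ => by positivity]
    refine Finset.sum_congr rfl fun τ _ => ?_
    rw [ENNReal.ofReal_mul (by positivity), ENNReal.ofReal_pow (norm_nonneg _), measureReal_def,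
      ENNReal.ofReal_toReal τ.isCompact_carrier.measure_lt_top.ne]
  · intro x v a b hab hS
    have hpre : ∀ τ : Triangle, MeasurableSet ((fun s : ℝ => x + s • v) ⁻¹' τ.carrier) := fun τ =>
      (by fun_prop : Continuous fun s : ℝ => x + s • v).measurable (hm τ)
    refine (T.abs_sub_le_sum_volume hw hg hab hS).trans ?_
    have : ∀ (τ : Triangle) (s : ℝ), τ.carrier.indicator (fun _ => ENNReal.ofReal ‖gr τ‖) (x + s • v) =
        ((fun s : ℝ => x + s • v) ⁻¹' τ.carrier).indicator (fun _ => ENNReal.ofReal ‖gr τ‖) s :=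
      fun _ _ => rfl
    simp_rw [this]
    rw [lintegral_finsetSum _ fun τ _ => measurable_const.indicator (hpre τ), Finset.mul_sum]
    refine Finset.sum_le_sum fun τ _ => ?_
    rw [lintegral_indicator_const (hpre τ), Measure.restrict_apply (hpre τ), ← mul_assoc,
      ← ENNReal.ofReal_mul (norm_nonneg _)]
    gcongr
    rw [mul_comm]
    exact abs_real_inner_le_norm _ _

end Triangulation

/-! ### Mesh quantities and piecewise affine functions -/

lemma curl_eq_rot {S : Set Plane} {w : Plane → ℝ} {g : Plane} {d : ℝ}
    (h : ∀ x ∈ S, w x = inner ℝ g x + d) {x : Plane} (hx : x ∈ interior S) : curl w x = rot g := by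
  have hf : HasFDerivAt w (innerSL ℝ g) x := by
    have h1 : HasFDerivAt (fun x => inner ℝ g x + d) (innerSL ℝ g) x :=
      ((innerSL ℝ g).hasFDerivAt).add_const d
    refine h1.congr_of_eventuallyEq ?_
    filter_upwards [mem_interior_iff_mem_nhds.1 hx] with y hy using h y hy
  have hp : ∀ i, partialDeriv i w x = g i := by
    intro i
    rw [partialDeriv, hf.fderiv]
    simp [EuclideanSpace.inner_single_right]
  ext i
  fin_cases i <;> simp [curl, hp, rot]

namespace Triangulation

variable {Ω : Set Plane} (T : Triangulation Ω)

lemma elems_nonempty (hΩ : IsLipschitzPolygon Ω) : T.elems.Nonempty := by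
  obtain ⟨x, hx⟩ := hΩ.isConnected.nonempty
  have := subset_closure hx
  rw [T.cover] at this
  simp only [mem_iUnion, exists_prop] at this
  obtain ⟨τ, hτ, _⟩ := this
  exact ⟨τ, hτ⟩

lemma diam_le_meshSize {τ : Triangle} (hτ : τ ∈ T.elems) : diam τ.carrier ≤ T.meshSize :=
  le_ciSup (f := fun τ : T.elems => diam τ.1.carrier) (finite_range _).bddAbove ⟨τ, hτ⟩

lemma meshSize_pos (hΩ : IsLipschitzPolygon Ω) : 0 < T.meshSize := by
  obtain ⟨τ, hτ⟩ := T.elems_nonempty hΩ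
  exact τ.diam_pos.trans_le (T.diam_le_meshSize hτ)

lemma setIntegral_eq_sum (hΩ : IsLipschitzPolygon Ω) {f : Plane → ℝ}
    (hf : ∀ τ ∈ T.elems, IntegrableOn f τ.carrier) :
    ∫ x in Ω, f x = ∑ τ ∈ T.elems, ∫ x in τ.carrier, f x := by
  rw [T.restrict_eq_sum hΩ, integral_finsetSum_measure hf]

lemma sum_volume (hΩ : IsLipschitzPolygon Ω) :
    ∑ τ ∈ T.elems, volume.real τ.carrier = volume.real Ω := by
  have h := T.setIntegral_eq_sum hΩ (f := fun _ => 1) fun τ _ =>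
    integrableOn_const τ.isCompact_carrier.measure_lt_top.ne
  simpa using h.symm

lemma l2Norm_curl_sq (hΩ : IsLipschitzPolygon Ω) {w : Plane → ℝ} {g : Triangle → Plane}
    {d : Triangle → ℝ} (hg : ∀ τ ∈ T.elems, ∀ x ∈ τ.carrier, w x = inner ℝ (g τ) x + d τ) :
    l2Norm Ω (curl w) ^ 2 = ∑ τ ∈ T.elems, ‖g τ‖ ^ 2 * volume.real τ.carrier := by
  have h1 : ∫⁻ x in Ω, ‖curl w x‖ₑ ^ (2 : ℝ) =
      ENNReal.ofReal (∑ τ ∈ T.elems, ‖g τ‖ ^ 2 * volume.real τ.carrier) := by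
    rw [T.restrict_eq_sum hΩ, lintegral_finsetSum_measure,
      ENNReal.ofReal_sum_of_nonneg fun _ _ => by positivity]
    refine Finset.sum_congr rfl fun τ hτ => ?_
    rw [← Measure.restrict_congr_set τ.interior_ae_eq, setLIntegral_congr_fun
      (g := fun _ => ENNReal.ofReal (‖g τ‖ ^ 2)) isOpen_interior.measurableSet, setLIntegral_const,
      measure_congr τ.interior_ae_eq, ENNReal.ofReal_mul (by positivity), measureReal_def,
      ENNReal.ofReal_toReal τ.isCompact_carrier.measure_lt_top.ne]
    intro x hx
    simp only
    rw [curl_eq_rot (hg τ hτ) hx, ← ofReal_norm, norm_rot, ENNReal.ofReal_rpow_of_nonneg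
      (norm_nonneg _) (by norm_num)]
    norm_cast
  have h2 : 0 ≤ ∑ τ ∈ T.elems, ‖g τ‖ ^ 2 * volume.real τ.carrier :=
    Finset.sum_nonneg fun _ _ => by positivity
  rw [l2Norm, eLpNorm_eq_lintegral_rpow_enorm_toReal (by norm_num) (by norm_num), ENNReal.toReal_ofNat, h1,
    ENNReal.ofReal_rpow_of_nonneg h2 (by norm_num),
    ENNReal.toReal_ofReal (by positivity), ← Real.sqrt_eq_rpow, Real.sq_sqrt h2]

lemma sum_det_mul_norm_sq (hΩ : IsLipschitzPolygon Ω) {w : Plane → ℝ} {g : Triangle → Plane}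
    {d : Triangle → ℝ} (hg : ∀ τ ∈ T.elems, ∀ x ∈ τ.carrier, w x = inner ℝ (g τ) x + d τ) :
    ∑ τ ∈ T.elems, τ.det * ‖g τ‖ ^ 2 = 2 * l2Norm Ω (curl w) ^ 2 := by
  rw [T.l2Norm_curl_sq hΩ hg, Finset.mul_sum]
  refine Finset.sum_congr rfl fun τ _ => ?_
  rw [τ.volume_real_carrier]; ring

lemma sum_det_mul_norm_le (hΩ : IsLipschitzPolygon Ω) {w : Plane → ℝ} {g : Triangle → Plane}
    {d : Triangle → ℝ} (hg : ∀ τ ∈ T.elems, ∀ x ∈ τ.carrier, w x = inner ℝ (g τ) x + d τ) :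
    ∑ τ ∈ T.elems, τ.det * ‖g τ‖ ≤ 2 * √(volume.real Ω) * l2Norm Ω (curl w) := by
  have hQ : 0 ≤ l2Norm Ω (curl w) := ENNReal.toReal_nonneg
  have h1 : ∑ τ ∈ T.elems, τ.det = 2 * volume.real Ω := by
    rw [← T.sum_volume hΩ, Finset.mul_sum]
    refine Finset.sum_congr rfl fun τ _ => ?_
    rw [τ.volume_real_carrier]; ring
  have h2 := Finset.sum_mul_sq_le_sq_mul_sq T.elems (fun τ => √τ.det) (fun τ => √τ.det * ‖g τ‖)
  have h3 : ∀ τ : Triangle, √τ.det ^ 2 = τ.det := fun τ => Real.sq_sqrt τ.det_pos.le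
  simp only [mul_pow, h3, ← mul_assoc, Real.mul_self_sqrt (Triangle.det_pos _).le] at h2
  rw [h1, T.sum_det_mul_norm_sq hΩ hg] at h2
  refine abs_le_of_sq_le_sq' ?_ (by positivity) |>.2
  rw [mul_pow, mul_pow, Real.sq_sqrt (by positivity)]
  linarith

/-- The discrete Sobolev inequality: an inverse estimate bounds each gradient by `2 * lam * Q / N`,
so the oscillation theorem applies with `δ` a multiple of the smallest admissible diameter `N`. -/
lemma exists_abs_sub_le_l2Norm_curl (hΩ : IsLipschitzPolygon Ω) :
    ∃ C : ℝ, 0 ≤ C ∧ ∀ (T : Triangulation Ω) (lam N : ℝ), 1 ≤ lam →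
      (∀ τ ∈ T.elems, diam τ.carrier ^ 2 ≤ lam * τ.det) → 0 < N → N < 1 →
      (∀ τ ∈ T.elems, N ≤ diam τ.carrier) →
      ∀ w ∈ T.continuousPiecewiseLinear, ∀ y ∈ closure Ω, ∀ z ∈ closure Ω,
        |w y - w z| ≤ C * (l2Norm Ω (curl w) * √(1 + Real.log (16 * lam ^ 2 / N))) := by
  obtain ⟨C, hC0, hC⟩ := hΩ.exists_oscillation_le
  refine ⟨C, hC0, fun T lam N hlam hreg hN hN1 hNd w hw y hy z hz => ?_⟩
  choose! g d hg using hw.2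
  set Q := l2Norm Ω (curl w) with hQ
  have hQ0 : 0 ≤ Q := ENNReal.toReal_nonneg
  -- `Q` may vanish, whereas the oscillation theorem needs a positive bound; `Q'` then tends to `Q`.
  have key : ∀ Q', Q < Q' → |w y - w z| ≤ C * (Q' * √(1 + Real.log (16 * lam ^ 2 / N))) := by
    intro Q' hQ'
    have h16 : (1 : ℝ) < 16 * lam ^ 2 := by nlinarith
    -- The overlap `8 * lam` times the gradient bound `2 * lam * Q / N` is `16 * lam ^ 2 * Q / N`,
    -- which determines `δ`.
    have := hC w _ (N / (16 * lam ^ 2)) Q' (by positivity)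
      ((div_lt_one (by positivity)).2 (by linarith)) (hQ0.trans_lt hQ') hw.1
      (T.hasUpperGradient (lam := lam) (N := 2 * lam * Q / N) hw.1 hg (by positivity) hreg
        (by positivity) ?_ ?_ ?_) y hy z hz
    · rwa [one_div_div] at this
    · intro τ hτ
      rw [le_div_iff₀ hN]
      refine abs_le_of_sq_le_sq' ?_ (by positivity) |>.2
      have h1 : ‖g τ‖ ^ 2 * volume.real τ.carrier ≤ Q ^ 2 := by
        rw [hQ, T.l2Norm_curl_sq hΩ hg]
        exact Finset.single_le_sum (f := fun τ => ‖g τ‖ ^ 2 * volume.real τ.carrier)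
          (fun _ _ => by positivity) hτ
      rw [τ.volume_real_carrier] at h1
      have h2 : N ^ 2 ≤ lam * τ.det := (pow_le_pow_left₀ hN.le (hNd τ hτ) 2).trans (hreg τ hτ)
      calc (‖g τ‖ * N) ^ 2 = ‖g τ‖ ^ 2 * N ^ 2 := by ring
        _ ≤ ‖g τ‖ ^ 2 * (lam * τ.det) := by gcongr
        _ = 2 * lam * (‖g τ‖ ^ 2 * (τ.det / 2)) := by ring
        _ ≤ 2 * lam * Q ^ 2 := by gcongr
        _ ≤ (2 * lam * Q) ^ 2 := by nlinarith [mul_nonneg (by linarith : 0 ≤ lam) (sq_nonneg Q),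
            mul_le_mul_of_nonneg_right (mul_le_mul hlam hlam one_pos.le (by linarith)) (sq_nonneg Q)]
    · rw [div_div_eq_mul_div, ← mul_div_assoc, div_le_div_iff_of_pos_right hN]
      nlinarith
    · rw [← T.l2Norm_curl_sq hΩ hg]
      exact pow_le_pow_left₀ hQ0 hQ'.le 2
  have hlim : Tendsto (fun Q' => C * (Q' * √(1 + Real.log (16 * lam ^ 2 / N)))) (𝓝[>] Q)
      (𝓝 (C * (Q * √(1 + Real.log (16 * lam ^ 2 / N))))) :=
    ((continuous_const.mul (continuous_id.mul continuous_const)).tendsto Q).mono_left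
      nhdsWithin_le_nhds
  exact ge_of_tendsto hlim (eventually_mem_nhdsWithin.mono key)

end Triangulation

/-! ### Reduction to a sum over half-edges -/

/-- A field in `W^{2,∞}` has a bounded gradient field that approximates it to second order on
triangles and is Lipschitz up to the boundary. -/
theorem IsLipschitzPolygon.exists_gradient_field {Ω : Set Plane} (hΩ : IsLipschitzPolygon Ω) :
    ∃ C : ℝ, 0 ≤ C ∧ ∀ p : Plane → Plane, MemW2InfVec Ω p → ∃ G : Plane → Fin 2 → Plane,
      (∀ x i, ‖G x i‖ ≤ 2 * gradNorm1Inf Ω p) ∧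
      (∀ x ∈ Ω, ∀ y ∈ Ω, ∀ i, ‖G y i - G x i‖ ≤ C * gradNorm1Inf Ω p * ‖y - x‖) ∧
      ∀ x y, segment ℝ x y ⊆ Ω →
        ‖p y - (p x + rowApply (G x) (y - x))‖ ≤ 8 * gradNorm1Inf Ω p * ‖y - x‖ ^ 2 := by
  obtain ⟨C, hC0, hC⟩ := hΩ.exists_lipschitz_const
  refine ⟨C * 4, by positivity, fun p hp => ?_⟩
  set K := gradNorm1Inf Ω p with hK
  have hK0 : 0 ≤ K := ENNReal.toReal_nonneg
  have hcont : ∀ i, ContinuousOn (fun x => p x i) Ω := fun i =>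
    ((EuclideanSpace.proj (𝕜 := ℝ) i).continuous.comp_continuousOn hp.1).mono subset_closure
  have hex := fun i => exists_gradient hΩ.isOpen hΩ.isBounded (hcont i) (hp.2 i) hK0
    fun j => sobolevInfNorm_weakDeriv_le hΩ.isOpen hp i j
  choose G hG1 hG2 using hex
  refine ⟨fun x i => G i x, fun x i => hG1 i x, fun x hx y hy i => ?_, fun x y hxy => ?_⟩
  · have := hC (4 * K) (G i) (by positivity) (fun x => (hG1 i x).trans (by linarith))
      (fun x y h => (hG2 i x y h).1) x hx y hy
    linarith
  · have e : p y - (p x + rowApply (fun i => G i x) (y - x)) =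
        !₂[p y 0 - p x 0 - inner ℝ (G 0 x) (y - x), p y 1 - p x 1 - inner ℝ (G 1 x) (y - x)] := by
      ext i
      fin_cases i <;> simp <;> ring
    rw [e]
    refine (norm_plane_le _ _).trans ?_
    have h0 := (hG2 0 x y hxy).2
    have h1 := (hG2 1 x y hxy).2
    linarith

namespace Triangulation

variable {Ω : Set Plane} (T : Triangulation Ω)

lemma abs_setIntegral_sub_sum_coef_le (hΩ : IsLipschitzPolygon Ω) {τ : Triangle} (hτ : τ ∈ T.elems)
    {lam K : ℝ} (hK : 0 ≤ K) (hreg : diam τ.carrier ^ 2 ≤ lam * τ.det)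
    {p : Plane → Plane} (hp : ContinuousOn p (closure Ω)) {G : Plane → Fin 2 → Plane}
    (hG : ∀ x y, segment ℝ x y ⊆ Ω → ‖p y - (p x + rowApply (G x) (y - x))‖ ≤ K * ‖y - x‖ ^ 2)
    {r f : Plane → Plane} (hf : f ∈ RT0) (hrf : EqOn r f (interior τ.carrier))
    (hfl : ∀ k, τ.flux f k = τ.flux p k)
    {w : Plane → ℝ} {g : Plane} {d : ℝ} (hw : ∀ x ∈ τ.carrier, w x = inner ℝ g x + d) :
    |(∫ x in τ.carrier, inner ℝ (p x - r x) (curl w x)) -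
      ∑ k, τ.coef k (G τ.centroid) * (w (τ.a (k + 2)) - w (τ.a (k + 1)))| ≤
      2 * K * lam * T.meshSize ^ 2 * (τ.det * ‖g‖) := by
  have e1 : ∫ x in τ.carrier, inner ℝ (p x - r x) (curl w x) =
      ∫ x in τ.carrier, inner ℝ (p x - f x) (rot g) := by
    rw [← Measure.restrict_congr_set τ.interior_ae_eq]
    refine setIntegral_congr_fun isOpen_interior.measurableSet fun x hx => ?_
    rw [hrf hx, curl_eq_rot hw hx]
  have e2 : ∀ k, w (τ.a (k + 2)) - w (τ.a (k + 1)) = inner ℝ (rot g) (rot (τ.vec k)) := by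
    intro k
    rw [hw _ (τ.vertex_mem _), hw _ (τ.vertex_mem _)]
    simp only [inner_plane, rot_zero_apply, rot_one_apply, Triangle.vec, PiLp.sub_apply]
    ring
  have hsub := T.interior_subset hΩ hτ
  have happ : ∀ x ∈ τ.carrier, ‖p x - (p τ.centroid + rowApply (G τ.centroid) (x - τ.centroid))‖ ≤
      K * diam τ.carrier ^ 2 := by
    intro x hx
    have hcp : ContinuousOn p (closure (interior τ.carrier)) :=
      hp.mono ((closure_mono _root_.interior_subset).trans
        (τ.isCompact_carrier.isClosed.closure_eq.subset.trans (T.carrier_subset hτ)))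
    have hcr : Continuous fun x => p τ.centroid + rowApply (G τ.centroid) (x - τ.centroid) := by
      have : Continuous fun x => rowApply (G τ.centroid) (x - τ.centroid) := by
        unfold rowApply; fun_prop
      exact continuous_const.add this
    have hcn : ContinuousOn
        (fun x => ‖p x - (p τ.centroid + rowApply (G τ.centroid) (x - τ.centroid))‖)
        (closure (interior τ.carrier)) := (hcp.sub hcr.continuousOn).norm
    -- The Taylor estimate requires segments inside the open set `Ω`, hence points interior to the
    -- triangle. Continuity of `p` extends it to the edges, where the fluxes live.
    refine le_on_closure (fun y hy => ?_) hcn continuousOn_const (τ.carrier_subset_closure_interior hx)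
    refine (hG _ _ ((τ.convex_carrier.interior.segment_subset τ.centroid_mem_interior hy).trans
      hsub)).trans ?_
    have : ‖y - τ.centroid‖ ≤ diam τ.carrier := by
      rw [← dist_eq_norm]
      exact τ.dist_le_diam (_root_.interior_subset hy) τ.centroid_mem
    gcongr
  have h := τ.abs_integral_sub_sum_coef_le (q := rot g) (hp.mono (T.carrier_subset hτ)) hf hfl happ
  rw [norm_rot] at h
  simp_rw [e1, e2]
  refine h.trans ?_
  have hd := pow_le_pow_left₀ diam_nonneg (T.diam_le_meshSize hτ) 2
  calc 2 * (K * diam τ.carrier ^ 2) * diam τ.carrier ^ 2 * ‖g‖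
      ≤ 2 * (K * T.meshSize ^ 2) * (lam * τ.det) * ‖g‖ := by gcongr
    _ = _ := by ring

lemma integrableOn_inner_curl {τ : Triangle} (hτ : τ ∈ T.elems)
    {p r f : Plane → Plane} (hp : ContinuousOn p (closure Ω)) (hf : f ∈ RT0)
    (hrf : EqOn r f (interior τ.carrier)) {w : Plane → ℝ} {g : Plane} {d : ℝ}
    (hw : ∀ x ∈ τ.carrier, w x = inner ℝ g x + d) :
    IntegrableOn (fun x => inner ℝ (p x - r x) (curl w x)) τ.carrier := by
  obtain ⟨a, b, rfl⟩ := hf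
  have h1 : IntegrableOn (fun x => inner ℝ (p x - (a + b • x)) (rot g)) τ.carrier := by
    refine ContinuousOn.integrableOn_compact τ.isCompact_carrier ?_
    have hc : Continuous fun x : Plane => a + b • x := by fun_prop
    exact ((hp.mono (T.carrier_subset hτ)).sub hc.continuousOn).inner continuousOn_const
  rw [← integrableOn_congr_set_ae τ.interior_ae_eq] at h1 ⊢
  refine h1.congr_fun (fun x hx => ?_) isOpen_interior.measurableSet
  simp only
  rw [hrf hx, curl_eq_rot hw hx]

lemma abs_integral_sub_sum_halfEdges_le (hΩ : IsLipschitzPolygon Ω) {lam K : ℝ} (hlam : 0 ≤ lam)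
    (hK : 0 ≤ K) (hreg : ∀ τ ∈ T.elems, diam τ.carrier ^ 2 ≤ lam * τ.det)
    {p : Plane → Plane} (hp : ContinuousOn p (closure Ω)) {G : Plane → Fin 2 → Plane}
    (hG : ∀ x y, segment ℝ x y ⊆ Ω → ‖p y - (p x + rowApply (G x) (y - x))‖ ≤ K * ‖y - x‖ ^ 2)
    {r : Plane → Plane} (hr : T.IsRTInterpolant p r) {w : Plane → ℝ} {g : Triangle → Plane}
    {d : Triangle → ℝ} (hg : ∀ τ ∈ T.elems, ∀ x ∈ τ.carrier, w x = inner ℝ (g τ) x + d τ) :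
    |(∫ x in Ω, inner ℝ (p x - r x) (curl w x)) - ∑ b ∈ T.halfEdges,
      b.1.coef b.2 (G b.1.centroid) * (w (b.1.a (b.2 + 2)) - w (b.1.a (b.2 + 1)))| ≤
      4 * K * lam * √(volume.real Ω) * (T.meshSize ^ 2 * l2Norm Ω (curl w)) := by
  choose! f hf hrf hfl using hr
  rw [T.setIntegral_eq_sum hΩ fun τ hτ => T.integrableOn_inner_curl hτ hp (hf τ hτ) (hrf τ hτ) (hg τ hτ),
    halfEdges, Finset.sum_product, ← Finset.sum_sub_distrib]
  calc _ ≤ ∑ τ ∈ T.elems, 2 * K * lam * T.meshSize ^ 2 * (τ.det * ‖g τ‖) :=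
        (Finset.abs_sum_le_sum_abs _ _).trans (Finset.sum_le_sum fun τ hτ =>
          T.abs_setIntegral_sub_sum_coef_le hΩ hτ hK (hreg τ hτ) hp hG (hf τ hτ) (hrf τ hτ)
            (hfl τ hτ) (hg τ hτ))
    _ ≤ 2 * K * lam * T.meshSize ^ 2 * (2 * √(volume.real Ω) * l2Norm Ω (curl w)) := by
        rw [← Finset.mul_sum]
        exact mul_le_mul_of_nonneg_left (T.sum_det_mul_norm_le hΩ hg) (by positivity)
    _ = _ := by ring

end Triangulation

/-! ### Interior edges -/

namespace Triangulation

variable {Ω : Set Plane} (T : Triangulation Ω) {τ τ' : Triangle}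

lemma norm_centroid_sub_le (hτ : τ ∈ T.elems) (hτ' : τ' ∈ T.elems) {x : Plane} (hx : x ∈ τ.carrier)
    (hx' : x ∈ τ'.carrier) : ‖τ.centroid - τ'.centroid‖ ≤ 2 * T.meshSize := by
  rw [← dist_eq_norm]
  have h1 := (τ.dist_le_diam τ.centroid_mem hx).trans (T.diam_le_meshSize hτ)
  have h2 := (τ'.dist_le_diam hx' τ'.centroid_mem).trans (T.diam_le_meshSize hτ')
  linarith [dist_triangle τ.centroid x τ'.centroid]

/-- The tangents along a common edge are exactly opposite, so the direction error is `η = 0`. The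
shared edge makes the two diameters comparable, and the change of gradient contributes `L`. -/
lemma abs_coef_sub_le (hτ : τ ∈ T.elems) (hτ' : τ' ∈ T.elems) (hne : τ ≠ τ') {k k' : Fin 3}
    (h : τ.edge k = τ'.edge k') {lam K L δ : ℝ} (hlam : 1 ≤ lam)
    (hreg : ∀ τ ∈ T.elems, diam τ.carrier ^ 2 ≤ lam * τ.det) {G : Triangle → Fin 2 → Plane}
    (hK : 0 ≤ K) (hG : ∀ τ ∈ T.elems, ∀ i, ‖G τ i‖ ≤ K) (hL : 0 ≤ L)
    (hGL : ∀ τ ∈ T.elems, ∀ τ' ∈ T.elems, ∀ x ∈ τ.carrier, x ∈ τ'.carrier → ∀ i,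
      ‖G τ i - G τ' i‖ ≤ L) (hcl : τ.EdgesClose k τ' k' δ) :
    |τ.coef k (G τ) - τ'.coef k' (G τ')| ≤
      (16 * lam ^ 4 * K * δ + lam * L * T.meshSize) * diam τ.carrier := by
  obtain ⟨o1, o2⟩ := T.edge_orientation hτ hτ' hne h
  have hvec : τ'.vec k' = -τ.vec k := by
    rw [Triangle.vec, Triangle.vec, o1, o2]; abel
  have hlen : τ'.len k' = τ.len k := by rw [τ'.len_eq, τ.len_eq, hvec, norm_neg]
  have htan : τ'.tangent k' = -τ.tangent k := by
    rw [Triangle.tangent, Triangle.tangent, hlen, o1, o2, ← smul_neg]; congr 1; abel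
  have hd' : diam τ'.carrier ≤ lam * diam τ.carrier := by
    refine (τ'.diam_le_len (hreg τ' hτ') (by linarith) k').trans ?_
    rw [hlen]
    exact mul_le_mul_of_nonneg_left (τ.len_le_diam k) (by linarith)
  have hd : diam τ.carrier ≤ lam * diam τ.carrier := le_mul_of_one_le_left diam_nonneg hlam
  have h1 := Triangle.abs_coef_sub_coef_le (η := 0) (ς := -1) hK (hG τ' hτ') hlam (hreg τ hτ)
    (hreg τ' hτ') hd hd' (Or.inr rfl) hcl (by rw [htan]; simp)
  have h2 := τ.abs_coef_le hL (g := fun i => G τ i - G τ' i)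
    (hGL τ hτ τ' hτ' _ (τ.vertex_mem (k + 1)) (by rw [← o2]; exact τ'.vertex_mem _)) (hreg τ hτ) k
  rw [← Triangle.coef_sub] at h2
  refine (abs_sub_le _ (τ.coef k (G τ')) _).trans ((add_le_add h2 h1).trans ?_)
  have h3 := mul_le_mul_of_nonneg_left (T.diam_le_meshSize hτ)
    (by positivity : 0 ≤ lam * L * diam τ.carrier)
  nlinarith

lemma abs_sub_vertices_le {w : Plane → ℝ} {g : Plane} {d : ℝ}
    (hw : ∀ x ∈ τ.carrier, w x = inner ℝ g x + d) (k : Fin 3) :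
    |w (τ.a (k + 2)) - w (τ.a (k + 1))| ≤ ‖g‖ * diam τ.carrier := by
  have : w (τ.a (k + 2)) - w (τ.a (k + 1)) = inner ℝ g (τ.vec k) := by
    rw [hw _ (τ.vertex_mem _), hw _ (τ.vertex_mem _), Triangle.vec, inner_sub_right]; ring
  rw [this]
  exact (abs_real_inner_le_norm _ _).trans
    (mul_le_mul_of_nonneg_left (τ.norm_vec_le k) (norm_nonneg _))

/-- The increments of `w` are opposite on the two half-edges, leaving a difference of coefficients.
It carries one factor `diam` and the increment `‖g‖ * diam` another; their product is absorbed into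
the area. -/
lemma abs_sum_edge_le_of_edgesClose {e : Sym2 Plane} (he : e ∈ T.interiorEdges) {lam K L δ : ℝ}
    (hlam : 1 ≤ lam) (hreg : ∀ τ ∈ T.elems, diam τ.carrier ^ 2 ≤ lam * τ.det)
    {G : Triangle → Fin 2 → Plane}
    (hK : 0 ≤ K) (hG : ∀ τ ∈ T.elems, ∀ i, ‖G τ i‖ ≤ K) (hL : 0 ≤ L)
    (hGL : ∀ τ ∈ T.elems, ∀ τ' ∈ T.elems, ∀ x ∈ τ.carrier, x ∈ τ'.carrier → ∀ i,
      ‖G τ i - G τ' i‖ ≤ L) (hδ : 0 ≤ δ)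
    (hcl : ∀ τ ∈ T.elems, ∀ τ' ∈ T.elems, ∀ k k', τ ≠ τ' → τ.edge k = e → τ'.edge k' = e →
      τ.EdgesClose k τ' k' δ) {w : Plane → ℝ} {g : Triangle → Plane}
    {d : Triangle → ℝ} (hg : ∀ τ ∈ T.elems, ∀ x ∈ τ.carrier, w x = inner ℝ (g τ) x + d τ) :
    |∑ b ∈ T.halfEdges with b.1.edge b.2 = e,
      b.1.coef b.2 (G b.1) * (w (b.1.a (b.2 + 2)) - w (b.1.a (b.2 + 1)))| ≤
      (16 * lam ^ 5 * K * δ + lam ^ 2 * L * T.meshSize) *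
        ∑ b ∈ T.halfEdges with b.1.edge b.2 = e, b.1.det * ‖g b.1‖ := by
  obtain ⟨b, hb, b', hb', hne, h, h', o1, o2, hall⟩ := T.exists_pair he
  rw [T.sum_filter_edge_eq _ hb hb' hne h h' hall, T.sum_filter_edge_eq _ hb hb' hne h h' hall]
  rw [mem_halfEdges] at hb hb'
  have hh : 0 ≤ T.meshSize := diam_nonneg.trans (T.diam_le_meshSize hb)
  have e1 : b.1.coef b.2 (G b.1) * (w (b.1.a (b.2 + 2)) - w (b.1.a (b.2 + 1))) +
      b'.1.coef b'.2 (G b'.1) * (w (b'.1.a (b'.2 + 2)) - w (b'.1.a (b'.2 + 1))) =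
      (b.1.coef b.2 (G b.1) - b'.1.coef b'.2 (G b'.1)) *
        (w (b.1.a (b.2 + 2)) - w (b.1.a (b.2 + 1))) := by
    rw [o1, o2]; ring
  rw [e1, abs_mul]
  have h1 := T.abs_coef_sub_le hb hb' hne (h.trans h'.symm) hlam hreg hK hG hL hGL
    (hcl _ hb _ hb' _ _ hne h h')
  have h2 := abs_sub_vertices_le (hg _ hb) b.2
  have h3 := hreg _ hb
  have h4 : 0 ≤ b'.1.det * ‖g b'.1‖ := mul_nonneg b'.1.det_pos.le (norm_nonneg _)
  calc _ ≤ ((16 * lam ^ 4 * K * δ + lam * L * T.meshSize) * diam b.1.carrier) *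
        (‖g b.1‖ * diam b.1.carrier) := mul_le_mul h1 h2 (abs_nonneg _)
          (by positivity)
    _ = (16 * lam ^ 4 * K * δ + lam * L * T.meshSize) * (diam b.1.carrier ^ 2 * ‖g b.1‖) := by ring
    _ ≤ (16 * lam ^ 4 * K * δ + lam * L * T.meshSize) * (lam * b.1.det * ‖g b.1‖) := by gcongr
    _ = (16 * lam ^ 5 * K * δ + lam ^ 2 * L * T.meshSize) * (b.1.det * ‖g b.1‖) := by ring
    _ ≤ _ := mul_le_mul_of_nonneg_left (by linarith) (by positivity)

lemma abs_coef_mul_sub_le {b : Triangle × Fin 3} (hb : b ∈ T.halfEdges) {lam K : ℝ} (hlam : 1 ≤ lam)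
    (hreg : ∀ τ ∈ T.elems, diam τ.carrier ^ 2 ≤ lam * τ.det) {G : Triangle → Fin 2 → Plane}
    (hK : 0 ≤ K) (hG : ∀ τ ∈ T.elems, ∀ i, ‖G τ i‖ ≤ K) {w : Plane → ℝ} {g : Triangle → Plane}
    {d : Triangle → ℝ} (hg : ∀ τ ∈ T.elems, ∀ x ∈ τ.carrier, w x = inner ℝ (g τ) x + d τ) :
    |b.1.coef b.2 (G b.1) * (w (b.1.a (b.2 + 2)) - w (b.1.a (b.2 + 1)))| ≤
      lam ^ 2 * K * T.meshSize * (b.1.det * ‖g b.1‖) := by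
  rw [mem_halfEdges] at hb
  have h1 := b.1.abs_coef_le hK (hG _ hb) (hreg _ hb) b.2
  have h2 := abs_sub_vertices_le (hg _ hb) b.2
  have h3 := hreg _ hb
  rw [abs_mul]
  have hh : 0 ≤ T.meshSize := diam_nonneg.trans (T.diam_le_meshSize hb)
  calc _ ≤ (lam * K * diam b.1.carrier ^ 2) * (‖g b.1‖ * diam b.1.carrier) :=
        mul_le_mul h1 h2 (abs_nonneg _) (by positivity)
    _ ≤ (lam * K * (lam * b.1.det)) * (‖g b.1‖ * T.meshSize) := by
        have := T.diam_le_meshSize hb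
        have := b.1.det_pos.le
        gcongr
    _ = _ := by ring

lemma sum_filter_edge_fst (e : Sym2 Plane) (F : Triangle → ℝ) [DecidablePred fun τ : Triangle => ∃ k, τ.edge k = e]
    [DecidablePred fun b : Triangle × Fin 3 => b.1.edge b.2 = e] :
    ∑ b ∈ T.halfEdges with b.1.edge b.2 = e, F b.1 =
      ∑ τ ∈ T.elems with ∃ k, τ.edge k = e, F τ := by
  refine Finset.sum_bij (fun b _ => b.1) ?_ ?_ ?_ fun _ _ => rfl
  · intro b hb
    rw [Finset.mem_filter, mem_halfEdges] at hb
    exact Finset.mem_filter.2 ⟨hb.1, b.2, hb.2⟩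
  · intro b hb b' hb' h
    rw [Finset.mem_filter] at hb hb'
    obtain ⟨τ, k⟩ := b
    obtain ⟨τ', k'⟩ := b'
    obtain rfl : τ = τ' := h
    exact Prod.ext rfl (τ.edge_injective (hb.2.trans hb'.2.symm))
  · intro τ hτ
    obtain ⟨hτ, k, hk⟩ := Finset.mem_filter.1 hτ
    exact ⟨(τ, k), Finset.mem_filter.2 ⟨T.mem_halfEdges.2 hτ, hk⟩, rfl⟩

open Classical in
lemma sum_edges_fst_le (E : Finset (Sym2 Plane)) {F : Triangle → ℝ} (hF : ∀ τ, 0 ≤ F τ) :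
    ∑ e ∈ E, ∑ b ∈ T.halfEdges with b.1.edge b.2 = e, F b.1 ≤ 3 * ∑ τ ∈ T.elems, F τ := by
  rw [Finset.sum_fiberwise_eq_sum_filter]
  refine (Finset.sum_le_sum_of_subset_of_nonneg (Finset.filter_subset _ _) fun b _ _ => hF b.1).trans ?_
  rw [halfEdges, Finset.sum_product, Finset.mul_sum]
  simp

open Classical in
-- Cauchy–Schwarz with area weights: one factor is the area attached to the exceptional edges, the
-- other the full `L²` norm, each triangle being counted at most three times.
lemma sum_edges_det_mul_norm_le (hΩ : IsLipschitzPolygon Ω) {E : Finset (Sym2 Plane)} {A : ℝ}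
    (hA : ∑ e ∈ E, ∑ τ ∈ T.elems with ∃ k, τ.edge k = e, volume.real τ.carrier ≤ A)
    {w : Plane → ℝ} {g : Triangle → Plane}
    {d : Triangle → ℝ} (hg : ∀ τ ∈ T.elems, ∀ x ∈ τ.carrier, w x = inner ℝ (g τ) x + d τ) :
    ∑ e ∈ E, ∑ b ∈ T.halfEdges with b.1.edge b.2 = e, b.1.det * ‖g b.1‖ ≤
      4 * √A * l2Norm Ω (curl w) := by
  have hQ : 0 ≤ l2Norm Ω (curl w) := ENNReal.toReal_nonneg
  simp_rw [← T.sum_filter_edge_fst] at hA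
  rw [Finset.sum_fiberwise_eq_sum_filter] at hA ⊢
  set S := T.halfEdges.filter fun b => b.1.edge b.2 ∈ E with hS
  have h1 : ∑ b ∈ S, b.1.det ≤ 2 * A := by
    refine le_trans (le_of_eq ?_) (mul_le_mul_of_nonneg_left hA two_pos.le)
    rw [Finset.mul_sum]
    refine Finset.sum_congr rfl fun b _ => ?_
    rw [b.1.volume_real_carrier]; ring
  have hA0 : 0 ≤ A := by
    have : 0 ≤ ∑ b ∈ S, b.1.det := Finset.sum_nonneg fun b _ => b.1.det_pos.le
    linarith
  have h4 : ∑ b ∈ S, b.1.det * ‖g b.1‖ ^ 2 ≤ 6 * l2Norm Ω (curl w) ^ 2 := by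
    have := T.sum_edges_fst_le E (F := fun τ => τ.det * ‖g τ‖ ^ 2)
      fun τ => mul_nonneg τ.det_pos.le (sq_nonneg _)
    rw [Finset.sum_fiberwise_eq_sum_filter, T.sum_det_mul_norm_sq hΩ hg] at this
    linarith
  have h2 := Finset.sum_mul_sq_le_sq_mul_sq S (fun b => √b.1.det) (fun b => √b.1.det * ‖g b.1‖)
  have h3 : ∀ τ : Triangle, √τ.det ^ 2 = τ.det := fun τ => Real.sq_sqrt τ.det_pos.le
  simp only [mul_pow, h3, ← mul_assoc, Real.mul_self_sqrt (Triangle.det_pos _).le] at h2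
  refine abs_le_of_sq_le_sq' ?_ (by positivity) |>.2
  rw [mul_pow, mul_pow, Real.sq_sqrt hA0]
  have h5 : (∑ b ∈ S, b.1.det) * ∑ b ∈ S, b.1.det * ‖g b.1‖ ^ 2 ≤
      2 * A * (6 * l2Norm Ω (curl w) ^ 2) :=
    mul_le_mul h1 h4 (Finset.sum_nonneg fun b _ => mul_nonneg b.1.det_pos.le (sq_nonneg _))
      (by positivity)
  nlinarith [mul_nonneg hA0 (sq_nonneg (l2Norm Ω (curl w)))]

open Classical in
/-- The contribution of the interior edges. -/
lemma abs_sum_interior_le (hΩ : IsLipschitzPolygon Ω) {lam K L δ A : ℝ}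
    (hlam : 1 ≤ lam) (hreg : ∀ τ ∈ T.elems, diam τ.carrier ^ 2 ≤ lam * τ.det)
    {G : Triangle → Fin 2 → Plane}
    (hK : 0 ≤ K) (hG : ∀ τ ∈ T.elems, ∀ i, ‖G τ i‖ ≤ K) (hL : 0 ≤ L)
    (hGL : ∀ τ ∈ T.elems, ∀ τ' ∈ T.elems, ∀ x ∈ τ.carrier, x ∈ τ'.carrier → ∀ i,
      ‖G τ i - G τ' i‖ ≤ L) (hδ : 0 ≤ δ) {E₁ E₂ : Finset (Sym2 Plane)} (hdisj : Disjoint E₁ E₂)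
    (hE : ((E₁ ∪ E₂ : Finset _) : Set _) = T.interiorEdges)
    (hcl : ∀ e ∈ E₁, ∀ τ ∈ T.elems, ∀ τ' ∈ T.elems, ∀ k k', τ ≠ τ' → τ.edge k = e →
      τ'.edge k' = e → τ.EdgesClose k τ' k' δ)
    (hA : ∑ e ∈ E₂, ∑ τ ∈ T.elems with ∃ k, τ.edge k = e, volume.real τ.carrier ≤ A)
    {w : Plane → ℝ} {g : Triangle → Plane}
    {d : Triangle → ℝ} (hg : ∀ τ ∈ T.elems, ∀ x ∈ τ.carrier, w x = inner ℝ (g τ) x + d τ) :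
    |∑ e ∈ E₁ ∪ E₂, ∑ b ∈ T.halfEdges with b.1.edge b.2 = e,
      b.1.coef b.2 (G b.1) * (w (b.1.a (b.2 + 2)) - w (b.1.a (b.2 + 1)))| ≤
      ((16 * lam ^ 5 * K * δ + lam ^ 2 * L * T.meshSize) * (6 * √(volume.real Ω)) +
        lam ^ 2 * K * T.meshSize * (4 * √A)) * l2Norm Ω (curl w) := by
  have hh := (T.meshSize_pos hΩ).le
  rw [Finset.sum_union hdisj, add_mul]
  refine (abs_add_le _ _).trans (add_le_add ?_ ?_)
  · have h1 := fun e (he : e ∈ E₁) => T.abs_sum_edge_le_of_edgesClose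
      (hE.subset (Finset.mem_coe.2 (Finset.mem_union_left _ he))) hlam hreg hK hG hL hGL hδ
      (hcl e he) hg
    refine (Finset.abs_sum_le_sum_abs _ _).trans ((Finset.sum_le_sum h1).trans ?_)
    rw [← Finset.mul_sum]
    have h2 := (T.sum_edges_fst_le E₁ (F := fun τ => τ.det * ‖g τ‖)
      fun τ => mul_nonneg τ.det_pos.le (norm_nonneg _)).trans
      (mul_le_mul_of_nonneg_left (T.sum_det_mul_norm_le hΩ hg) (by norm_num))
    exact (mul_le_mul_of_nonneg_left h2 (by positivity)).trans_eq (by ring)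
  · refine (Finset.abs_sum_le_sum_abs _ _).trans ((Finset.sum_le_sum fun e _ =>
      (Finset.abs_sum_le_sum_abs _ _).trans (Finset.sum_le_sum fun b hb =>
        T.abs_coef_mul_sub_le (Finset.mem_filter.1 hb).1 hlam hreg hK hG hg)).trans ?_)
    simp_rw [← Finset.mul_sum]
    exact (mul_le_mul_of_nonneg_left (T.sum_edges_det_mul_norm_le hΩ hA hg)
      (by positivity)).trans_eq (by ring)

end Triangulation

/-! ### Boundary edges -/

namespace Triangulation

variable {Ω : Set Plane} (T : Triangulation Ω) {τ τ' : Triangle}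

open Classical in
/-- The incidence number of a vertex and an oriented edge. -/
def incidence (x : Plane) (b : Triangle × Fin 3) : ℝ :=
  (if b.1.a (b.2 + 2) = x then 1 else 0) - (if b.1.a (b.2 + 1) = x then 1 else 0)

open Classical in
lemma sum_incidence_mul {V : Finset Plane} {b : Triangle × Fin 3} (h1 : b.1.a (b.2 + 1) ∈ V)
    (h2 : b.1.a (b.2 + 2) ∈ V) (W : Plane → ℝ) :
    ∑ x ∈ V, incidence x b * W x = W (b.1.a (b.2 + 2)) - W (b.1.a (b.2 + 1)) := by
  simp [incidence, sub_mul, Finset.sum_sub_distrib, h1, h2]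

lemma incidence_eq_zero {x : Plane} {b : Triangle × Fin 3} (h : x ∉ b.1.edge b.2) :
    incidence x b = 0 := by
  rw [Triangle.edge, Sym2.mem_iff, not_or] at h
  rw [incidence, if_neg (Ne.symm h.1), if_neg (Ne.symm h.2), sub_zero]

lemma abs_incidence_le_one (x : Plane) (b : Triangle × Fin 3) : |incidence x b| ≤ 1 := by
  unfold incidence; split_ifs <;> norm_num

open Classical in
lemma sum_abs_incidence_le (V : Finset Plane) (b : Triangle × Fin 3) :
    ∑ x ∈ V, |incidence x b| ≤ 2 := by
  calc ∑ x ∈ V, |incidence x b| ≤ ∑ x ∈ V, ((if b.1.a (b.2 + 2) = x then 1 else 0) +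
        (if b.1.a (b.2 + 1) = x then (1 : ℝ) else 0)) := by
        refine Finset.sum_le_sum fun x _ => ?_
        unfold incidence; split_ifs <;> norm_num
    _ ≤ 2 := by
        rw [Finset.sum_add_distrib, Finset.sum_ite_eq, Finset.sum_ite_eq]
        split_ifs <;> norm_num

lemma sum_incidence_eq_zero (x : Plane) : ∑ b ∈ T.boundaryHalfEdges, incidence x b = 0 := by
  classical
  exact T.sum_boundary_sub_eq_zero fun y => if y = x then 1 else 0

lemma mem_carrier_of_mem_edge {x : Plane} {b : Triangle × Fin 3} (h : x ∈ b.1.edge b.2) :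
    x ∈ b.1.carrier := by
  rw [Triangle.edge, Sym2.mem_iff] at h
  rcases h with rfl | rfl <;> exact b.1.vertex_mem _

lemma mem_halfEdges_of_boundary {b : Triangle × Fin 3} (hb : b ∈ T.boundaryHalfEdges) :
    b.1 ∈ T.elems := (T.mem_boundaryHalfEdges.1 hb).1

lemma mem_boundaryVertices (hΩ : IsLipschitzPolygon Ω) {b : Triangle × Fin 3}
    (hb : b ∈ T.boundaryHalfEdges) : b.1.a (b.2 + 1) ∈ T.boundaryVertices ∧
      b.1.a (b.2 + 2) ∈ T.boundaryVertices := by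
  have h := T.edgeSet_subset_frontier hb hΩ.isOpen
  exact ⟨⟨h (left_mem_segment ℝ _ _), b.1, T.mem_halfEdges_of_boundary hb, _, rfl⟩,
    ⟨h (right_mem_segment ℝ _ _), b.1, T.mem_halfEdges_of_boundary hb, _, rfl⟩⟩

open Classical in
lemma card_boundary_filter_le {lam : ℝ} (hlam : 0 ≤ lam)
    (hreg : ∀ τ ∈ T.elems, diam τ.carrier ^ 2 ≤ lam * τ.det) (x : Plane) :
    ((T.boundaryHalfEdges.filter fun b => x ∈ b.1.carrier).card : ℝ) ≤ 24 * lam := by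
  have hsub : T.boundaryHalfEdges.filter (fun b => x ∈ b.1.carrier) ⊆
      (T.elems.filter fun τ => x ∈ τ.carrier) ×ˢ (Finset.univ : Finset (Fin 3)) := by
    intro b hb
    rw [Finset.mem_filter] at hb
    simp [T.mem_halfEdges_of_boundary hb.1, hb.2]
  have h1 : ((T.boundaryHalfEdges.filter fun b => x ∈ b.1.carrier).card : ℝ) ≤
      (T.elems.filter fun τ => x ∈ τ.carrier).card * 3 := by
    have := Finset.card_le_card hsub
    rw [Finset.card_product, Finset.card_univ, Fintype.card_fin] at this
    exact_mod_cast this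
  have h2 : ((T.elems.filter fun τ => x ∈ τ.carrier).card : ℝ) ≤ 8 * lam := by
    convert T.card_filter_mem_le hlam hreg x
  linarith

lemma sum_diam_boundary_le (hΩ : IsLipschitzPolygon Ω) {lam : ℝ} (hlam : 0 ≤ lam)
    (hreg : ∀ τ ∈ T.elems, diam τ.carrier ^ 2 ≤ lam * τ.det) :
    ∑ b ∈ T.boundaryHalfEdges, diam b.1.carrier ≤
      lam * (Measure.hausdorffMeasure 1 (frontier Ω)).toReal := by
  refine le_trans ?_ (mul_le_mul_of_nonneg_left (T.sum_len_boundary_le hΩ) hlam)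
  rw [Finset.mul_sum]
  exact Finset.sum_le_sum fun b hb =>
    b.1.diam_le_len (hreg _ (T.mem_halfEdges_of_boundary hb)) hlam b.2

/-- The incidence numbers at `x` add up to zero, so the coefficient of one fixed boundary edge at
`x` can be subtracted from all. This works whatever the number of boundary edges at `x`. -/
lemma abs_sum_incidence_le_of_close (hΩ : IsLipschitzPolygon Ω) {lam K L δ η : ℝ}
    (hlam : 1 ≤ lam) (hreg : ∀ τ ∈ T.elems, diam τ.carrier ^ 2 ≤ lam * τ.det)
    {G : Triangle → Fin 2 → Plane}
    (hK : 0 ≤ K) (hG : ∀ τ ∈ T.elems, ∀ i, ‖G τ i‖ ≤ K) (hL : 0 ≤ L)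
    (hGL : ∀ τ ∈ T.elems, ∀ τ' ∈ T.elems, ∀ x ∈ τ.carrier, x ∈ τ'.carrier → ∀ i,
      ‖G τ i - G τ' i‖ ≤ L) (hδ : 0 ≤ δ) (hη : 0 ≤ η) {x : Plane}
    (hx : ∀ τ ∈ T.elems, ∀ τ' ∈ T.elems, ∀ k k',
      τ.edgeSet k ⊆ frontier Ω → τ'.edgeSet k' ⊆ frontier Ω → x ∈ τ.edge k → x ∈ τ'.edge k' →
      τ.edge k ≠ τ'.edge k' →
        τ.EdgesClose k τ' k' δ ∧ ‖τ.tangent k - τ'.tangent k'‖ ≤ η) :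
    |∑ b ∈ T.boundaryHalfEdges, b.1.coef b.2 (G b.1) * incidence x b| ≤
      ∑ b ∈ T.boundaryHalfEdges, |incidence x b| *
        (lam * L * T.meshSize * diam b.1.carrier + 16 * lam ^ 3 * K * T.meshSize *
          (δ + T.meshSize * η)) := by
  have hh := (T.meshSize_pos hΩ).le
  by_cases hex : ∃ b ∈ T.boundaryHalfEdges, x ∈ b.1.edge b.2
  · obtain ⟨b₀, hb₀, hx₀⟩ := hex
    have e1 : ∑ b ∈ T.boundaryHalfEdges, b.1.coef b.2 (G b.1) * incidence x b =
        ∑ b ∈ T.boundaryHalfEdges,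
          (b.1.coef b.2 (G b.1) - b₀.1.coef b₀.2 (G b₀.1)) * incidence x b := by
      simp_rw [sub_mul]
      rw [Finset.sum_sub_distrib, ← Finset.mul_sum, T.sum_incidence_eq_zero, mul_zero, sub_zero]
    rw [e1]
    refine (Finset.abs_sum_le_sum_abs _ _).trans (Finset.sum_le_sum fun b hb => ?_)
    rw [abs_mul, mul_comm]
    by_cases hxb : x ∈ b.1.edge b.2
    swap
    · rw [incidence_eq_zero hxb]; simp
    refine mul_le_mul_of_nonneg_left ?_ (abs_nonneg _)
    have hb1 := T.mem_halfEdges_of_boundary hb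
    have hb2 := T.mem_halfEdges_of_boundary hb₀
    by_cases hbb : b = b₀
    · rw [hbb, sub_self, abs_zero]; positivity
    obtain ⟨hcl, ht⟩ := hx _ hb1 _ hb2 b.2 b₀.2 (T.edgeSet_subset_frontier hb hΩ.isOpen)
      (T.edgeSet_subset_frontier hb₀ hΩ.isOpen) hxb hx₀ fun h =>
        hbb (T.eq_of_edge_eq hb₀ (T.mem_halfEdges.2 hb1) h)
    have h1 := Triangle.abs_coef_sub_coef_le (η := η) (ς := 1) hK (hG _ hb2) hlam (hreg _ hb1)
      (hreg _ hb2) (T.diam_le_meshSize hb1) (T.diam_le_meshSize hb2) (Or.inl rfl) hcl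
      (by rwa [one_smul])
    have h2 := b.1.abs_coef_le hL (g := fun i => G b.1 i - G b₀.1 i)
      (hGL _ hb1 _ hb2 x (mem_carrier_of_mem_edge hxb) (mem_carrier_of_mem_edge hx₀))
      (hreg _ hb1) b.2
    rw [← Triangle.coef_sub] at h2
    refine (abs_sub_le _ (b.1.coef b.2 (G b₀.1)) _).trans (add_le_add (h2.trans ?_) h1)
    have h3 := mul_le_mul_of_nonneg_left (T.diam_le_meshSize hb1)
      (by positivity : 0 ≤ lam * L * diam b.1.carrier)
    nlinarith
  · push Not at hex
    rw [Finset.sum_eq_zero fun b hb => by rw [incidence_eq_zero (hex b hb), mul_zero], abs_zero]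
    exact Finset.sum_nonneg fun b _ => by positivity

/-- At an exceptional vertex there is no cancellation; the bounded number of half-edges at a point
and the size of each coefficient suffice. -/
lemma abs_sum_incidence_le {lam K : ℝ} (hlam : 0 ≤ lam)
    (hreg : ∀ τ ∈ T.elems, diam τ.carrier ^ 2 ≤ lam * τ.det) {G : Triangle → Fin 2 → Plane}
    (hK : 0 ≤ K) (hG : ∀ τ ∈ T.elems, ∀ i, ‖G τ i‖ ≤ K) (x : Plane) :
    |∑ b ∈ T.boundaryHalfEdges, b.1.coef b.2 (G b.1) * incidence x b| ≤
      24 * lam ^ 2 * K * T.meshSize ^ 2 := by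
  classical
  have e1 : ∑ b ∈ T.boundaryHalfEdges, b.1.coef b.2 (G b.1) * incidence x b =
      ∑ b ∈ T.boundaryHalfEdges with x ∈ b.1.carrier, b.1.coef b.2 (G b.1) * incidence x b := by
    refine (Finset.sum_filter_of_ne fun b _ h => ?_).symm
    by_contra hx
    exact h (by rw [incidence_eq_zero fun h' => hx (mem_carrier_of_mem_edge h'), mul_zero])
  rw [e1]
  have h1 : ∀ b ∈ T.boundaryHalfEdges.filter fun b => x ∈ b.1.carrier,
      |b.1.coef b.2 (G b.1) * incidence x b| ≤ lam * K * T.meshSize ^ 2 := by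
    intro b hb
    have hb1 := T.mem_halfEdges_of_boundary (Finset.mem_filter.1 hb).1
    rw [abs_mul]
    have h2 := (b.1.abs_coef_le hK (hG _ hb1) (hreg _ hb1) b.2).trans (mul_le_mul_of_nonneg_left
      (pow_le_pow_left₀ diam_nonneg (T.diam_le_meshSize hb1) 2) (by positivity))
    have := mul_le_mul h2 (abs_incidence_le_one x b) (abs_nonneg _) (by positivity)
    linarith
  refine (Finset.abs_sum_le_sum_abs _ _).trans ((Finset.sum_le_card_nsmul _ _ _ h1).trans ?_)
  rw [nsmul_eq_mul]
  refine (mul_le_mul_of_nonneg_right (T.card_boundary_filter_le hlam hreg x)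
    (by positivity)).trans_eq (by ring)

open Classical in
/-- The contribution of the boundary edges. -/
lemma abs_sum_boundary_le (hΩ : IsLipschitzPolygon Ω) {lam K L δ η N Λ : ℝ} {κ : ℕ}
    (hlam : 1 ≤ lam) (hreg : ∀ τ ∈ T.elems, diam τ.carrier ^ 2 ≤ lam * τ.det)
    {G : Triangle → Fin 2 → Plane}
    (hK : 0 ≤ K) (hG : ∀ τ ∈ T.elems, ∀ i, ‖G τ i‖ ≤ K) (hL : 0 ≤ L)
    (hGL : ∀ τ ∈ T.elems, ∀ τ' ∈ T.elems, ∀ x ∈ τ.carrier, x ∈ τ'.carrier → ∀ i,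
      ‖G τ i - G τ' i‖ ≤ L) (hδ : 0 ≤ δ) (hη : 0 ≤ η) (hN : 0 < N)
    (hdiam : ∀ τ ∈ T.elems, N ≤ diam τ.carrier) {P₁ P₂ : Finset Plane} (hdisj : Disjoint P₁ P₂)
    (hP : ((P₁ ∪ P₂ : Finset _) : Set _) = T.boundaryVertices)
    (hx : ∀ x ∈ P₁, ∀ τ ∈ T.elems, ∀ τ' ∈ T.elems, ∀ k k',
      τ.edgeSet k ⊆ frontier Ω → τ'.edgeSet k' ⊆ frontier Ω → x ∈ τ.edge k → x ∈ τ'.edge k' →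
      τ.edge k ≠ τ'.edge k' →
        τ.EdgesClose k τ' k' δ ∧ ‖τ.tangent k - τ'.tangent k'‖ ≤ η) (hκ : P₂.card ≤ κ)
    {w : Plane → ℝ} (hΛ : 0 ≤ Λ)
    (hw : ∀ y ∈ closure Ω, ∀ z ∈ closure Ω, |w y - w z| ≤ Λ) :
    |∑ b ∈ T.boundaryHalfEdges,
      b.1.coef b.2 (G b.1) * (w (b.1.a (b.2 + 2)) - w (b.1.a (b.2 + 1)))| ≤
      (2 * (lam * (Measure.hausdorffMeasure 1 (frontier Ω)).toReal) *
          (lam * L * T.meshSize + 16 * lam ^ 3 * K * T.meshSize * (δ + T.meshSize * η) / N) +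
        κ * (24 * lam ^ 2 * K * T.meshSize ^ 2)) * Λ := by
  have hh := (T.meshSize_pos hΩ).le
  have hlam0 : 0 ≤ lam := by linarith
  obtain ⟨x₀, hx₀⟩ := hΩ.isConnected.nonempty.closure
  set V := P₁ ∪ P₂ with hV
  have hmem : ∀ y ∈ T.boundaryVertices, y ∈ V := fun y hy => by
    rw [← Finset.mem_coe, hP]; exact hy
  have hVcl : ∀ x ∈ V, x ∈ closure Ω := fun x hx => by
    rw [← Finset.mem_coe, hP] at hx
    exact frontier_subset_closure hx.1
  set s : Plane → ℝ := fun x => ∑ b ∈ T.boundaryHalfEdges, b.1.coef b.2 (G b.1) * incidence x b with hs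
  -- Summation by parts. Subtracting `w x₀` is free because only increments of `w` enter.
  have e1 : ∑ b ∈ T.boundaryHalfEdges,
      b.1.coef b.2 (G b.1) * (w (b.1.a (b.2 + 2)) - w (b.1.a (b.2 + 1))) =
      ∑ x ∈ V, s x * (w x - w x₀) := by
    simp only [hs, Finset.sum_mul]
    rw [Finset.sum_comm]
    refine Finset.sum_congr rfl fun b hb => ?_
    obtain ⟨h1, h2⟩ := T.mem_boundaryVertices hΩ hb
    simp_rw [mul_assoc]
    rw [← Finset.mul_sum, sum_incidence_mul (hmem _ h1) (hmem _ h2)]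
    ring
  have h1 : |∑ x ∈ V, s x * (w x - w x₀)| ≤ (∑ x ∈ V, |s x|) * Λ := by
    rw [Finset.sum_mul]
    refine (Finset.abs_sum_le_sum_abs _ _).trans (Finset.sum_le_sum fun x hxV => ?_)
    rw [abs_mul]
    exact mul_le_mul_of_nonneg_left (hw x (hVcl x hxV) x₀ hx₀) (abs_nonneg _)
  rw [e1]
  refine h1.trans (mul_le_mul_of_nonneg_right ?_ hΛ)
  rw [hV, Finset.sum_union hdisj]
  refine add_le_add ?_ ?_
  · set A := 16 * lam ^ 3 * K * T.meshSize * (δ + T.meshSize * η) with hA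
    have hA0 : 0 ≤ A := by positivity
    calc ∑ x ∈ P₁, |s x| ≤ ∑ x ∈ P₁, ∑ b ∈ T.boundaryHalfEdges, |incidence x b| *
          (lam * L * T.meshSize * diam b.1.carrier + A) :=
          Finset.sum_le_sum fun x hxP =>
            T.abs_sum_incidence_le_of_close hΩ hlam hreg hK hG hL hGL hδ hη (hx x hxP)
      _ = ∑ b ∈ T.boundaryHalfEdges, (∑ x ∈ P₁, |incidence x b|) *
          (lam * L * T.meshSize * diam b.1.carrier + A) := by
          rw [Finset.sum_comm]; simp_rw [Finset.sum_mul]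
      _ ≤ ∑ b ∈ T.boundaryHalfEdges,
          (2 * (lam * L * T.meshSize + A / N)) * diam b.1.carrier := by
          refine Finset.sum_le_sum fun b hb => ?_
          -- Trades the number of boundary edges for their total length: each diameter is at least
          -- `N`, and the diameters sum to a multiple of the length of the boundary. Here the loss
          -- `h ^ (-γ)` enters.
          have hA1 : A ≤ A / N * diam b.1.carrier := by
            rw [div_mul_eq_mul_div, le_div_iff₀ hN]
            exact mul_le_mul_of_nonneg_left (hdiam _ (T.mem_halfEdges_of_boundary hb)) hA0
          have hd : 0 ≤ diam b.1.carrier := diam_nonneg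
          calc _ ≤ 2 * (lam * L * T.meshSize * diam b.1.carrier + A) :=
                mul_le_mul_of_nonneg_right (sum_abs_incidence_le _ _) (by positivity)
            _ ≤ 2 * (lam * L * T.meshSize * diam b.1.carrier + A / N * diam b.1.carrier) := by
                gcongr
            _ = _ := by ring
      _ ≤ (2 * (lam * L * T.meshSize + A / N)) *
          (lam * (Measure.hausdorffMeasure 1 (frontier Ω)).toReal) := by
          rw [← Finset.mul_sum]
          exact mul_le_mul_of_nonneg_left (T.sum_diam_boundary_le hΩ hlam0 hreg) (by positivity)
      _ = _ := by ring
  · refine (Finset.sum_le_card_nsmul _ _ _ fun x _ =>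
      T.abs_sum_incidence_le hlam0 hreg hK hG x).trans ?_
    rw [nsmul_eq_mul]
    gcongr

end Triangulation

/-! ### The superconvergence estimate -/

/-- Since `h ≤ h₀ < 1`, constants are bounded by multiples of `|log h|`, and `log (1 / h ^ γ)` is `γ
* |log h|`. -/
lemma sqrt_one_add_log_le {γ a h h₀ : ℝ} (ha : 1 ≤ a) (hγ : 0 ≤ γ) (hh : 0 < h) (hhh : h ≤ h₀)
    (hh₀ : h₀ < 1) :
    √(1 + Real.log (a / h ^ γ)) ≤
      √((1 + Real.log a) / |Real.log h₀| + γ) * |Real.log h| ^ (1 / 2 : ℝ) := by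
  have hlog : Real.log h ≤ Real.log h₀ := Real.log_le_log hh hhh
  have hlog₀ : Real.log h₀ < 0 := Real.log_neg (hh.trans_le hhh) hh₀
  have hloga := Real.log_nonneg ha
  rw [← Real.sqrt_eq_rpow, ← Real.sqrt_mul (by positivity)]
  refine Real.sqrt_le_sqrt ?_
  rw [Real.log_div (by positivity) (by positivity), Real.log_rpow hh, abs_of_neg hlog₀,
    abs_of_neg (hlog.trans_lt hlog₀), add_mul]
  have : 1 + Real.log a ≤ (1 + Real.log a) / -Real.log h₀ * -Real.log h := by
    rw [div_mul_eq_mul_div, le_div_iff₀ (by linarith)]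
    exact mul_le_mul_of_nonneg_left (by linarith) (by linarith)
  linarith

lemma one_le_sqrt_inv_mul {h h₀ : ℝ} (hh : 0 < h) (hhh : h ≤ h₀) (hh₀ : h₀ < 1) :
    1 ≤ (√|Real.log h₀|)⁻¹ * |Real.log h| ^ (1 / 2 : ℝ) := by
  have hlog₀ : Real.log h₀ < 0 := Real.log_neg (hh.trans_le hhh) hh₀
  rw [← Real.sqrt_eq_rpow, inv_mul_eq_div, le_div_iff₀ (Real.sqrt_pos.2 (abs_pos.2 hlog₀.ne)),
    one_mul]
  refine Real.sqrt_le_sqrt ?_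
  have := Real.log_le_log hh hhh
  rw [abs_of_neg hlog₀, abs_of_neg (this.trans_lt hlog₀)]
  linarith

/-- The four error sizes `h ^ 2`, `h ^ (1 + α)`, `h ^ (1 + σ / 2)` and `h ^ (2 + α - γ)`. The second
is dominated because `1 ≤ γ` makes the exponent at most `1 + α`. -/
lemma rpow_mesh_bounds {α σ γ c M h : ℝ} (hγ : 1 ≤ γ) (hc : 0 < c) (hh0 : 0 < h) (hh1 : h ≤ 1) :
    h ^ 2 ≤ h ^ (1 + min 1 (min (1 + α - γ) (σ / 2))) ∧
    h ^ (1 + α) ≤ h ^ (1 + min 1 (min (1 + α - γ) (σ / 2))) ∧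
    h * √(|M| * h ^ σ) ≤ √|M| * h ^ (1 + min 1 (min (1 + α - γ) (σ / 2))) ∧
    h * h ^ (1 + α) / (c * h ^ γ) ≤ h ^ (1 + min 1 (min (1 + α - γ) (σ / 2))) / c := by
  set ρ := min 1 (min (1 + α - γ) (σ / 2)) with hρ
  have hρ1 : ρ ≤ 1 := min_le_left _ _
  have hρ2 : ρ ≤ 1 + α - γ := (min_le_right _ _).trans (min_le_left _ _)
  have hρ3 : ρ ≤ σ / 2 := (min_le_right _ _).trans (min_le_right _ _)
  have hpow : ∀ t, 1 + ρ ≤ t → h ^ t ≤ h ^ (1 + ρ) := fun t ht =>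
    Real.rpow_le_rpow_of_exponent_ge hh0 hh1 ht
  refine ⟨?_, hpow _ (by linarith), ?_, ?_⟩
  · rw [← Real.rpow_natCast]; exact hpow _ (by push_cast; linarith)
  · have : h * √(|M| * h ^ σ) = √|M| * h ^ (1 + σ / 2) := by
      rw [Real.sqrt_mul (abs_nonneg _), Real.rpow_add hh0, Real.rpow_one,
        Real.sqrt_eq_rpow (h ^ σ), ← Real.rpow_mul hh0.le]
      ring_nf
    rw [this]
    exact mul_le_mul_of_nonneg_left (hpow _ (by linarith)) (Real.sqrt_nonneg _)
  · have : h * h ^ (1 + α) / (c * h ^ γ) = h ^ (2 + α - γ) / c := by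
      rw [mul_comm c, ← div_div, Real.rpow_sub hh0]
      congr 2
      rw [show (2 + α : ℝ) = 1 + (1 + α) by ring, Real.rpow_add hh0 1 (1 + α), Real.rpow_one]
    rw [this]
    exact div_le_div_of_nonneg_right (hpow _ (by linarith)) hc.le

lemma interior_terms_le {lam v m CG K Q P h hα s : ℝ} (hlam : 0 ≤ lam) (hv : 0 ≤ v) (hm : 0 ≤ m)
    (hCG : 0 ≤ CG) (hK : 0 ≤ K) (hQ : 0 ≤ Q) (p1 : h ^ 2 ≤ P) (p2 : hα ≤ P)
    (p3 : h * s ≤ √m * P) :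
    4 * (8 * K) * lam * v * (h ^ 2 * Q) +
      (((16 * lam ^ 5 * (2 * K) * (m * hα) + lam ^ 2 * (CG * K * (2 * h)) * h) * (6 * v) +
        lam ^ 2 * (2 * K) * h * (4 * s)) * Q) ≤
      (32 * lam * v + ((32 * lam ^ 5 * m + 2 * lam ^ 2 * CG) * (6 * v) + 8 * lam ^ 2 * √m)) *
        (P * K * Q) := by
  calc _ = (32 * lam * v * h ^ 2 + ((32 * lam ^ 5 * m * hα + 2 * lam ^ 2 * CG * h ^ 2) *
        (6 * v) + 8 * lam ^ 2 * (h * s))) * (K * Q) := by ring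
    _ ≤ (32 * lam * v * P + ((32 * lam ^ 5 * m * P + 2 * lam ^ 2 * CG * P) *
        (6 * v) + 8 * lam ^ 2 * (√m * P))) * (K * Q) := by gcongr
    _ = _ := by ring

lemma boundary_terms_le {lam m CG CS ℓ κ c K Q P R E h hα hβ N Y : ℝ} (hlam : 0 ≤ lam) (hm : 0 ≤ m)
    (hCG : 0 ≤ CG) (hCS : 0 ≤ CS) (hℓ : 0 ≤ ℓ) (hκ : 0 ≤ κ) (hc : 0 < c) (hK : 0 ≤ K) (hQ : 0 ≤ Q)
    (hP : 0 ≤ P) (hY : 0 ≤ Y) (p1 : h ^ 2 ≤ P) (p4 : h * hα / N ≤ P / c) (p5 : h * hβ = hα)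
    (hYE : Y ≤ E * R) :
    (2 * (lam * ℓ) * (lam * (CG * K * (2 * h)) * h + 16 * lam ^ 3 * (2 * K) * h *
        (m * hα + h * (m * hβ)) / N) + κ * (24 * lam ^ 2 * (2 * K) * h ^ 2)) * (CS * (Q * Y)) ≤
      (2 * (lam * ℓ) * (2 * lam * CG + 64 * lam ^ 3 * m / c) + 48 * κ * lam ^ 2) * CS * E *
        (P * R * K * Q) := by
  have e : 16 * lam ^ 3 * (2 * K) * h * (m * hα + h * (m * hβ)) / N =
      64 * lam ^ 3 * m * K * (h * hα / N) := by
    rw [show h * (m * hβ) = m * (h * hβ) by ring, p5]; ring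
  rw [e]
  calc _ = (2 * (lam * ℓ) * (2 * lam * CG * h ^ 2 + 64 * lam ^ 3 * m * (h * hα / N)) +
        48 * κ * lam ^ 2 * h ^ 2) * CS * (K * Q * Y) := by ring
    _ ≤ (2 * (lam * ℓ) * (2 * lam * CG * P + 64 * lam ^ 3 * m * (P / c)) +
        48 * κ * lam ^ 2 * P) * CS * (K * Q * (E * R)) := by gcongr
    _ = _ := by ring

lemma abs_le_add_of_abs_sub_le {I A B x y z : ℝ} (h : |I - (A + B)| ≤ x) (hA : |A| ≤ y)
    (hB : |B| ≤ z) : |I| ≤ x + y + z := by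
  have h1 := abs_add_le (I - (A + B)) (A + B)
  rw [sub_add_cancel] at h1
  linarith [abs_add_le A B]

/-- Superconvergence of the lowest order Raviart--Thomas interpolant on triangulations of a polygon
that satisfy the `(α,σ)`-condition. -/
theorem IsLipschitzPolygon.exists_superconvergence_bound {Ω : Set Plane} (hΩ : IsLipschitzPolygon Ω)
    (α σ : ℝ) {γ μ c : ℝ} (M : ℝ) {h₀ : ℝ} (κ : ℕ) (hγ : 1 ≤ γ) (hμ : 0 < μ) (hc : 0 < c)
    (hh₀ : h₀ < 1) (hh₀' : 0 < h₀) :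
    ∃ C : ℝ, 0 ≤ C ∧ ∀ T : Triangulation Ω, T.meshSize ≤ h₀ → T.ShapeRegular μ →
      (∀ τ ∈ T.elems, c * T.meshSize ^ γ ≤ diam τ.carrier) → T.AlphaSigmaCondition α σ M κ →
      ∀ p : Plane → Plane, MemW2InfVec Ω p → ∀ r : Plane → Plane, T.IsRTInterpolant p r →
      ∀ w ∈ T.continuousPiecewiseLinear,
        |∫ x in Ω, inner ℝ (p x - r x) (curl w x)| ≤
          C * T.meshSize ^ (1 + min 1 (min (1 + α - γ) (σ / 2))) *
            |Real.log T.meshSize| ^ (1 / 2 : ℝ) * gradNorm1Inf Ω p * l2Norm Ω (curl w) := by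
  obtain ⟨CG, hCG, hfield⟩ := hΩ.exists_gradient_field
  obtain ⟨CS, hCS, hosc⟩ := Triangulation.exists_abs_sub_le_l2Norm_curl hΩ
  set lam : ℝ := 1 + μ ^ 2 with hlam_def
  have hlam : 1 ≤ lam := by nlinarith
  -- Decreasing `c` keeps the lower bound for the diameters and ensures `N < 1`, as the Sobolev
  -- inequality demands.
  set c₁ := min c 1 with hc₁
  have hc₁0 : 0 < c₁ := lt_min hc one_pos
  have hc₁1 : c₁ ≤ 1 := min_le_right _ _
  set ℓ := (Measure.hausdorffMeasure 1 (frontier Ω)).toReal with hℓ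
  have hℓ0 : 0 ≤ ℓ := ENNReal.toReal_nonneg
  set v := √(volume.real Ω) with hv
  set E := (1 + Real.log (16 * lam ^ 2 / c₁)) / |Real.log h₀| + γ with hE
  set a₁ := 32 * lam * v + ((32 * lam ^ 5 * |M| + 2 * lam ^ 2 * CG) * (6 * v) +
    8 * lam ^ 2 * √|M|) with ha₁
  set a₂ := (2 * (lam * ℓ) * (2 * lam * CG + 64 * lam ^ 3 * |M| / c₁) + 48 * κ * lam ^ 2) * CS with ha₂
  have h16 : 1 ≤ 16 * lam ^ 2 / c₁ := by
    rw [le_div_iff₀ hc₁0]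
    linarith [one_le_pow₀ hlam (n := 2)]
  have ha₁0 : 0 ≤ a₁ := by positivity
  have ha₂0 : 0 ≤ a₂ := by positivity
  refine ⟨a₁ * (√|Real.log h₀|)⁻¹ + a₂ * √E, by positivity, ?_⟩
  intro T hmesh hshape hmin hcond p hp r hr w hw
  set h := T.meshSize with hh
  have hh0 : 0 < h := T.meshSize_pos hΩ
  have hh1 : h < 1 := hmesh.trans_lt hh₀
  have hreg : ∀ τ ∈ T.elems, diam τ.carrier ^ 2 ≤ lam * τ.det := fun τ hτ => by
    obtain ⟨x, hx⟩ := hshape τ hτ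
    exact τ.diam_sq_le_of_closedBall hμ hx
  set K := gradNorm1Inf Ω p with hK
  have hK0 : 0 ≤ K := ENNReal.toReal_nonneg
  set Q := l2Norm Ω (curl w) with hQ
  have hQ0 : 0 ≤ Q := ENNReal.toReal_nonneg
  set R := |Real.log h| ^ (1 / 2 : ℝ) with hR
  have hR0 : 0 ≤ R := by positivity
  obtain ⟨p1, p2, p3, p4⟩ := rpow_mesh_bounds (α := α) (σ := σ) (M := M) hγ hc₁0 hh0 hh1.le
  set P := h ^ (1 + min 1 (min (1 + α - γ) (σ / 2))) with hP
  have hP0 : 0 < P := by positivity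
  set N := c₁ * h ^ γ with hN
  have hN0 : 0 < N := by positivity
  have hN1 : N < 1 := by
    have := Real.rpow_lt_one hh0.le hh1 (by linarith : 0 < γ)
    nlinarith [Real.rpow_pos_of_pos hh0 γ]
  have hNd : ∀ τ ∈ T.elems, N ≤ diam τ.carrier := fun τ hτ =>
    (mul_le_mul_of_nonneg_right (min_le_left _ _) (by positivity)).trans (hmin τ hτ)
  have p5 : h * h ^ α = h ^ (1 + α) := by rw [Real.rpow_add hh0, Real.rpow_one]
  obtain ⟨G, hG1, hG2, hG3⟩ := hfield p hp
  have hGK : ∀ τ ∈ T.elems, ∀ i, ‖G τ.centroid i‖ ≤ 2 * K := fun τ _ i => hG1 _ i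
  have hGL : ∀ τ ∈ T.elems, ∀ τ' ∈ T.elems, ∀ x ∈ τ.carrier, x ∈ τ'.carrier → ∀ i,
      ‖G τ.centroid i - G τ'.centroid i‖ ≤ CG * K * (2 * h) := fun τ hτ τ' hτ' x hx hx' i =>
    (hG2 _ (T.interior_subset hΩ hτ' τ'.centroid_mem_interior) _
      (T.interior_subset hΩ hτ τ.centroid_mem_interior) i).trans
      (mul_le_mul_of_nonneg_left (T.norm_centroid_sub_le hτ hτ' hx hx') (by positivity))
  have hw' := hw
  obtain ⟨hwc, hwa⟩ := hw'
  choose! g d hg using hwa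
  obtain ⟨⟨E₁, E₂, hEd, hEu, hE1, hE2⟩, P₁, P₂, hPd, hPu, hP1, hP2⟩ := hcond
  -- `M` may be negative, while the estimates need nonnegative tolerances.
  have hMle : ∀ t : ℝ, M * h ^ t ≤ |M| * h ^ t := fun t =>
    mul_le_mul_of_nonneg_right (le_abs_self M) (by positivity)
  have b1 := T.abs_integral_sub_sum_halfEdges_le hΩ (lam := lam) (by positivity)
    (by positivity : 0 ≤ 8 * K) hreg hp.1 hG3 hr hg
  have b2 := T.abs_sum_interior_le hΩ (G := fun τ => G τ.centroid) hlam hreg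
    (by positivity : 0 ≤ 2 * K) hGK (by positivity : 0 ≤ CG * K * (2 * h)) hGL
    (by positivity : 0 ≤ |M| * h ^ (1 + α)) hEd hEu
    (fun e he τ hτ τ' hτ' k k' h1 h2 h3 j => (hE1 e he τ hτ τ' hτ' k k' h1 h2 h3 j).trans (hMle _))
    (hE2.trans (hMle _)) hg
  have b3 := T.abs_sum_boundary_le hΩ (G := fun τ => G τ.centroid) hlam hreg
    (by positivity : 0 ≤ 2 * K) hGK (by positivity : 0 ≤ CG * K * (2 * h)) hGL
    (by positivity : 0 ≤ |M| * h ^ (1 + α)) (by positivity : 0 ≤ |M| * h ^ α) hN0 hNd hPd hPu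
    (fun x hx τ hτ τ' hτ' k k' h1 h2 h3 h4 h5 => by
      obtain ⟨q1, q2⟩ := hP1 x hx τ hτ τ' hτ' k k' h1 h2 h3 h4 h5
      exact ⟨fun j => (q1 j).trans (hMle _), q2.trans (hMle _)⟩) hP2
    (by positivity) (hosc T lam N hlam hreg hN0 hN1 hNd w hw)
  have hsum := T.sum_halfEdges_eq hEu
    (fun b => b.1.coef b.2 (G b.1.centroid) * (w (b.1.a (b.2 + 2)) - w (b.1.a (b.2 + 1))))
  rw [hsum] at b1
  have htri := abs_le_add_of_abs_sub_le b1 b2 b3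
  have c1 := interior_terms_le (zero_le_one.trans hlam : 0 ≤ lam) (Real.sqrt_nonneg _ : 0 ≤ v) (abs_nonneg M)
    hCG hK0 hQ0 p1 p2 p3
  have hlog : √(1 + Real.log (16 * lam ^ 2 / N)) ≤ √E * R := by
    rw [hN, ← div_div]
    exact sqrt_one_add_log_le h16 (zero_le_one.trans hγ) hh0 hmesh hh₀
  have c2 := boundary_terms_le (zero_le_one.trans hlam : 0 ≤ lam) (abs_nonneg M) hCG hCS hℓ0 (Nat.cast_nonneg κ)
    hc₁0 hK0 hQ0 hP0.le (Real.sqrt_nonneg _) p1 p4 p5 hlog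
  have hr := one_le_sqrt_inv_mul hh0 hmesh hh₀
  have c3 : a₁ * (P * K * Q) ≤ a₁ * (√|Real.log h₀|)⁻¹ * (P * R * K * Q) :=
    (le_mul_of_one_le_right (by positivity) hr).trans_eq (by ring)
  exact (htri.trans (add_le_add (c1.trans c3) c2)).trans_eq (by ring)

end RTMixed

end


theorem corollary3p7 (Ω : Set RTMixed.Plane) (hΩ : RTMixed.IsLipschitzPolygon Ω)
    (α σ γ : ℝ) (hγ : 1 ≤ γ)
    (μ c M h₀ : ℝ) (κ : ℕ) (hμ : 0 < μ) (hc : 0 < c) (hh₀ : h₀ < 1) :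
    ∃ C : ℝ, 0 < C ∧ ∀ T : RTMixed.Triangulation Ω,
      T.meshSize ≤ h₀ →
      T.ShapeRegular μ →
      (∀ τ ∈ T.elems, c * T.meshSize ^ γ ≤ Metric.diam τ.carrier) →
      T.AlphaSigmaCondition α σ M κ →
      ∀ p : RTMixed.Plane → RTMixed.Plane, RTMixed.MemW2InfVec Ω p →
      ∀ r : RTMixed.Plane → RTMixed.Plane, T.IsRTInterpolant p r →
      ∀ w ∈ T.continuousPiecewiseLinear,
        |∫ x in Ω, inner ℝ (p x - r x) (RTMixed.curl w x)| ≤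
          C * T.meshSize ^ (1 + min 1 (min (1 + α - γ) (σ / 2))) *
            |Real.log T.meshSize| ^ (1 / 2 : ℝ) *
            RTMixed.gradNorm1Inf Ω p * RTMixed.l2Norm Ω (RTMixed.curl w) := by
  -- For `h₀ ≤ 0` no triangulation qualifies, since the mesh size is positive.
  rcases le_or_gt h₀ 0 with h0 | h0
  · exact ⟨1, one_pos, fun T hT => absurd (hT.trans h0) (not_le.2 (T.meshSize_pos hΩ))⟩
  obtain ⟨C, hC0, hC⟩ := hΩ.exists_superconvergence_bound α σ M κ hγ hμ hc hh₀ h0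
  refine ⟨C + 1, by linarith, fun T h1 h2 h3 h4 p hp r hr w hw => ?_⟩
  refine (hC T h1 h2 h3 h4 p hp r hr w hw).trans ?_
  have hm := (T.meshSize_pos hΩ).le
  have hK : 0 ≤ RTMixed.gradNorm1Inf Ω p := ENNReal.toReal_nonneg
  have hQ : 0 ≤ RTMixed.l2Norm Ω (RTMixed.curl w) := ENNReal.toReal_nonneg
  gcongr
  linarith
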